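/- Let $\Sigma$ be a closed connected surface (a compact connected Hausdorff topological $2$-manifold without boundary), for example the closed orientable surface $\Sigma_g$ of genus $g\ge 0$. Let $L=K_1\cup\dots\cup K_n$ $(n\ge 0)$ be a link diagram on $\Sigma$: the $K_i$ are closed curves $S^1\to\Sigma$ such that every point of their union has an open neighbourhood, homeomorphic to $\mathbb{R}^2$, in which the curves form either a single strand, traversed once, corresponding to the horizontal axis, or exactly two strands, each traversed once, one corresponding to the horizontal axis and the other to the vertical axis; moreover, at each double point one of the two strands is designated as the over-strand. The regions of $L$ are the connected components of $\Sigma\setminus(K_1\cup\dots\cup K_n)$. Two (possibly equal) regions are locally adjacent if some arc of $L$ has one of them on one side and the other on the other side, and $L$ is $2$-colorable (admits a checkerboard coloring) if its regions can be colored with two colors such that locally adjacent regions always receive distinct colors; in particular, no region is then locally adjacent to itself. Then $L$ is $2$-colorable if and only if $\sum_{i=1}^n [K_i]=0$ in the singular homology group $H_1(\Sigma;\mathbb{Z}/2)$, where $[K_i]$ is the class of the singular cycle given by going around $K_i$ once. -/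

import Mathlib

open CategoryTheory Simplicial

noncomputable section

universe u

namespace SurfaceLink

/-! ### First homology with mod 2 coefficients and the class of a closed curve -/

/-- The coefficient module `ℤ/2` (lifted to the universe of the space). -/
abbrev Coeff : ModuleCat.{u} (ZMod 2) := ModuleCat.of (ZMod 2) (ULift.{u} (ZMod 2))

/-- The singular homology group `H₁(X; ℤ/2)`. -/
abbrev H1 (X : Type u) [TopologicalSpace X] : ModuleCat.{u} (ZMod 2) :=
  ((AlgebraicTopology.singularHomologyFunctor (ModuleCat.{u} (ZMod 2)) 1).obj Coeff).obj
    (TopCat.of X)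

variable {X : Type u} [TopologicalSpace X]

/-- A closed curve `γ : ℝ/ℤ → X` as a singular `1`-simplex of `X`: going around the circle once,
the parameter `t ∈ [0, 1]` is sent to `γ t`. -/
def loopSimplex (γ : C(UnitAddCircle, X)) : (TopCat.toSSet.obj (TopCat.of X)) _⦋1⦌ :=
  (TopCat.toSSetObjEquiv (TopCat.of X) (.op ⦋1⦌)).symm
    ⟨fun s ↦ γ (((stdSimplexHomeomorphUnitInterval s : unitInterval) : ℝ) : UnitAddCircle), by
      fun_prop⟩

lemma loopSimplex_face_eq (γ : C(UnitAddCircle, X)) :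
    (TopCat.toSSet.obj (TopCat.of X)).δ 0 (loopSimplex γ) =
      (TopCat.toSSet.obj (TopCat.of X)).δ 1 (loopSimplex γ) := by
  have h0 (s : stdSimplex ℝ (Fin 1)) : stdSimplexHomeomorphUnitInterval
      (stdSimplex.map (SimplexCategory.δ (n := 0) 0) s) = 1 := by
    rw [← stdSimplexHomeomorphUnitInterval_one, Subsingleton.elim s (stdSimplex.vertex 0),
      stdSimplex.map_vertex]
    rfl
  have h1 (s : stdSimplex ℝ (Fin 1)) : stdSimplexHomeomorphUnitInterval
      (stdSimplex.map (SimplexCategory.δ (n := 0) 1) s) = 0 := by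
    rw [← stdSimplexHomeomorphUnitInterval_zero, Subsingleton.elim s (stdSimplex.vertex 0),
      stdSimplex.map_vertex]
    rfl
  apply (TopCat.toSSetObjEquiv (TopCat.of X) (.op ⦋0⦌)).injective
  ext s
  change γ (((stdSimplexHomeomorphUnitInterval
      (stdSimplex.map (SimplexCategory.δ (n := 0) 0) s) : unitInterval) : ℝ) : UnitAddCircle) =
    γ (((stdSimplexHomeomorphUnitInterval
      (stdSimplex.map (SimplexCategory.δ (n := 0) 1) s) : unitInterval) : ℝ) : UnitAddCircle)
  rw [h0, h1]
  congr 1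
  simp

lemma loopSimplex_isCycle (γ : C(UnitAddCircle, X)) :
    SSet.ιChainComplex (R := Coeff.{u}) _ (loopSimplex γ) ≫
      ((TopCat.toSSet.obj (TopCat.of X)).chainComplex Coeff.{u}).d 1 0 = 0 := by
  rw [SSet.ιChainComplex_d]
  simp [Fin.sum_univ_two, loopSimplex_face_eq]

/-- The homology class `[γ] ∈ H₁(X; ℤ/2)` of a closed curve `γ`: the class of the singular cycle
`1 • loopSimplex γ`. -/
def loopClass (γ : C(UnitAddCircle, X)) : H1 X :=
  (HomologicalComplex.liftCycles ((TopCat.toSSet.obj (TopCat.of X)).chainComplex Coeff.{u})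
      (SSet.ιChainComplex _ (loopSimplex γ)) 0 (by simp) (loopSimplex_isCycle γ) ≫
    HomologicalComplex.homologyπ _ 1).hom (ULift.up 1)

/-! ### Link diagrams -/

/-- The union of the images of finitely many closed curves is parametrized by
`Fin n × ℝ/ℤ`, the disjoint union of `n` circles. -/
def total {n : ℕ} (γ : Fin n → C(UnitAddCircle, X)) (s : Fin n × UnitAddCircle) : X :=
  γ s.1 s.2

/-- `e` maps an open set of `X` homeomorphically onto the plane, and in this open set the curves
form a single strand, traversed once, which corresponds to the horizontal axis. -/
structure IsArcChart {n : ℕ} (γ : Fin n → C(UnitAddCircle, X))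
    (e : OpenPartialHomeomorph X (EuclideanSpace ℝ (Fin 2))) : Prop where
  target_eq : e.target = Set.univ
  bijOn : Set.BijOn (total γ) (total γ ⁻¹' e.source) {x | x ∈ e.source ∧ e x 1 = 0}

/-- `e` maps an open set of `X` homeomorphically onto the plane, and in this open set the curves
form exactly two strands, each traversed once, which correspond to the horizontal axis and to the
vertical axis: two strands crossing transversely in one point. -/
structure IsCrossingChart {n : ℕ} (γ : Fin n → C(UnitAddCircle, X))
    (e : OpenPartialHomeomorph X (EuclideanSpace ℝ (Fin 2))) : Prop where
  target_eq : e.target = Set.univ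
  exists_strands : ∃ A B : Set (Fin n × UnitAddCircle), IsOpen A ∧ IsOpen B ∧ Disjoint A B ∧
    A ∪ B = total γ ⁻¹' e.source ∧
    Set.BijOn (total γ) A {x | x ∈ e.source ∧ e x 1 = 0} ∧
    Set.BijOn (total γ) B {x | x ∈ e.source ∧ e x 0 = 0}

/-- A link diagram `L = K₁ ∪ ⋯ ∪ Kₙ` on `X`: `n` closed curves whose only singularities are
transverse double points (near each of its points the union of the curves is either one flat strand
or two strands crossing transversely), together with a choice, at each double
point, of the strand that passes over, given by one of the two parameters of the double point. -/
structure LinkDiagram (X : Type u) [TopologicalSpace X] (n : ℕ) where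
  curve : Fin n → C(UnitAddCircle, X)
  generic : ∀ p ∈ Set.range (total curve),
    ∃ e : OpenPartialHomeomorph X (EuclideanSpace ℝ (Fin 2)),
      p ∈ e.source ∧ (IsArcChart curve e ∨ IsCrossingChart curve e)
  upper : {p : X // ∃ s t, s ≠ t ∧ total curve s = p ∧ total curve t = p} → Fin n × UnitAddCircle
  total_upper : ∀ p, total curve (upper p) = p

namespace LinkDiagram

variable {n : ℕ} (L : LinkDiagram X n)

/-- The projection of the diagram, as a subset of `X`. -/
def support : Set X := Set.range (total L.curve)

/-- The regions of the diagram: the connected components of the complement of its projection. -/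
abbrev Region : Type u := ConnectedComponents ↥(L.supportᶜ)

/-- The regions `R` and `R'` are locally adjacent: somewhere, an arc of the diagram has
`R` on one side and `R'` on the other. A region may be locally adjacent to itself. -/
def LocallyAdjacent (R R' : L.Region) : Prop :=
  ∃ e : OpenPartialHomeomorph X (EuclideanSpace ℝ (Fin 2)), IsArcChart L.curve e ∧
    (∀ x : ↥(L.supportᶜ), x.1 ∈ e.source → 0 < e x.1 1 → ConnectedComponents.mk x = R) ∧
    (∀ x : ↥(L.supportᶜ), x.1 ∈ e.source → e x.1 1 < 0 → ConnectedComponents.mk x = R')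

/-- The diagram admits a checkerboard coloring: the regions can be colored with two colors such
that locally adjacent regions receive distinct colors. -/
def TwoColorable : Prop :=
  ∃ c : L.Region → Bool, ∀ R R', L.LocallyAdjacent R R' → c R ≠ c R'

end LinkDiagram

end SurfaceLink

end

open CategoryTheory Simplicial

noncomputable section

universe u

namespace SurfaceLink

open Topology Filter

/-! ### Mod 2 one-forms

A mod 2 one-form assigns to each point `x` a function with values in `ℤ/2`, of which only the
germ at `x`, up to an additive constant, matters. -/

/-! Both conditions are compared with a third: every closed mod 2 one-form has total period zero
along the diagram. A form is a family of germs of `ℤ/2`-valued functions modulo constants. Closed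
forms play the role of 1-cocycles, but they are local objects that can be cut, glued and given point
singularities.

Homology. Over a field, a class in `H₁` vanishes as soon as all cocycles vanish on it
(`sum_loopClass_eq_zero_iff`). A closed form has a primitive along every singular simplex, and its
end-point differences form a cocycle with the same periods (`exists_isCocycle`). Conversely, on a
surface a cocycle evaluated on rays in discs gives a closed form (`IsCocycle.exists_form`).

Singularities. A form that is closed on a punctured disc has a residue in `ℤ/2`, the monodromy of
its primitives around the puncture. The basic example is `segmentForm`, dual to a segment in a disc:
its residue is `1` at both ends, and its periods count crossings with the segment.

From zero periods to a coloring (`twoColorable_of_integral_eq_zero`). Two points off the diagram are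
the only poles of some sum of segment forms. The integral of such a sum along the diagram depends
only on the two points, because two choices differ by a form without residues, that is, by a closed
form up to removable singularities. The integral from a base point is the color: it is constant on
regions, and it changes by `1` across an arc because a short transverse segment meets the diagram
once.

From a coloring to zero periods (`IsColoring.integral_eq_zero`). More generally, for a form with
finitely many singularities, all off the diagram, the integral along the diagram is the sum of the
residues weighted by the color. For a segment form in a disc around an arc or a crossing this is a
direct count. A form with a global primitive has neither integrals nor residues. The general case
reduces to these two: the surface is covered by finitely many discs, and on one disc after the other
the form is changed by segment forms along a fine grid until it has a primitive there too
(`ResidueFormulaNear.of_union`). A closed form has no residues, so its integral is zero. -/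

/-- A mod 2 one-form on `X`: near each point `x`, it is the differential of `ω x`. -/
abbrev Form (X : Type*) := X → X → ZMod 2

lemma add_self_zmod (a : ZMod 2) : a + a = 0 := CharTwo.add_self_eq_zero a

section Form

variable {X Y : Type*} [TopologicalSpace X] [TopologicalSpace Y]

/-- The form `ω` is closed at `x`: near `x`, it is the differential of the single function `ω x`. -/
def ClosedAt (ω : Form X) (x : X) : Prop :=
  ∀ᶠ y in 𝓝 x, ∀ᶠ z in 𝓝 y, ω x z + ω y z = ω x y + ω y y

/-- On `S`, the form `ω` is the differential of the function `F`. -/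
def IsPrimitiveOn (ω : Form X) (F : X → ZMod 2) (S : Set X) : Prop :=
  ∀ x ∈ S, ∀ᶠ z in 𝓝[S] x, F z + ω x z = F x + ω x x

/-- Near `x`, the form `ω` is the differential of the function `F`. -/
def PrimitiveAt (ω : Form X) (F : X → ZMod 2) (x : X) : Prop :=
  ∀ᶠ z in 𝓝 x, F z + ω x z = F x + ω x x

/-- The pullback of a form. -/
def Form.pullback (ω : Form X) (p : Y → X) : Form Y := fun s t ↦ ω (p s) (p t)

variable {ω η : Form X} {F G : X → ZMod 2} {S T : Set X} {x : X}

lemma closedAt_iff : ClosedAt ω x ↔ ∀ᶠ y in 𝓝 x, PrimitiveAt ω (ω x) y := Iff.rfl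

lemma closedAt_zero : ClosedAt (0 : Form X) x := by simp [ClosedAt]

lemma ClosedAt.add (h : ClosedAt ω x) (h' : ClosedAt η x) : ClosedAt (ω + η) x := by
  filter_upwards [h, h'] with y hy hy'
  filter_upwards [hy, hy'] with z hz hz'
  simp only [Pi.add_apply]
  linear_combination hz + hz'

lemma ClosedAt.sum {ι : Type*} {s : Finset ι} {ω : ι → Form X} (h : ∀ i ∈ s, ClosedAt (ω i) x) :
    ClosedAt (∑ i ∈ s, ω i) x := by
  classical
  induction s using Finset.induction_on with
  | empty => exact closedAt_zero
  | insert i s hi ih =>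
    rw [Finset.sum_insert hi]
    exact (h i (by simp)).add (ih fun j hj ↦ h j (by simp [hj]))

lemma ClosedAt.pullback {p : Y → X} (hp : Continuous p) {t : Y} (h : ClosedAt ω (p t)) :
    ClosedAt (ω.pullback p) t := by
  filter_upwards [hp.continuousAt.eventually h] with y hy
  exact hp.continuousAt.eventually hy

lemma PrimitiveAt.add (h : PrimitiveAt ω F x) (h' : PrimitiveAt η G x) :
    PrimitiveAt (ω + η) (F + G) x := by
  filter_upwards [h, h'] with z hz hz'
  simp only [Pi.add_apply]
  linear_combination hz + hz'

lemma ClosedAt.primitiveAt_self (ω : Form X) (x : X) : PrimitiveAt ω (ω x) x :=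
  .of_forall fun z ↦ by rw [add_self_zmod, add_self_zmod]

lemma IsPrimitiveOn.add (h : IsPrimitiveOn ω F S) (h' : IsPrimitiveOn η G S) :
    IsPrimitiveOn (ω + η) (F + G) S := by
  intro x hx
  filter_upwards [h x hx, h' x hx] with z hz hz'
  simp only [Pi.add_apply]
  linear_combination hz + hz'

lemma IsPrimitiveOn.mono (h : IsPrimitiveOn ω F S) (hT : T ⊆ S) : IsPrimitiveOn ω F T :=
  fun x hx ↦ nhdsWithin_mono _ hT (h x (hT hx))

lemma PrimitiveAt.pullback {p : Y → X} (hp : Continuous p) {t : Y} (h : PrimitiveAt ω F (p t)) :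
    PrimitiveAt (ω.pullback p) (F ∘ p) t :=
  hp.continuousAt.eventually h

lemma PrimitiveAt.isPrimitiveOn (h : ∀ x ∈ S, PrimitiveAt ω F x) : IsPrimitiveOn ω F S :=
  fun x hx ↦ nhdsWithin_le_nhds (h x hx)

lemma IsPrimitiveOn.primitiveAt (h : IsPrimitiveOn ω F S) (hS : S ∈ 𝓝 x) : PrimitiveAt ω F x := by
  have := h x (mem_of_mem_nhds hS)
  rwa [nhdsWithin_eq_nhds.2 hS] at this

lemma IsPrimitiveOn.congr_fun (h : IsPrimitiveOn ω F S) (hG : Set.EqOn G F S) :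
    IsPrimitiveOn ω G S := by
  intro x hx
  filter_upwards [h x hx, eventually_mem_nhdsWithin] with z hz hzS
  rw [hG hzS, hG hx, hz]

lemma IsPrimitiveOn.add_const (h : IsPrimitiveOn ω F S) (c : ZMod 2) :
    IsPrimitiveOn ω (fun x ↦ F x + c) S := by
  intro x hx
  filter_upwards [h x hx] with z hz
  linear_combination hz

/-- Two functions with the same differential differ by a constant. -/
lemma IsPrimitiveOn.add_eq_add (hS : IsPreconnected S) (hF : IsPrimitiveOn ω F S)
    (hG : IsPrimitiveOn ω G S) {x y : X} (hx : x ∈ S) (hy : y ∈ S) : F x + G x = F y + G y := by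
  refine hS.induction₂ (fun x y ↦ F x + G x = F y + G y) (fun x hx ↦ ?_)
    (fun _ _ _ _ _ _ h h' ↦ h.trans h') (fun _ _ _ _ h ↦ h.symm) hx hy
  filter_upwards [hF x hx, hG x hx] with z hz hz'
  have e1 := add_self_zmod (ω x z)
  have e2 := add_self_zmod (ω x x)
  linear_combination -hz - hz' + e1 - e2

/-- Primitives on two closed sets with connected intersection can be glued. -/
lemma exists_isPrimitiveOn_union (hS : IsClosed S) (hT : IsClosed T)
    (hST : IsPreconnected (S ∩ T)) (hF : IsPrimitiveOn ω F S) (hG : IsPrimitiveOn ω G T) :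
    ∃ H, IsPrimitiveOn ω H (S ∪ T) := by
  classical
  obtain ⟨c, hc⟩ : ∃ c, ∀ x ∈ S ∩ T, G x + c = F x := by
    rcases (S ∩ T).eq_empty_or_nonempty with h | ⟨y, hy⟩
    · exact ⟨0, by simp [h]⟩
    · refine ⟨F y + G y, fun x hx ↦ ?_⟩
      rw [← (hF.mono Set.inter_subset_left).add_eq_add hST (hG.mono Set.inter_subset_right) hx hy]
      linear_combination add_self_zmod (G x)
  have hG' := hG.add_const c
  set H : X → ZMod 2 := fun x ↦ if x ∈ S then F x else G x + c with hH
  have hHS : Set.EqOn H F S := fun x hx ↦ by simp [hH, hx]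
  have hHT : Set.EqOn H (fun x ↦ G x + c) T := fun x hx ↦ by
    by_cases h : x ∈ S
    · simp [hH, h, hc x ⟨h, hx⟩]
    · simp [hH, h]
  have h1 := hF.congr_fun hHS
  have h2 := hG'.congr_fun hHT
  refine ⟨H, fun x hx ↦ ?_⟩
  rw [nhdsWithin_union, eventually_sup]
  constructor
  · by_cases h : x ∈ S
    · exact h1 x h
    · have := hS.isOpen_compl.mem_nhds h
      filter_upwards [eventually_mem_nhdsWithin, nhdsWithin_le_nhds this] with z hz hz'
      exact absurd hz hz'
  · by_cases h : x ∈ T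
    · exact h2 x h
    · have := hT.isOpen_compl.mem_nhds h
      filter_upwards [eventually_mem_nhdsWithin, nhdsWithin_le_nhds this] with z hz hz'
      exact absurd hz hz'

/-- The relation "there is a primitive on the interval between `s` and `t`" holds for nearby points
by closedness and is transitive by gluing, so connectedness of `[0, 1]` gives it for `0` and `1`. -/
lemma exists_primitive_unitInterval {ω : Form unitInterval} (h : ∀ t, ClosedAt ω t) :
    ∃ F, IsPrimitiveOn ω F Set.univ := by
  have key : ∃ F, IsPrimitiveOn ω F (Set.uIcc (0 : unitInterval) 1) := by
    refine isPreconnected_univ.induction₂ (fun s t ↦ ∃ F, IsPrimitiveOn ω F (Set.uIcc s t))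
      (fun s _ ↦ ?_) ?_ ?_ (Set.mem_univ _) (Set.mem_univ _)
    · rw [nhdsWithin_univ]
      have h1 : Tendsto (fun t ↦ Set.uIcc s t) (𝓝 s) (𝓝 s).smallSets :=
        tendsto_const_nhds.uIcc tendsto_id
      filter_upwards [h1.eventually (eventually_smallSets.2 ⟨_, h s, fun t ht ↦ ht⟩)] with t ht
      exact ⟨ω s, PrimitiveAt.isPrimitiveOn fun x hx ↦ ht hx⟩
    · rintro r s t - - - ⟨F, hF⟩ ⟨G, hG⟩
      obtain ⟨H, hH⟩ := exists_isPrimitiveOn_union isClosed_Icc isClosed_Icc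
        (Set.OrdConnected.isPreconnected (Set.ordConnected_Icc.inter Set.ordConnected_Icc)) hF hG
      exact ⟨H, hH.mono Set.uIcc_subset_uIcc_union_uIcc⟩
    · rintro s t - - h
      rwa [Set.uIcc_comm]
  have e : Set.uIcc (0 : unitInterval) 1 = Set.univ := by
    rw [Set.uIcc_of_le zero_le_one]
    ext t
    simp [unitInterval.le_one']
  rwa [e] at key

/-- A function which is a primitive along the fibres `{y} × [0, 1]` and along `Y × {0}` is a
primitive. -/
lemma primitiveAt_of_fibrewise {ω : Form (Y × unitInterval)} (h : ∀ p, ClosedAt ω p)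
    {G : Y × unitInterval → ZMod 2}
    (hG : ∀ y, IsPrimitiveOn (ω.pullback (Prod.mk y)) (fun t ↦ G (y, t)) Set.univ)
    (hG0 : ∀ y, ∀ᶠ y' in 𝓝 y, G (y', 0) + ω (y, 0) (y', 0) = G (y, 0) + ω (y, 0) (y, 0))
    (p : Y × unitInterval) : PrimitiveAt ω G p := by
  obtain ⟨y, s⟩ := p
  -- near `(y, s)`, the function `G` agrees with `ω (y, s)` up to a constant if it does so on one
  -- slice `Y × {t}`
  have key (s : unitInterval) : ∀ᶠ t in 𝓝 s,
      (∀ᶠ y' in 𝓝 y, G (y', t) + ω (y, s) (y', t) = G (y, t) + ω (y, s) (y, t)) →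
      ∀ᶠ t' in 𝓝 s, PrimitiveAt ω G (y, t') := by
    obtain ⟨U, hU, V, hV, hUV⟩ := mem_nhds_prod_iff.1 (h (y, s))
    have h1 : Tendsto (fun t ↦ Set.uIcc s t) (𝓝 s) (𝓝 s).smallSets :=
      tendsto_const_nhds.uIcc tendsto_id
    have h2 := h1.eventually (eventually_smallSets.2 ⟨V, hV, fun t ht ↦ ht⟩)
    filter_upwards [h2] with t ht hyt
    -- The vertical segment from `(y', t')` to `(y', t)` stays where `ω` is the differential of `ω
    -- (y, s)`, so `G` and `ω (y, s)` differ by a constant along it. This carries agreement from the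
    -- slice `t` to every slice `t'` near `s`.
    have h3 : ∀ᶠ t' in 𝓝 s, ∀ y' ∈ U, G (y', t') + ω (y, s) (y', t') =
        G (y', t) + ω (y, s) (y', t) := by
      filter_upwards [h2] with t' ht' y' hy'
      have sub : Set.uIcc t' t ⊆ V :=
        Set.uIcc_subset_uIcc_union_uIcc.trans (Set.union_subset (Set.uIcc_comm s t' ▸ ht') ht)
      refine ((hG y').mono (Set.subset_univ (Set.uIcc t' t))).add_eq_add isPreconnected_uIcc
        (G := fun t ↦ ω (y, s) (y', t)) (fun τ hτ ↦ ?_) Set.left_mem_uIcc Set.right_mem_uIcc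
      have h4 : PrimitiveAt ω (ω (y, s)) (y', τ) := hUV ⟨hy', sub hτ⟩
      exact nhdsWithin_le_nhds
        (((Continuous.prodMk_right y').continuousAt (x := τ)).eventually h4)
    have h5 : ∀ᶠ t' in 𝓝 s, ∀ᶠ z in 𝓝 (y, t'), G z + ω (y, s) z =
        G (y, t') + ω (y, s) (y, t') := by
      filter_upwards [eventually_eventually_nhds.2 h3] with t' ht'
      rw [nhds_prod_eq]
      filter_upwards [hyt.prod_mk ht', (eventually_mem_set.2 hU).prod_mk ht'] with z hz hz'
      rw [hz.2 z.1 hz'.1, hz.1, ht'.self_of_nhds y (mem_of_mem_nhds hU)]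
    filter_upwards [h5, (Continuous.prodMk_right y).continuousAt.eventually (h (y, s))]
      with t' ht' ht''
    filter_upwards [ht', ht''] with z hz hz'
    have e := add_self_zmod (ω (y, s) z)
    have e' := add_self_zmod (ω (y, s) (y, t'))
    linear_combination hz + hz' - e + e'
  -- A primitive at `(y, t)` restricts to the slice condition that `key` takes as input.
  have conv {s t : unitInterval} (hc : PrimitiveAt ω (ω (y, s)) (y, t))
      (hp : PrimitiveAt ω G (y, t)) :
      ∀ᶠ y' in 𝓝 y, G (y', t) + ω (y, s) (y', t) = G (y, t) + ω (y, s) (y, t) := by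
    have := ((Continuous.prodMk_left t).continuousAt (x := y)).eventually (hp.and hc)
    filter_upwards [this] with y' hy'
    obtain ⟨h1, h2⟩ := hy'
    have e := add_self_zmod (ω (y, t) (y', t))
    have e' := add_self_zmod (ω (y, t) (y, t))
    linear_combination h1 + h2 - e + e'
  have zero : PrimitiveAt ω G (y, 0) := ((key 0).self_of_nhds (hG0 y)).self_of_nhds
  -- Being a primitive at `(y, s)` is a locally constant property of `s`, so it spreads from `s = 0`
  -- over the connected interval.
  have prop (s : unitInterval) : ∀ᶠ t in 𝓝 s,
      (PrimitiveAt ω G (y, s) ↔ PrimitiveAt ω G (y, t)) := by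
    have h1 : ∀ᶠ t in 𝓝 s, PrimitiveAt ω (ω (y, s)) (y, t) :=
      (Continuous.prodMk_right y).continuousAt.eventually (h (y, s))
    have h2 : ∀ᶠ t in 𝓝 s, PrimitiveAt ω G (y, s) → PrimitiveAt ω G (y, t) := by
      by_cases hs : PrimitiveAt ω G (y, s)
      · filter_upwards [(key s).self_of_nhds (conv h1.self_of_nhds hs)] with t ht _ using ht
      · simp [hs]
    filter_upwards [h1, h2, key s] with t h1t h2t hkt
    exact ⟨h2t, fun hp ↦ (hkt (conv h1t hp)).self_of_nhds⟩
  have := isPreconnected_univ.induction₂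
    (fun s t ↦ (PrimitiveAt ω G (y, s) ↔ PrimitiveAt ω G (y, t)))
    (fun s _ ↦ by simpa only [nhdsWithin_univ] using prop s)
    (fun _ _ _ _ _ _ h h' ↦ h.trans h') (fun _ _ _ _ h ↦ h.symm) (Set.mem_univ 0) (Set.mem_univ s)
  exact this.1 zero

/-- A closed form on a contractible space has a primitive. -/
theorem exists_primitive_of_contractible [ContractibleSpace X] (h : ∀ x, ClosedAt ω x) :
    ∃ F, ∀ x, PrimitiveAt ω F x := by
  obtain ⟨x₀, ⟨H⟩⟩ := id_nullhomotopic X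
  obtain ⟨k, hk, hk0, hk1⟩ : ∃ k : X × unitInterval → X, Continuous k ∧ (∀ y, k (y, 0) = x₀) ∧
      ∀ y, k (y, 1) = y :=
    ⟨fun p ↦ H.symm (p.2, p.1), by fun_prop, fun y ↦ H.symm.apply_zero y,
      fun y ↦ H.symm.apply_one y⟩
  have hcl (p) : ClosedAt (ω.pullback k) p := (h _).pullback hk
  have hex (y : X) : ∃ F, IsPrimitiveOn ((ω.pullback k).pullback (Prod.mk y)) F Set.univ :=
    exists_primitive_unitInterval fun t ↦ (hcl _).pullback (Continuous.prodMk_right y)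
  choose F hF using hex
  -- The fibrewise primitives are normalized to vanish at time `0`. There the contraction `k` is
  -- constant, so the pulled-back form is trivial along that slice and the initial condition holds.
  have hG := primitiveAt_of_fibrewise hcl (G := fun p ↦ F p.1 p.2 + F p.1 0)
    (fun y ↦ (hF y).add_const (F y 0)) (fun y ↦ by
      refine .of_forall fun y' ↦ ?_
      change F y' 0 + F y' 0 + ω (k (y, 0)) (k (y', 0)) = F y 0 + F y 0 + ω (k (y, 0)) (k (y, 0))
      rw [add_self_zmod, add_self_zmod, hk0, hk0])
  refine ⟨fun x ↦ F x 1 + F x 0, fun x ↦ ?_⟩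
  have := ((Continuous.prodMk_left (1 : unitInterval)).continuousAt (x := x)).eventually (hG (x, 1))
  refine this.mono fun z hz ↦ ?_
  change F z 1 + F z 0 + ω (k (x, 1)) (k (z, 1)) = F x 1 + F x 0 + ω (k (x, 1)) (k (x, 1)) at hz
  rwa [hk1, hk1] at hz

/-- A form which is closed on the contractible subspace `S` has a primitive on `S`. -/
theorem exists_isPrimitiveOn [ContractibleSpace S] (h : ∀ x ∈ S, ClosedAt ω x) :
    ∃ F, IsPrimitiveOn ω F S := by
  obtain ⟨F, hF⟩ := exists_primitive_of_contractible (X := S) (ω := ω.pullback Subtype.val)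
    fun x ↦ (h x x.2).pullback continuous_subtype_val
  classical
  refine ⟨fun x ↦ if hx : x ∈ S then F ⟨x, hx⟩ else 0, fun x hx ↦ ?_⟩
  rw [nhdsWithin_eq_map_subtype_coe hx, eventually_map]
  filter_upwards [hF ⟨x, hx⟩] with z hz
  simpa [Form.pullback, hx] using hz

end Form

/-! ### First homology and cocycles on singular simplices -/

section Homology

variable {X : Type u} [TopologicalSpace X]

/-- The inclusion of a face of the standard triangle. -/
def triangleFace (i : Fin 3) : C(stdSimplex ℝ (Fin 2), stdSimplex ℝ (Fin 3)) :=
  ⟨stdSimplex.map i.succAbove, stdSimplex.continuous_map _⟩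

/-- The singular `1`-simplex which runs through a closed curve once. -/
def loopPath (γ : C(UnitAddCircle, X)) : C(stdSimplex ℝ (Fin 2), X) :=
  ⟨fun s ↦ γ (((stdSimplexHomeomorphUnitInterval s : unitInterval) : ℝ) : UnitAddCircle), by
    fun_prop⟩

/-- A function on singular `1`-simplices that vanishes on the boundaries of `2`-simplices. -/
def IsCocycle (w : C(stdSimplex ℝ (Fin 2), X) → ZMod 2) : Prop :=
  ∀ σ : C(stdSimplex ℝ (Fin 3), X), ∑ i, w (σ.comp (triangleFace i)) = 0

variable (X) in
/-- The singular chain complex of `X` with coefficients `ℤ/2`. -/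
abbrev chains : ChainComplex (ModuleCat.{u} (ZMod 2)) ℕ :=
  (TopCat.toSSet.obj (TopCat.of X)).chainComplex Coeff.{u}

/-- The singular chain `1 • σ`. -/
def single {n : ℕ} (σ : (TopCat.toSSet.obj (TopCat.of X)) _⦋n⦌) : (chains X).X n :=
  (SSet.ιChainComplex (R := Coeff.{u}) _ σ).hom (ULift.up 1)

lemma d_single (σ : (TopCat.toSSet.obj (TopCat.of X)) _⦋2⦌) :
    ((chains X).d 2 1).hom (single σ) =
      ∑ i, single ((TopCat.toSSet.obj (TopCat.of X)).δ i σ) := by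
  have h := congrArg (fun f ↦ f.hom (ULift.up 1)) (SSet.ιChainComplex_d (R := Coeff.{u}) _ σ)
  have two (c : (chains X).X 1) : -c = c := by
    rw [neg_eq_iff_add_eq_zero, ← two_smul (ZMod 2) c, show (2 : ZMod 2) = 0 from rfl, zero_smul]
  refine h.trans ?_
  simp [Fin.sum_univ_three, single, two]

/-- The cycle of a closed curve. -/
def loopCycle (γ : C(UnitAddCircle, X)) : (chains X).cycles 1 :=
  (HomologicalComplex.liftCycles (chains X) (SSet.ιChainComplex _ (loopSimplex γ)) 0 (by simp)
    (loopSimplex_isCycle γ)).hom (ULift.up 1)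

lemma iCycles_loopCycle (γ : C(UnitAddCircle, X)) :
    ((chains X).iCycles 1).hom (loopCycle γ) = single (loopSimplex γ) :=
  congrArg (fun f : Coeff.{u} ⟶ _ ↦ f.hom (ULift.up (1 : ZMod 2)))
    (HomologicalComplex.liftCycles_i (chains X) _ _ _ _)

/-- The chain group is a coproduct of copies of `ℤ/2` indexed by the simplices, so a function on
simplices extends linearly. The hypothesis on triangles makes the extension vanish on boundaries. -/
lemma exists_chain_map (w : (TopCat.toSSet.obj (TopCat.of X)) _⦋1⦌ → ZMod 2)
    (hw : ∀ σ : (TopCat.toSSet.obj (TopCat.of X)) _⦋2⦌,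
      ∑ i, w ((TopCat.toSSet.obj (TopCat.of X)).δ i σ) = 0) :
    ∃ φ : (chains X).X 1 ⟶ Coeff.{u}, (chains X).d 2 1 ≫ φ = 0 ∧
      ∀ σ, φ.hom (single σ) = ULift.up (w σ) := by
  let φ : (chains X).X 1 ⟶ Coeff.{u} :=
    (SSet.isColimitChainComplexXCofan (TopCat.toSSet.obj (TopCat.of X)) Coeff.{u} 1).desc
      (Limits.Cofan.mk _ fun σ ↦ w σ • 𝟙 Coeff.{u})
  have hφ (σ) : SSet.ιChainComplex (R := Coeff.{u}) _ σ ≫ φ = w σ • 𝟙 Coeff.{u} :=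
    (SSet.isColimitChainComplexXCofan (TopCat.toSSet.obj (TopCat.of X)) Coeff.{u} 1).fac _ ⟨σ⟩
  have hφ' (σ) : φ.hom (single σ) = ULift.up (w σ) := by
    refine (congrArg (fun f ↦ f.hom (ULift.up 1)) (hφ σ)).trans ?_
    change w σ • (ULift.up 1 : ULift (ZMod 2)) = _
    ext
    simp
  refine ⟨φ, ?_, hφ'⟩
  refine SSet.chainComplex_hom_ext fun σ ↦ ?_
  have h1 : φ.hom (((chains X).d 2 1).hom (single σ)) = 0 := by
    rw [d_single, map_sum]
    simp_rw [hφ']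
    have := hw σ
    ext
    rw [Fin.sum_univ_three] at this ⊢
    exact this
  rw [Limits.comp_zero]
  refine ModuleCat.hom_ext (LinearMap.ext fun a ↦ ?_)
  have ha : a = a.down • (ULift.up 1 : ULift.{u} (ZMod 2)) := by
    ext
    simp
  rw [ha, map_smul, map_smul]
  exact congrArg _ h1

lemma sum_loopClass_eq_zero_iff_sum_loopCycle {n : ℕ} (γ : Fin n → C(UnitAddCircle, X)) :
    ∑ i, loopClass (γ i) = 0 ↔ ((chains X).homologyπ 1).hom (∑ i, loopCycle (γ i)) = 0 := by
  rw [map_sum]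
  rfl

/-- A cochain vanishing on boundaries descends to homology, which gives one direction. For the
other, linear functionals detect zero over the field `ℤ/2`, and each functional on `H₁` comes from a
cochain. -/
theorem sum_loopClass_eq_zero_iff {n : ℕ} (γ : Fin n → C(UnitAddCircle, X)) :
    ∑ i, loopClass (γ i) = 0 ↔ ∀ w : C(stdSimplex ℝ (Fin 2), X) → ZMod 2, IsCocycle w →
      ∑ i, w (loopPath (γ i)) = 0 := by
  rw [sum_loopClass_eq_zero_iff_sum_loopCycle]
  constructor
  · intro h w hw
    obtain ⟨φ, hφ, hφw⟩ := exists_chain_map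
      (fun σ ↦ w (TopCat.toSSetObjEquiv (TopCat.of X) _ σ))
      (fun σ ↦ hw (TopCat.toSSetObjEquiv (TopCat.of X) (.op ⦋2⦌) σ))
    have h1 (c : (chains X).cycles 1) : φ.hom (((chains X).iCycles 1).hom c) =
        ((chains X).homologyι 1 ≫ (chains X).descOpcycles φ 2 (by simp) hφ).hom
          (((chains X).homologyπ 1).hom c) := by
      have : (chains X).homologyπ 1 ≫ (chains X).homologyι 1 ≫
          (chains X).descOpcycles φ 2 (by simp) hφ = (chains X).iCycles 1 ≫ φ := by
        simp
      exact (congrArg (fun f ↦ f.hom c) this).symm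
    have h2 : ∑ i, φ.hom (single (loopSimplex (γ i))) = 0 := by
      simp_rw [← iCycles_loopCycle]
      rw [← map_sum, ← map_sum, h1, h, map_zero]
    have h3 := congrArg ULift.down h2
    simp_rw [hφw] at h3
    have h4 (s : Finset (Fin n)) (f : Fin n → ZMod 2) :
        (∑ i ∈ s, (ULift.up (f i) : ULift.{u} (ZMod 2))).down = ∑ i ∈ s, f i :=
      map_sum (ULift.moduleEquiv (R := ZMod 2) (M := ZMod 2)) _ _
    exact (h4 _ _).symm.trans h3
  · intro h
    rw [← Module.forall_dual_apply_eq_zero_iff (ZMod 2)]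
    intro ψ
    have inj : Function.Injective ((chains X).iCycles 1).hom :=
      (ModuleCat.mono_iff_injective _).1 inferInstance
    -- The cycles split off the chains, so `r` extends a functional on cycles to all chains.
    obtain ⟨r, hr⟩ := LinearMap.exists_leftInverse_of_injective ((chains X).iCycles 1).hom
      (LinearMap.ker_eq_bot.2 inj)
    let φ : (chains X).X 1 →ₗ[ZMod 2] ZMod 2 := ψ ∘ₗ ((chains X).homologyπ 1).hom ∘ₗ r
    have hφ (c : (chains X).cycles 1) :
        φ (((chains X).iCycles 1).hom c) = ψ (((chains X).homologyπ 1).hom c) := by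
      change ψ (((chains X).homologyπ 1).hom (r (((chains X).iCycles 1).hom c))) = _
      rw [show r (((chains X).iCycles 1).hom c) = c from LinearMap.congr_fun hr c]
    have hd (c : (chains X).X 2) : φ (((chains X).d 2 1).hom c) = 0 := by
      have e : (chains X).toCycles 2 1 ≫ (chains X).iCycles 1 = (chains X).d 2 1 :=
        HomologicalComplex.toCycles_i _ _ _
      have e' : (chains X).toCycles 2 1 ≫ (chains X).homologyπ 1 = 0 := by simp
      rw [← e]
      refine (hφ _).trans ?_
      have := congrArg (fun f ↦ f.hom c) e'
      exact (congrArg ψ this).trans (map_zero _)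
    have := h (fun σ ↦ φ (single ((TopCat.toSSetObjEquiv (TopCat.of X) (.op ⦋1⦌)).symm σ)))
      (fun σ ↦ by
        rw [← map_sum]
        refine Eq.trans (congrArg φ ?_)
          (hd (single ((TopCat.toSSetObjEquiv (TopCat.of X) (.op ⦋2⦌)).symm σ)))
        rw [d_single]
        rfl)
    rw [← hφ, map_sum, map_sum]
    simp_rw [iCycles_loopCycle]
    exact this

end Homology

/-! ### Periods of forms, and the comparison with homology -/

section Period

variable {X : Type u} [TopologicalSpace X]

/-- The lift of a closed curve to the real line. -/
def unroll (γ : C(UnitAddCircle, X)) : C(ℝ, X) := ⟨fun t ↦ γ (t : UnitAddCircle), by fun_prop⟩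

open Classical in
/-- The integral of a form along a closed curve. -/
def period (ω : Form X) (γ : C(UnitAddCircle, X)) : ZMod 2 :=
  if h : ∃ F : ℝ → ZMod 2, ∀ t, PrimitiveAt (ω.pullback (unroll γ)) F t then
    h.choose 1 + h.choose 0 else 0

variable {ω η : Form X} {γ : C(UnitAddCircle, X)}

lemma exists_primitive_unroll (h : ∀ s, ClosedAt ω (γ s)) :
    ∃ F : ℝ → ZMod 2, ∀ t, PrimitiveAt (ω.pullback (unroll γ)) F t :=
  exists_primitive_of_contractible fun t ↦ ClosedAt.pullback (unroll γ).continuous (h t)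

/-- Primitives on the connected interval `[0, 1]` differ by constants, so the one chosen in the
definition of `period` may be replaced by any other. -/
lemma period_eq (h : ∀ s, ClosedAt ω (γ s)) {F : ℝ → ZMod 2}
    (hF : IsPrimitiveOn (ω.pullback (unroll γ)) F (Set.Icc 0 1)) : period ω γ = F 1 + F 0 := by
  have hex := exists_primitive_unroll h
  rw [period, dif_pos hex]
  have := (PrimitiveAt.isPrimitiveOn (S := Set.Icc (0 : ℝ) 1)
    fun t _ ↦ hex.choose_spec t).add_eq_add isPreconnected_Icc hF (Set.left_mem_Icc.2 zero_le_one)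
    (Set.right_mem_Icc.2 zero_le_one)
  linear_combination this + add_self_zmod (hex.choose 1) - add_self_zmod (F 0)

lemma period_add (h : ∀ s, ClosedAt ω (γ s)) (h' : ∀ s, ClosedAt η (γ s)) :
    period (ω + η) γ = period ω γ + period η γ := by
  obtain ⟨F, hF⟩ := exists_primitive_unroll h
  obtain ⟨G, hG⟩ := exists_primitive_unroll h'
  rw [period_eq h (PrimitiveAt.isPrimitiveOn fun t _ ↦ hF t),
    period_eq h' (PrimitiveAt.isPrimitiveOn fun t _ ↦ hG t),
    period_eq (fun s ↦ (h s).add (h' s)) (F := F + G)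
      (PrimitiveAt.isPrimitiveOn fun t _ ↦ (hF t).add (hG t))]
  simp only [Pi.add_apply]
  ring

lemma period_congr (h : ∀ s, ω (γ s) = η (γ s)) : period ω γ = period η γ := by
  have : ω.pullback (unroll γ) = η.pullback (unroll γ) := by
    ext s t
    simp only [Form.pullback, unroll, ContinuousMap.coe_mk, h]
  rw [period, period, this]

/-- A form with a primitive along a closed curve has zero period. -/
lemma period_eq_zero (h : ∀ s, ClosedAt ω (γ s)) {F : X → ZMod 2}
    (hF : ∀ s, PrimitiveAt ω F (γ s)) : period ω γ = 0 := by
  rw [period_eq h (F := F ∘ unroll γ) (PrimitiveAt.isPrimitiveOn fun t _ ↦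
    (hF t).pullback (unroll γ).continuous)]
  have : unroll γ 1 = unroll γ 0 := by
    simp only [unroll, ContinuousMap.coe_mk]
    congr 1
    simp
  simp only [Function.comp_apply, this]
  exact add_self_zmod _

instance (n : ℕ) : ContractibleSpace (stdSimplex ℝ (Fin (n + 1))) :=
  (convex_stdSimplex ℝ _).contractibleSpace ⟨_, single_mem_stdSimplex ℝ 0⟩

/-- A closed form defines a cocycle on singular `1`-simplices. -/
lemma exists_isCocycle (h : ∀ x, ClosedAt ω x) :
    ∃ w : C(stdSimplex ℝ (Fin 2), X) → ZMod 2, IsCocycle w ∧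
      ∀ γ, w (loopPath γ) = period ω γ := by
  have hex {m : ℕ} (σ : C(stdSimplex ℝ (Fin (m + 1)), X)) :=
    exists_primitive_of_contractible fun t ↦ (h (σ t)).pullback σ.continuous
  let w : C(stdSimplex ℝ (Fin 2), X) → ZMod 2 := fun σ ↦
    (hex σ).choose (stdSimplex.vertex 1) + (hex σ).choose (stdSimplex.vertex 0)
  have hw {σ : C(stdSimplex ℝ (Fin 2), X)} {F : stdSimplex ℝ (Fin 2) → ZMod 2}
      (hF : ∀ t, PrimitiveAt (ω.pullback σ) F t) :
      w σ = F (stdSimplex.vertex 1) + F (stdSimplex.vertex 0) := by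
    have := (PrimitiveAt.isPrimitiveOn fun t _ ↦ (hex σ).choose_spec t).add_eq_add
      isPreconnected_univ (PrimitiveAt.isPrimitiveOn fun t _ ↦ hF t)
      (Set.mem_univ (stdSimplex.vertex 1)) (Set.mem_univ (stdSimplex.vertex 0))
    dsimp only [w]
    linear_combination this + add_self_zmod ((hex σ).choose (stdSimplex.vertex 0)) -
      add_self_zmod (F (stdSimplex.vertex 1))
  refine ⟨w, fun σ ↦ ?_, fun γ ↦ ?_⟩
  -- One primitive on the triangle serves all three faces, and each vertex is an end of two of them.
  · obtain ⟨F, hF⟩ := hex σ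
    have h1 (i : Fin 3) : w (σ.comp (triangleFace i)) =
        F (stdSimplex.vertex (i.succAbove 1)) + F (stdSimplex.vertex (i.succAbove 0)) := by
      rw [hw (σ := σ.comp (triangleFace i)) (F := F ∘ triangleFace i) fun t ↦
        (hF _).pullback (triangleFace i).continuous]
      simp [triangleFace, stdSimplex.map_vertex]
    rw [Fin.sum_univ_three, h1, h1, h1]
    have e1 : (0 : Fin 3).succAbove 1 = 2 := rfl
    have e2 : (0 : Fin 3).succAbove 0 = 1 := rfl
    have e3 : (1 : Fin 3).succAbove 1 = 2 := rfl
    have e4 : (1 : Fin 3).succAbove 0 = 0 := rfl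
    have e5 : (2 : Fin 3).succAbove 1 = 1 := rfl
    have e6 : (2 : Fin 3).succAbove 0 = 0 := rfl
    rw [e1, e2, e3, e4, e5, e6]
    linear_combination add_self_zmod (F (stdSimplex.vertex 0)) +
      add_self_zmod (F (stdSimplex.vertex 1)) + add_self_zmod (F (stdSimplex.vertex 2))
  · obtain ⟨F, hF⟩ := exists_primitive_unroll (γ := γ) fun s ↦ h (γ s)
    have hc : Continuous fun s : stdSimplex ℝ (Fin 2) ↦
        ((stdSimplexHomeomorphUnitInterval s : unitInterval) : ℝ) := by fun_prop
    rw [hw (σ := loopPath γ) (fun t ↦ (hF _).pullback hc),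
      period_eq (fun s ↦ h _) (PrimitiveAt.isPrimitiveOn fun t _ ↦ hF t)]
    simp

/-! ### From cocycles back to closed forms. -/

lemma continuous_coord {m : ℕ} (i : Fin m) : Continuous fun s : stdSimplex ℝ (Fin m) ↦ s.1 i :=
  (continuous_apply i).comp continuous_subtype_val

lemma coord_mem_Icc {m : ℕ} (i : Fin m) (s : stdSimplex ℝ (Fin m)) :
    s.1 i ∈ Set.Icc (0 : ℝ) 1 :=
  ⟨s.2.1 i, (Finset.single_le_sum (fun j _ ↦ s.2.1 j) (Finset.mem_univ i)).trans s.2.2.le⟩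

/-- The singular `1`-simplex of a path. -/
def pathSimplex (q : C(ℝ, X)) : C(stdSimplex ℝ (Fin 2), X) := 
  ⟨fun s ↦ q (s.1 1), q.continuous.comp (continuous_coord 1)⟩

lemma pathSimplex_congr {q q' : C(ℝ, X)} (h : ∀ t ∈ Set.Icc (0 : ℝ) 1, q t = q' t) :
    pathSimplex q = pathSimplex q' := by
  ext s
  exact h _ (coord_mem_Icc 1 s)

variable {w : C(stdSimplex ℝ (Fin 2), X) → ZMod 2}

/-- The last two barycentric coordinates identify the standard triangle with the one with corners
`(0, 0)`, `(1, 0)`, `(0, 1)`; the three terms are its faces `0`, `1`, `2`. Triangles can then be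
given by maps from the plane. -/
lemma IsCocycle.triangle (hw : IsCocycle w) (σ : C(ℝ × ℝ, X)) :
    w (pathSimplex (σ.comp ⟨fun t ↦ (1 - t, t), by fun_prop⟩)) +
      w (pathSimplex (σ.comp ⟨fun t ↦ (0, t), by fun_prop⟩)) +
      w (pathSimplex (σ.comp ⟨fun t ↦ (t, 0), by fun_prop⟩)) = 0 := by
  have := hw (σ.comp ⟨fun s ↦ (s.1 1, s.1 2),
    (continuous_coord 1).prodMk (continuous_coord 2)⟩)
  rw [Fin.sum_univ_three] at this
  have hs (s : stdSimplex ℝ (Fin 2)) : s.1 0 = 1 - s.1 1 := by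
    have := s.2.2
    rw [Fin.sum_univ_two] at this
    exact eq_sub_of_add_eq this
  have face (i : Fin 3) (s : stdSimplex ℝ (Fin 2)) (j : Fin 3) :
      (triangleFace i s).1 j = (if i.succAbove 0 = j then s.1 0 else 0) +
        if i.succAbove 1 = j then s.1 1 else 0 := by
    rw [← Fin.sum_univ_two fun k ↦ if i.succAbove k = j then s.1 k else 0, ← Finset.sum_filter]
    exact FunOnFinite.linearMap_apply_apply _ _ _ _ _
  rw [← this]
  have e (i : Fin 3) (q : C(ℝ, ℝ × ℝ)) (h : ∀ s : stdSimplex ℝ (Fin 2),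
      q (s.1 1) = ((triangleFace i s).1 1, (triangleFace i s).1 2)) :
      pathSimplex (σ.comp q) = (σ.comp ⟨fun s ↦ (s.1 1, s.1 2),
        (continuous_coord 1).prodMk (continuous_coord 2)⟩).comp (triangleFace i) := by
    ext s
    exact congrArg σ (h s)
  rw [e 0 ⟨fun t ↦ (1 - t, t), by fun_prop⟩ fun s ↦ by
      rw [face, face, if_pos (by decide), if_neg (by decide), if_neg (by decide),
        if_pos (by decide), hs, add_zero, zero_add]
      rfl,
    e 1 ⟨fun t ↦ (0, t), by fun_prop⟩ fun s ↦ by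
      rw [face, face, if_neg (by decide), if_neg (by decide), if_neg (by decide),
        if_pos (by decide), add_zero, zero_add]
      rfl,
    e 2 ⟨fun t ↦ (t, 0), by fun_prop⟩ fun s ↦ by
      rw [face, face, if_neg (by decide), if_pos (by decide), if_neg (by decide),
        if_neg (by decide), add_zero, zero_add]
      rfl]

/-- A constant triangle has three equal faces, and `3 = 1` in `ℤ/2`. -/
lemma IsCocycle.pathSimplex_const (hw : IsCocycle w) (x : X) :
    w (pathSimplex (ContinuousMap.const ℝ x)) = 0 := by
  have := hw.triangle (ContinuousMap.const (ℝ × ℝ) x)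
  rw [ContinuousMap.const_comp, ContinuousMap.const_comp, ContinuousMap.const_comp,
    add_self_zmod, zero_add] at this
  exact this

/-- The straight path from the centre in a parametrized disc. -/
def ray (φ : C(ℝ × ℝ, X)) (v : ℝ × ℝ) : C(ℝ, X) := φ.comp ⟨fun t ↦ t • v, by fun_prop⟩

/-- This is the cone over `Q` with apex the origin. Where `p.1 + p.2 = 0` the quotient is a junk
value, but `Q` is bounded and the factor in front tends to zero. -/
lemma continuous_cone (Q : C(unitInterval, ℝ × ℝ)) : Continuous fun p : ℝ × ℝ ↦
    (p.1 + p.2) • Q (Set.projIcc 0 1 zero_le_one (p.2 / (p.1 + p.2))) := by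
  rw [continuous_iff_continuousAt]
  intro p
  by_cases hp : p.1 + p.2 = 0
  · have h0 : (p.1 + p.2) • Q (Set.projIcc 0 1 zero_le_one (p.2 / (p.1 + p.2))) = 0 := by
      rw [hp, zero_smul]
    rw [ContinuousAt, h0]
    refine squeeze_zero_norm (a := fun p ↦ ‖p.1 + p.2‖ * ‖Q‖) (fun q ↦ ?_) ?_
    · rw [norm_smul]
      gcongr
      exact Q.norm_coe_le_norm _
    · have : Continuous fun p : ℝ × ℝ ↦ ‖p.1 + p.2‖ * ‖Q‖ := by fun_prop
      simpa [hp] using this.tendsto p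
  · have h1 : ContinuousAt (fun p : ℝ × ℝ ↦ p.1 + p.2) p := by fun_prop
    have h2 : ContinuousAt (fun p : ℝ × ℝ ↦ p.2 / (p.1 + p.2)) p :=
      ContinuousAt.div (by fun_prop) h1 hp
    exact h1.smul ((Q.continuous.comp continuous_projIcc).continuousAt.comp h2)

/-- In a disc, the value of a cocycle on a path can be computed from its end points. -/
lemma IsCocycle.cone (hw : IsCocycle w) {φ : C(ℝ × ℝ, X)} (hφ : IsOpenEmbedding φ) {q : C(ℝ, X)}
    (hq : ∀ t ∈ Set.Icc (0 : ℝ) 1, q t ∈ Set.range φ) {a b : ℝ × ℝ} (ha : φ a = q 0)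
    (hb : φ b = q 1) :
    w (pathSimplex q) = w (pathSimplex (ray φ a)) + w (pathSimplex (ray φ b)) := by
  choose! Q hQ using hq
  let Q' : C(unitInterval, ℝ × ℝ) := ⟨fun t ↦ Q t, by
    rw [hφ.isInducing.continuous_iff]
    have : (φ ∘ fun t : unitInterval ↦ Q t) = fun t : unitInterval ↦ q t := by
      ext t
      exact hQ t t.2
    rw [this]
    fun_prop⟩
  have h0 : Q' 0 = a := hφ.injective ((hQ 0 (by simp)).trans ha.symm)
  have h1 : Q' 1 = b := hφ.injective ((hQ 1 (by simp)).trans hb.symm)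
  -- The cone over the path, taken inside the disc, is a triangle with the path as one side and the
  -- rays to its two ends as the other sides.
  have := hw.triangle (φ.comp ⟨_, continuous_cone Q'⟩)
  have e1 : pathSimplex ((φ.comp ⟨_, continuous_cone Q'⟩).comp ⟨fun t ↦ (1 - t, t), by fun_prop⟩) =
      pathSimplex q := by
    refine pathSimplex_congr fun t ht ↦ ?_
    simp only [ContinuousMap.comp_apply, ContinuousMap.coe_mk, sub_add_cancel, div_one, one_smul,
      Set.projIcc_of_mem _ ht]
    exact hQ t ht
  have e2 : pathSimplex ((φ.comp ⟨_, continuous_cone Q'⟩).comp ⟨fun t ↦ (0, t), by fun_prop⟩) =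
      pathSimplex (ray φ b) := by
    refine pathSimplex_congr fun t ht ↦ ?_
    rcases eq_or_ne t 0 with rfl | h
    · simp [ray]
    · simp [ray, h, ← h1]
  have e3 : pathSimplex ((φ.comp ⟨_, continuous_cone Q'⟩).comp ⟨fun t ↦ (t, 0), by fun_prop⟩) =
      pathSimplex (ray φ a) := by
    refine pathSimplex_congr fun t ht ↦ ?_
    simp [ray, ← h0]
  rw [e1, e2, e3] at this
  linear_combination this - add_self_zmod (w (pathSimplex (ray φ a))) -
    add_self_zmod (w (pathSimplex (ray φ b)))

/-- On a surface, a cocycle on singular `1`-simplices defines a closed form. -/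
lemma IsCocycle.exists_form (hw : IsCocycle w)
    (hX : ∀ x : X, ∃ φ : C(ℝ × ℝ, X), IsOpenEmbedding φ ∧ φ 0 = x) :
    ∃ ω : Form X, (∀ x, ClosedAt ω x) ∧ ∀ γ, period ω γ = w (loopPath γ) := by
  classical
  choose φ hφ hφ0 using hX
  -- Only germs matter, so the value `0` outside the disc around `x` is harmless.
  let ω : Form X := fun x z ↦
    if h : z ∈ Set.range (φ x) then w (pathSimplex (ray (φ x) h.choose)) else 0
  have hω (x : X) (v : ℝ × ℝ) : ω x (φ x v) = w (pathSimplex (ray (φ x) v)) := by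
    have h : φ x v ∈ Set.range (φ x) := ⟨v, rfl⟩
    have e : h.choose = v := (hφ x).injective h.choose_spec
    dsimp only [ω]
    rw [dif_pos h, e]
  have self (x : X) : ω x x = 0 := by
    have := hω x 0
    rw [hφ0] at this
    rw [this, ← hw.pathSimplex_const x]
    congr 2
    ext t
    simp [ray, hφ0]
  have cone (x : X) {q : C(ℝ, X)} (hq : ∀ t ∈ Set.Icc (0 : ℝ) 1, q t ∈ Set.range (φ x)) :
      w (pathSimplex q) = ω x (q 0) + ω x (q 1) := by
    obtain ⟨a, ha⟩ := hq 0 (by simp)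
    obtain ⟨b, hb⟩ := hq 1 (by simp)
    rw [hw.cone (hφ x) hq ha hb, ← hω, ← hω, ha, hb]
  have closed (x : X) : ClosedAt ω x := by
    have hr : Set.range (φ x) ∈ 𝓝 x := (hφ x).isOpen_range.mem_nhds ⟨0, hφ0 x⟩
    filter_upwards [hr] with y hy
    have h1 : φ y ⁻¹' Set.range (φ x) ∈ 𝓝 0 :=
      (φ y).continuous.continuousAt.preimage_mem_nhds
        ((hφ x).isOpen_range.mem_nhds (by rwa [hφ0]))
    -- Rays of length less than `r` in the disc of `y` stay inside the disc of `x`, so `cone` for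
    -- `x` evaluates them.
    obtain ⟨r, hr, hball⟩ := Metric.mem_nhds_iff.1 h1
    have h2 : φ y '' Metric.ball 0 r ∈ 𝓝 y := by
      have := (hφ y).isOpenMap.image_mem_nhds (Metric.ball_mem_nhds (0 : ℝ × ℝ) hr)
      rwa [hφ0] at this
    filter_upwards [h2] with z hz
    obtain ⟨v, hv, rfl⟩ := hz
    have h3 := cone x (q := ray (φ y) v) fun t ht ↦ hball (by
      rw [mem_ball_zero_iff] at hv ⊢
      change ‖t • v‖ < r
      rw [norm_smul, Real.norm_of_nonneg ht.1]
      exact (mul_le_of_le_one_left (norm_nonneg _) ht.2).trans_lt hv)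
    have h4 : ray (φ y) v 0 = y := by simp [ray, hφ0]
    have h5 : ray (φ y) v 1 = φ y v := by simp [ray]
    rw [hω y v, h3, h4, h5, self]
    linear_combination add_self_zmod (ω x (φ y v))
  refine ⟨ω, closed, fun γ ↦ ?_⟩
  -- The part of the curve from time `a` to time `b`. Its value under `w` is additive in the
  -- interval by `hsub`, so `t ↦ w (pathSimplex (sub 0 t))` is a primitive along the curve.
  let sub (a b : ℝ) : C(ℝ, X) := (unroll γ).comp ⟨fun t ↦ (1 - t) * a + t * b, by fun_prop⟩
  have hsub (a b : ℝ) : w (pathSimplex (sub a b)) =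
      w (pathSimplex (sub 0 b)) + w (pathSimplex (sub 0 a)) := by
    have := hw.triangle ((unroll γ).comp ⟨fun p ↦ p.1 * a + p.2 * b, by fun_prop⟩)
    have e1 : (((unroll γ).comp ⟨fun p ↦ p.1 * a + p.2 * b, by fun_prop⟩).comp
        ⟨fun t ↦ (1 - t, t), by fun_prop⟩ : C(ℝ, X)) = sub a b := rfl
    have e2 : (((unroll γ).comp ⟨fun p ↦ p.1 * a + p.2 * b, by fun_prop⟩).comp
        ⟨fun t ↦ (0, t), by fun_prop⟩ : C(ℝ, X)) = sub 0 b := by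
      ext t
      simp [sub]
    have e3 : (((unroll γ).comp ⟨fun p ↦ p.1 * a + p.2 * b, by fun_prop⟩).comp
        ⟨fun t ↦ (t, 0), by fun_prop⟩ : C(ℝ, X)) = sub 0 a := by
      ext t
      simp [sub]
    rw [e1, e2, e3] at this
    linear_combination this - add_self_zmod (w (pathSimplex (sub 0 a))) -
      add_self_zmod (w (pathSimplex (sub 0 b)))
  have prim (t : ℝ) :
      PrimitiveAt (ω.pullback (unroll γ)) (fun t ↦ w (pathSimplex (sub 0 t))) t := by
    have h1 : unroll γ ⁻¹' Set.range (φ (unroll γ t)) ∈ 𝓝 t :=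
      (unroll γ).continuous.continuousAt.preimage_mem_nhds
        ((hφ _).isOpen_range.mem_nhds ⟨0, hφ0 _⟩)
    have h2 : Tendsto (fun s ↦ Set.uIcc t s) (𝓝 t) (𝓝 t).smallSets :=
      tendsto_const_nhds.uIcc tendsto_id
    filter_upwards [h2.eventually (eventually_smallSets.2 ⟨_, h1, fun t ht ↦ ht⟩)] with s hs
    have h3 := cone (unroll γ t) (q := sub t s) fun τ hτ ↦ hs (by
      rw [← segment_eq_uIcc]
      exact ⟨1 - τ, τ, by linarith [hτ.2], hτ.1, by ring, rfl⟩)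
    have e0 : sub t s 0 = unroll γ t := by simp [sub]
    have e1 : sub t s 1 = unroll γ s := by simp [sub]
    rw [e0, e1, hsub, self] at h3
    simp only [Form.pullback, self]
    linear_combination h3 + add_self_zmod (ω (unroll γ t) (unroll γ s)) -
      add_self_zmod (w (pathSimplex (sub 0 t)))
  rw [period_eq (fun s ↦ closed _) (PrimitiveAt.isPrimitiveOn fun t _ ↦ prim t)]
  have e0 : sub 0 0 = ContinuousMap.const ℝ (γ 0) := by
    ext t
    simp [sub, unroll]
  rw [e0, hw.pathSimplex_const, add_zero]
  congr 1
  ext s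
  simp [pathSimplex, sub, loopPath, unroll, stdSimplexHomeomorphUnitInterval, stdSimplexEquivIcc]

/-- The sum of the classes of closed curves on a surface vanishes if and only if the sum of the
periods of every closed form vanishes. -/
theorem sum_loopClass_eq_zero_iff_period
    (hX : ∀ x : X, ∃ φ : C(ℝ × ℝ, X), IsOpenEmbedding φ ∧ φ 0 = x) {n : ℕ}
    (γ : Fin n → C(UnitAddCircle, X)) :
    ∑ i, loopClass (γ i) = 0 ↔
      ∀ ω : Form X, (∀ x, ClosedAt ω x) → ∑ i, period ω (γ i) = 0 := by
  rw [sum_loopClass_eq_zero_iff]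
  constructor
  · intro h ω hω
    obtain ⟨w, hw, e⟩ := exists_isCocycle hω
    simpa only [e] using h w hw
  · intro h w hw
    obtain ⟨ω, hω, e⟩ := hw.exists_form hX
    simpa only [e] using h ω hω

end Period

/-! ### Residues -/

lemma form_add_self {X : Type*} (ω : Form X) : ω + ω = 0 := by
  ext x y
  exact add_self_zmod _

section Residue

variable {X : Type u} [TopologicalSpace X] {ω η : Form X} {x z : X}

/-- In a punctured neighbourhood of `z`, the form `ω` has a primitive. -/
def Removable (ω : Form X) (z : X) : Prop := ∃ F, ∀ᶠ y in 𝓝[≠] z, PrimitiveAt ω F y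

open Classical in
/-- The residue of a form at an isolated singular point. -/
def residue (ω : Form X) (z : X) : ZMod 2 := if Removable ω z then 0 else 1

lemma residue_eq_zero_iff : residue ω z = 0 ↔ Removable ω z := by simp [residue]

lemma residue_eq_one_iff : residue ω z = 1 ↔ ¬ Removable ω z := by simp [residue]

lemma ClosedAt.removable (h : ClosedAt ω z) : Removable ω z := ⟨ω z, nhdsWithin_le_nhds h⟩

lemma ClosedAt.residue_eq_zero (h : ClosedAt ω z) : residue ω z = 0 :=
  residue_eq_zero_iff.2 h.removable

lemma Removable.add (h : Removable ω z) (h' : Removable η z) : Removable (ω + η) z := by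
  obtain ⟨F, hF⟩ := h
  obtain ⟨G, hG⟩ := h'
  exact ⟨F + G, (hF.and hG).mono fun y hy ↦ hy.1.add hy.2⟩

lemma Removable.congr (h : ∀ᶠ y in 𝓝[≠] z, ω y = η y) (hω : Removable ω z) : Removable η z := by
  obtain ⟨F, hF⟩ := hω
  refine ⟨F, (hF.and h).mono fun y hy ↦ ?_⟩
  have := hy.1
  rwa [PrimitiveAt, hy.2] at this

lemma residue_congr (h : ∀ᶠ y in 𝓝[≠] z, ω y = η y) : residue ω z = residue η z := by
  have : Removable ω z ↔ Removable η z :=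
    ⟨fun h' ↦ h'.congr h, fun h' ↦ h'.congr (h.mono fun y hy ↦ hy.symm)⟩
  by_cases h1 : Removable ω z
  · rw [residue_eq_zero_iff.2 h1, residue_eq_zero_iff.2 (this.1 h1)]
  · rw [residue_eq_one_iff.2 h1, residue_eq_one_iff.2 (mt this.2 h1)]

variable {φ : C(ℝ × ℝ, X)}

lemma PrimitiveAt.extend (hφ : IsOpenEmbedding φ) {F : ℝ × ℝ → ZMod 2} {p : ℝ × ℝ}
    (h : PrimitiveAt (ω.pullback φ) F p) : PrimitiveAt ω (Function.extend φ F 0) (φ p) := by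
  rw [PrimitiveAt, ← hφ.map_nhds_eq, eventually_map]
  filter_upwards [h] with q hq
  rw [hφ.injective.extend_apply, hφ.injective.extend_apply]
  exact hq

lemma eventually_nhdsNE_iff (hφ : IsOpenEmbedding φ) {P : X → Prop} {p : ℝ × ℝ} :
    (∀ᶠ y in 𝓝[≠] (φ p), P y) ↔ ∀ᶠ q in 𝓝[≠] p, P (φ q) := by
  rw [eventually_nhdsWithin_iff, eventually_nhdsWithin_iff, ← hφ.map_nhds_eq, eventually_map]
  simp [hφ.injective.eq_iff]

/-! ### Slit discs and monodromy around a puncture. -/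

lemma mem_segment_iff {a b p : ℝ × ℝ} :
    p ∈ segment ℝ a b ↔ ∃ t ∈ Set.Icc (0 : ℝ) 1, a + t • (b - a) = p := by
  rw [segment_eq_image']
  rfl

/-- A ball minus a radius is star-shaped. -/
lemma exists_starConvex_slit {a b : ℝ × ℝ} (hab : a ≠ b) {r : ℝ} (hr : 0 < r)
    (hr' : r ≤ ‖b - a‖) :
    ∃ o ∈ Metric.ball a r \ segment ℝ a b, StarConvex ℝ o (Metric.ball a r \ segment ℝ a b) := by
  have hv : 0 < ‖b - a‖ := norm_pos_iff.2 (sub_ne_zero.2 hab.symm)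
  set v := b - a with hvdef
  -- This places the star centre `a - ε • v` at distance `r / 2` from `a`, on the side opposite to
  -- the slit.
  set ε := r / (2 * ‖v‖) with hε
  have hε0 : 0 < ε := by positivity
  have hv0 : v ≠ 0 := norm_pos_iff.1 hv
  have ho : a - ε • v ∈ Metric.ball a r := by
    rw [mem_ball_iff_norm]
    rw [sub_sub_cancel_left, norm_neg, norm_smul, Real.norm_of_nonneg hε0.le, hε]
    field_simp
    linarith
  have key {p : ℝ × ℝ} (hp : p ∈ Metric.ball a r) {t : ℝ} (ht0 : 0 ≤ t) (ht : t ≤ 1)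
      (h : (1 - t) • (a - ε • v) + t • p ∈ segment ℝ a b) : p ∈ segment ℝ a b := by
    obtain ⟨s, hs, e⟩ := mem_segment_iff.1 h
    rw [← hvdef] at e
    have e1 : t • (p - a) = (s + (1 - t) * ε) • v := by
      have : t • (p - a) = ((1 - t) • (a - ε • v) + t • p) - a + ((1 - t) * ε) • v := by
        module
      rw [this, ← e]
      module
    rcases eq_or_lt_of_le ht0 with rfl | htpos
    · simp only [zero_smul, sub_zero, one_mul] at e1
      have : s + ε = 0 := (smul_eq_zero.1 e1.symm).resolve_right hv0
      linarith [hs.1]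
    · have e2 : p = a + (t⁻¹ * (s + (1 - t) * ε)) • v := by
        rw [mul_smul, ← e1, smul_smul, inv_mul_cancel₀ htpos.ne', one_smul, add_sub_cancel]
      have hl : 0 ≤ t⁻¹ * (s + (1 - t) * ε) := by
        have := hs.1
        have : 0 ≤ 1 - t := by linarith
        positivity
      refine mem_segment_iff.2 ⟨_, ⟨hl, ?_⟩, e2.symm⟩
      rw [e2, mem_ball_iff_norm, add_sub_cancel_left, norm_smul, Real.norm_of_nonneg hl] at hp
      -- A point beyond `b` on the ray from `a` would be at distance more than `‖v‖ ≥ r` from `a`,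
      -- hence outside the ball.
      by_contra hcon
      push Not at hcon
      nlinarith
  have hoS : a - ε • v ∉ segment ℝ a b := by
    intro h
    obtain ⟨s, hs, e⟩ := mem_segment_iff.1 h
    have : (s + ε) • v = 0 := by
      have : (s + ε) • v = (a + s • v) - (a - ε • v) := by module
      rw [this, e, sub_self]
    have := (smul_eq_zero.1 this).resolve_right hv0
    linarith [hs.1]
  refine ⟨a - ε • v, ⟨ho, hoS⟩, fun p hp s t hs ht hst ↦ ⟨?_, fun h ↦ hp.2 ?_⟩⟩
  · exact (convex_ball a r) ho hp.1 hs ht hst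
  · obtain rfl : s = 1 - t := by linarith
    exact key hp.1 ht (by linarith) h

lemma isOpen_slit (a b c : ℝ × ℝ) (r : ℝ) : IsOpen (Metric.ball a r \ segment ℝ b c) :=
  Metric.isOpen_ball.sdiff (by
    rw [segment_eq_image_lineMap]
    exact (isCompact_Icc.image (AffineMap.lineMap_continuous)).isClosed)

/-- A closed form on a punctured disc has primitives on two slit discs. -/
lemma exists_slit_primitives {Ω : Form (ℝ × ℝ)} {r : ℝ} (hr : 0 < r)
    (h : ∀ p ∈ Metric.ball (0 : ℝ × ℝ) r, p ≠ 0 → ClosedAt Ω p) :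
    ∃ F G : ℝ × ℝ → ZMod 2, ∃ c d : ZMod 2,
      IsPrimitiveOn Ω F (Metric.ball 0 r \ segment ℝ 0 (r, 0)) ∧
      IsPrimitiveOn Ω G (Metric.ball 0 r \ segment ℝ 0 (-r, 0)) ∧
      (∀ p ∈ Metric.ball (0 : ℝ × ℝ) r, 0 < p.2 → F p + G p = c) ∧
      (∀ p ∈ Metric.ball (0 : ℝ × ℝ) r, p.2 < 0 → F p + G p = d) := by
  have slit (s : ℝ) (hs : |s| = r) :
      ∃ F, IsPrimitiveOn Ω F (Metric.ball 0 r \ segment ℝ 0 (s, 0)) := by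
    have hs0 : s ≠ 0 := by
      rintro rfl
      simp at hs
      linarith
    obtain ⟨o, ho, hstar⟩ := exists_starConvex_slit (a := 0) (b := (s, 0))
      (by simpa [Prod.ext_iff] using hs0.symm) hr (by simp [Prod.norm_def, hs, hr.le])
    have := hstar.contractibleSpace ⟨o, ho⟩
    refine exists_isPrimitiveOn fun p hp ↦ h p hp.1 ?_
    rintro rfl
    exact hp.2 (left_mem_segment ℝ _ _)
  obtain ⟨F, hF⟩ := slit r (abs_of_pos hr)
  obtain ⟨G, hG⟩ := slit (-r) (by rw [abs_neg, abs_of_pos hr])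
  have off (s : ℝ) {p : ℝ × ℝ} (hp : p.2 ≠ 0) : p ∉ segment ℝ 0 (s, (0 : ℝ)) := by
    intro h
    obtain ⟨t, -, rfl⟩ := mem_segment_iff.1 h
    simp at hp
  have up : Convex ℝ (Metric.ball (0 : ℝ × ℝ) r ∩ {p | 0 < p.2}) :=
    (convex_ball _ _).inter (convex_halfSpace_gt (LinearMap.snd ℝ ℝ ℝ).isLinear 0)
  have lo : Convex ℝ (Metric.ball (0 : ℝ × ℝ) r ∩ {p | p.2 < 0}) :=
    (convex_ball _ _).inter (convex_halfSpace_lt (LinearMap.snd ℝ ℝ ℝ).isLinear 0)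
  have m1 : ((0, r / 2) : ℝ × ℝ) ∈ Metric.ball (0 : ℝ × ℝ) r ∩ {p | 0 < p.2} := by
    simp [Prod.norm_def, abs_of_pos hr, hr]
  have m2 : ((0, -(r / 2)) : ℝ × ℝ) ∈ Metric.ball (0 : ℝ × ℝ) r ∩ {p | p.2 < 0} := by
    simp [Prod.norm_def, abs_of_pos hr, hr]
  -- Each open half-disc is convex and avoids both slits, so there the two primitives differ by a
  -- constant, read off at `m1` and at `m2`.
  refine ⟨F, G, _, _, hF, hG, fun p hp hp' ↦ IsPrimitiveOn.add_eq_add up.isPreconnected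
    (hF.mono ?_) (hG.mono ?_) ⟨hp, hp'⟩ m1, fun p hp hp' ↦ IsPrimitiveOn.add_eq_add
    lo.isPreconnected (hF.mono ?_) (hG.mono ?_) ⟨hp, hp'⟩ m2⟩
  · exact fun q hq ↦ ⟨hq.1, off _ (ne_of_gt hq.2)⟩
  · exact fun q hq ↦ ⟨hq.1, off _ (ne_of_gt hq.2)⟩
  · exact fun q hq ↦ ⟨hq.1, off _ (ne_of_lt hq.2)⟩
  · exact fun q hq ↦ ⟨hq.1, off _ (ne_of_lt hq.2)⟩

/-- The same constant on both half-discs means that there is no monodromy: `F` continues across its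
slit as `G + c`, which gives a single-valued primitive around the puncture. -/
lemma removable_of_slit_primitives {Ω : Form (ℝ × ℝ)} {r : ℝ} (hr : 0 < r)
    {F G : ℝ × ℝ → ZMod 2} {c : ZMod 2}
    (hF : IsPrimitiveOn Ω F (Metric.ball 0 r \ segment ℝ 0 (r, 0)))
    (hG : IsPrimitiveOn Ω G (Metric.ball 0 r \ segment ℝ 0 (-r, 0)))
    (h : ∀ p ∈ Metric.ball (0 : ℝ × ℝ) r, p.2 ≠ 0 → F p + G p = c) : Removable Ω 0 := by
  classical
  refine ⟨fun p ↦ if p ∈ segment ℝ (0 : ℝ × ℝ) (r, 0) then G p + c else F p, ?_⟩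
  rw [eventually_nhdsWithin_iff]
  filter_upwards [Metric.ball_mem_nhds 0 hr] with p hp hp0
  by_cases hps : p ∈ segment ℝ (0 : ℝ × ℝ) (r, 0)
  · have hp1 : p ∈ {q | 0 < q.1} := by
      obtain ⟨t, ht, rfl⟩ := mem_segment_iff.1 hps
      rcases eq_or_lt_of_le ht.1 with rfl | ht'
      · simp at hp0
      · simpa using by positivity
    have hopen : IsOpen (Metric.ball (0 : ℝ × ℝ) r ∩ {q | 0 < q.1}) :=
      Metric.isOpen_ball.inter (isOpen_lt continuous_const continuous_fst)
    have hsub : Metric.ball (0 : ℝ × ℝ) r ∩ {q | 0 < q.1} ⊆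
        Metric.ball 0 r \ segment ℝ 0 (-r, 0) := by
      refine fun q hq ↦ ⟨hq.1, fun hq' ↦ ?_⟩
      obtain ⟨t, ht, rfl⟩ := mem_segment_iff.1 hq'
      have := hq.2
      simp at this
      nlinarith [ht.1]
    refine IsPrimitiveOn.primitiveAt (((hG.mono hsub).add_const c).congr_fun fun q hq ↦ ?_)
      (hopen.mem_nhds ⟨hp, hp1⟩)
    dsimp only
    split_ifs with hqs
    · rfl
    · have hq2 : q.2 ≠ 0 := by
        intro h2
        refine hqs (mem_segment_iff.2 ⟨q.1 / r, ⟨?_, ?_⟩, ?_⟩)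
        · have := hq.2
          have : 0 < q.1 := this
          positivity
        · rw [div_le_one hr]
          have := hq.1
          rw [mem_ball_zero_iff, Prod.norm_def] at this
          exact (le_abs_self _).trans ((le_max_left _ _).trans this.le)
        · ext
          · simp [hr.ne']
          · simp [h2]
      rw [← h q hq.1 hq2]
      linear_combination -add_self_zmod (G q)
  · refine IsPrimitiveOn.primitiveAt (hF.congr_fun fun q hq ↦ ?_)
      ((isOpen_slit 0 0 (r, 0) r).mem_nhds ⟨hp, hps⟩)
    exact if_neg hq.2

lemma Removable.of_pullback (hφ : IsOpenEmbedding φ) {p : ℝ × ℝ}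
    (h : Removable (ω.pullback φ) p) : Removable ω (φ p) := by
  obtain ⟨F, hF⟩ := h
  refine ⟨Function.extend φ F 0, ?_⟩
  rw [eventually_nhdsNE_iff hφ]
  exact hF.mono fun q hq ↦ hq.extend hφ

/-- The sum of two singularities which are not removable is removable. -/
lemma removable_add_of_not_removable (hφ : IsOpenEmbedding φ)
    (hω : ∀ᶠ y in 𝓝[≠] (φ 0), ClosedAt ω y) (hη : ∀ᶠ y in 𝓝[≠] (φ 0), ClosedAt η y)
    (h : ¬ Removable ω (φ 0)) (h' : ¬ Removable η (φ 0)) : Removable (ω + η) (φ 0) := by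
  rw [eventually_nhdsNE_iff hφ] at hω hη
  obtain ⟨r, hr, hball⟩ := Metric.eventually_nhds_iff_ball.1
    (eventually_nhdsWithin_iff.1 (hω.and hη))
  obtain ⟨F, G, c, d, hF, hG, hc, hd⟩ := exists_slit_primitives (Ω := ω.pullback φ) hr
    fun p hp hp0 ↦ (hball p hp hp0).1.pullback φ.continuous
  obtain ⟨F', G', c', d', hF', hG', hc', hd'⟩ := exists_slit_primitives (Ω := η.pullback φ) hr
    fun p hp hp0 ↦ (hball p hp hp0).2.pullback φ.continuous
  have ne : c ≠ d := by
    rintro rfl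
    exact h (.of_pullback hφ (removable_of_slit_primitives hr hF hG fun p hp hp2 ↦
      hp2.lt_or_gt.elim (hd p hp) (hc p hp)))
  have ne' : c' ≠ d' := by
    rintro rfl
    exact h' (.of_pullback hφ (removable_of_slit_primitives hr hF' hG' fun p hp hp2 ↦
      hp2.lt_or_gt.elim (hd' p hp) (hc' p hp)))
  -- Both monodromies are non-zero in `ℤ/2`, so they are equal and cancel.
  have e : c + c' = d + d' := by
    have (c d c' d' : ZMod 2) : c ≠ d → c' ≠ d' → c + c' = d + d' := by
      revert c d c' d'
      decide
    exact this c d c' d' ne ne'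
  refine .of_pullback hφ (removable_of_slit_primitives (Ω := ω.pullback φ + η.pullback φ)
    (F := F + F') (G := G + G') (c := c + c') hr (hF.add hF') (hG.add hG') fun p hp hp2 ↦ ?_)
  simp only [Pi.add_apply]
  rcases hp2.lt_or_gt with h2 | h2
  · rw [e, ← hd p hp h2, ← hd' p hp h2]
    ring
  · rw [← hc p hp h2, ← hc' p hp h2]
    ring

/-- Only the case of two non-removable singularities uses the disc: there the group of possible
monodromies has just one non-zero element. The other cases are formal, since `ω + ω = 0`. -/
lemma residue_add (hz : ∃ φ : C(ℝ × ℝ, X), IsOpenEmbedding φ ∧ φ 0 = z)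
    (hω : ∀ᶠ y in 𝓝[≠] z, ClosedAt ω y) (hη : ∀ᶠ y in 𝓝[≠] z, ClosedAt η y) :
    residue (ω + η) z = residue ω z + residue η z := by
  obtain ⟨φ, hφ, rfl⟩ := hz
  by_cases h : Removable ω (φ 0) <;> by_cases h' : Removable η (φ 0)
  · rw [residue_eq_zero_iff.2 h, residue_eq_zero_iff.2 h', residue_eq_zero_iff.2 (h.add h'),
      add_zero]
  · have : ¬ Removable (ω + η) (φ 0) := fun h'' ↦ h' (by
      have := h.add h''
      rwa [← add_assoc, form_add_self, zero_add] at this)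
    rw [residue_eq_zero_iff.2 h, residue_eq_one_iff.2 h', residue_eq_one_iff.2 this, zero_add]
  · have : ¬ Removable (ω + η) (φ 0) := fun h'' ↦ h (by
      have := h''.add h'
      rwa [add_assoc, form_add_self, add_zero] at this)
    rw [residue_eq_one_iff.2 h, residue_eq_zero_iff.2 h', residue_eq_one_iff.2 this, add_zero]
  · rw [residue_eq_one_iff.2 h, residue_eq_one_iff.2 h', residue_eq_zero_iff.2
      (removable_add_of_not_removable hφ hω hη h h')]
    rfl

/-- Removable singularities can be removed. -/
lemma exists_closed_extension [T1Space X] {Z : Set X} (hZ : Z.Finite)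
    (hω : ∀ x ∉ Z, ClosedAt ω x) {V : Set X} (hV : IsOpen V) {F : X → ZMod 2}
    (hF : ∀ x ∈ V, x ∉ Z → PrimitiveAt ω F x) :
    ∃ ω' : Form X, (∀ x ∉ Z, ω' x = ω x) ∧ (∀ x, x ∉ Z ∨ Removable ω x → ClosedAt ω' x) ∧
      (∀ x ∈ V, PrimitiveAt ω' F x) ∧ ∀ x, residue ω' x = residue ω x := by
  classical
  -- The germ is changed only at points of `Z`. Inside `V` it becomes that of `F`, so that `F` stays
  -- a primitive; elsewhere a removable singularity receives a primitive from its punctured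
  -- neighbourhood.
  let ω' : Form X := fun x ↦ if x ∈ Z then
    (if x ∈ V then F else if h : Removable ω x then h.choose else ω x) else ω x
  have h1 (x) (hx : x ∉ Z) : ω' x = ω x := by simp [ω', hx]
  have nZ (x) (hx : x ∉ Z) : ∀ᶠ y in 𝓝 x, y ∉ Z := hZ.isClosed.isOpen_compl.mem_nhds hx
  have nZ' (x : X) : ∀ᶠ y in 𝓝[≠] x, y ∉ Z := by
    rw [eventually_nhdsWithin_iff]
    filter_upwards [(hZ.subset (Set.sdiff_subset (t := {x}))).isClosed.isOpen_compl.mem_nhds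
      (show x ∈ (Z \ {x})ᶜ by simp)] with y hy hyx hyZ
    exact hy ⟨hyZ, hyx⟩
  have cg {G : X → ZMod 2} {y : X} (hy : y ∉ Z) : PrimitiveAt ω' G y ↔ PrimitiveAt ω G y := by
    rw [PrimitiveAt, PrimitiveAt, h1 y hy]
  refine ⟨ω', h1, fun x hx ↦ ?_, fun x hx ↦ ?_, fun x ↦ ?_⟩
  · by_cases hxZ : x ∈ Z
    · have hrem := hx.resolve_left (not_not.2 hxZ)
      have key : ∀ᶠ y in 𝓝[≠] x, PrimitiveAt ω (ω' x) y := by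
        by_cases hxV : x ∈ V
        · filter_upwards [nZ' x, nhdsWithin_le_nhds (hV.mem_nhds hxV)] with y hy hyV
          simpa [ω', hxZ, hxV] using hF y hyV hy
        · have : ω' x = hrem.choose := by simp [ω', hxZ, hxV, hrem]
          rw [this]
          exact hrem.choose_spec
      rw [closedAt_iff, ← nhdsNE_sup_pure, eventually_sup]
      refine ⟨?_, by simpa using ClosedAt.primitiveAt_self ω' x⟩
      filter_upwards [key, nZ' x] with y hy hyZ
      exact (cg hyZ).2 hy
    · rw [closedAt_iff, h1 x hxZ]
      filter_upwards [nZ x hxZ, hω x hxZ] with y hy hy'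
      exact (cg hy).2 hy'
  · by_cases hxZ : x ∈ Z
    · have : ω' x = F := by simp [ω', hxZ, hx]
      have h2 := ClosedAt.primitiveAt_self ω' x
      rwa [this] at h2
    · exact (cg hxZ).2 (hF x hx hxZ)
  · exact residue_congr ((nZ' x).mono fun y hy ↦ h1 y hy)

end Residue

/-! ### The form dual to a segment -/

/-- The cross product of `b - a` and `q - a`, whose sign is the side of the line `a b` on which
`q` lies. -/
def cross (a b q : ℝ × ℝ) : ℝ := (b.1 - a.1) * (q.2 - a.2) - (b.2 - a.2) * (q.1 - a.1)

lemma continuous_cross (a b : ℝ × ℝ) : Continuous (cross a b) := by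
  unfold cross
  fun_prop

lemma cross_eq_zero_of_mem_segment {a b p : ℝ × ℝ} (h : p ∈ segment ℝ a b) : cross a b p = 0 := by
  obtain ⟨t, -, rfl⟩ := mem_segment_iff.1 h
  simp [cross]
  ring

lemma cross_swap (a b q : ℝ × ℝ) : cross b a q = -cross a b q := by
  simp only [cross]
  ring

/-- Near an interior point, the line through `a` and `b` agrees with the segment. -/
lemma eventually_mem_segment_or_cross_ne_zero {a b p : ℝ × ℝ} (hp : p ∈ segment ℝ a b)
    (hpa : p ≠ a) (hpb : p ≠ b) : ∀ᶠ q in 𝓝 p, q ∈ segment ℝ a b ∨ cross a b q ≠ 0 := by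
  -- `s q / l` is the parameter of the orthogonal projection of `q` to the line; near an interior
  -- point of the segment it stays strictly between `0` and `1`.
  let s : ℝ × ℝ → ℝ := fun q ↦ (q.1 - a.1) * (b.1 - a.1) + (q.2 - a.2) * (b.2 - a.2)
  let l : ℝ := (b.1 - a.1) ^ 2 + (b.2 - a.2) ^ 2
  have hs : Continuous s := by fun_prop
  obtain ⟨t, ht, e⟩ := mem_segment_iff.1 hp
  have hl : 0 < l := by
    rcases eq_or_ne a b with rfl | hab
    · simp at e
      exact absurd e.symm hpa
    · by_contra hcon
      have h1 : b.1 - a.1 = 0 := by nlinarith [sq_nonneg (b.1 - a.1), sq_nonneg (b.2 - a.2)]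
      have h2 : b.2 - a.2 = 0 := by nlinarith [sq_nonneg (b.1 - a.1), sq_nonneg (b.2 - a.2)]
      exact hab (Prod.ext (by linarith) (by linarith))
  have hsp : s p = t * l := by
    rw [← e]
    simp [s, l]
    ring
  have ht0 : 0 < t := by
    refine lt_of_le_of_ne ht.1 ?_
    rintro rfl
    simp at e
    exact hpa e.symm
  have ht1 : t < 1 := by
    refine lt_of_le_of_ne ht.2 ?_
    rintro rfl
    simp at e
    exact hpb e.symm
  have o : IsOpen {q | 0 < s q ∧ s q < l} :=
    (isOpen_lt continuous_const hs).inter (isOpen_lt hs continuous_const)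
  filter_upwards [o.mem_nhds (show p ∈ {q | 0 < s q ∧ s q < l} from
    ⟨by rw [hsp]; positivity, by rw [hsp]; nlinarith⟩)] with q hq
  by_cases hc : cross a b q = 0
  · left
    refine mem_segment_iff.2 ⟨s q / l, ⟨div_nonneg hq.1.le hl.le, (div_le_one hl).2 hq.2.le⟩, ?_⟩
    simp only [cross] at hc
    ext
    · simp only [Prod.fst_add, Prod.smul_fst, Prod.fst_sub, smul_eq_mul]
      field_simp
      simp only [s, l]
      linear_combination (b.2 - a.2) * hc
    · simp only [Prod.snd_add, Prod.smul_snd, Prod.snd_sub, smul_eq_mul]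
      field_simp
      simp only [s, l]
      linear_combination (-(b.1 - a.1)) * hc
  · exact .inr hc

section SegmentForm

variable {X : Type u} [TopologicalSpace X]

open Classical in
/-- In the parametrized disc `φ`, the form dual to the segment from `a` to `b`: its integral along a
path counts the crossings with the segment. -/
def segmentForm (φ : C(ℝ × ℝ, X)) (a b : ℝ × ℝ) : Form X := fun x z ↦
  if x ∈ φ '' segment ℝ a b ∧ z ∈ φ '' {q | 0 < cross a b q} then 1 else 0

variable {φ : C(ℝ × ℝ, X)} {a b p q : ℝ × ℝ}

lemma segmentForm_of_notMem {x : X} (hx : x ∉ φ '' segment ℝ a b) : segmentForm φ a b x = 0 := by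
  ext z
  simp only [segmentForm, hx, false_and, if_false, Pi.zero_apply]

lemma segmentForm_self (x z : X) : segmentForm φ a a x z = 0 := by
  simp [segmentForm, cross]

open Classical in
lemma segmentForm_apply (hφ : IsOpenEmbedding φ) : segmentForm φ a b (φ p) (φ q) =
    if p ∈ segment ℝ a b ∧ 0 < cross a b q then 1 else 0 := by
  simp [segmentForm, hφ.injective.mem_set_image]

lemma isClosed_image_segment [T2Space X] (φ : C(ℝ × ℝ, X)) (a b : ℝ × ℝ) :
    IsClosed (φ '' segment ℝ a b) := by
  rw [segment_eq_image_lineMap]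
  exact ((isCompact_Icc.image AffineMap.lineMap_continuous).image φ.continuous).isClosed

lemma closedAt_of_forall_eventually_eq_zero {ω : Form X} {x : X} (h : ∀ᶠ y in 𝓝 x, ω y = 0) :
    ClosedAt ω x := by
  have h0 : ω x = 0 := h.self_of_nhds
  filter_upwards [h] with y hy
  simp [hy, h0]

/-- Near an interior point of the segment, the indicator of the side `0 < cross a b` is locally
constant off the segment, so its differential agrees with the zero form there. This fails at the
ends, where the line goes on beyond the segment. -/
lemma closedAt_segmentForm [T2Space X] (hφ : IsOpenEmbedding φ) {x : X} (ha : x ≠ φ a)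
    (hb : x ≠ φ b) : ClosedAt (segmentForm φ a b) x := by
  by_cases hx : x ∈ φ '' segment ℝ a b
  · obtain ⟨p, hp, rfl⟩ := hx
    rw [ClosedAt, ← hφ.map_nhds_eq, eventually_map]
    filter_upwards [eventually_mem_segment_or_cross_ne_zero hp (fun h ↦ ha (h ▸ rfl))
      (fun h ↦ hb (h ▸ rfl))] with q hq
    rw [← hφ.map_nhds_eq, eventually_map]
    by_cases hqs : q ∈ segment ℝ a b
    · refine .of_forall fun r ↦ ?_
      simp only [segmentForm_apply hφ, hp, hqs, true_and]
      rw [add_self_zmod, add_self_zmod]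
    · have hc := hq.resolve_left hqs
      have hz : ∀ r, segmentForm φ a b (φ q) (φ r) = 0 := fun r ↦ by
        simp [segmentForm_apply hφ, hqs]
      have hs : ∀ᶠ r in 𝓝 q, (0 < cross a b r ↔ 0 < cross a b q) := by
        rcases hc.lt_or_gt with h | h
        · filter_upwards [(continuous_cross a b).continuousAt.eventually (gt_mem_nhds h)] with r hr
          exact ⟨fun h' ↦ absurd h' hr.not_gt, fun h' ↦ absurd h' h.not_gt⟩
        · filter_upwards [(continuous_cross a b).continuousAt.eventually (lt_mem_nhds h)] with r hr
          exact ⟨fun _ ↦ h, fun _ ↦ hr⟩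
      filter_upwards [hs] with r hr
      rw [hz, hz, segmentForm_apply hφ, segmentForm_apply hφ]
      by_cases h : 0 < cross a b q
      · rw [if_pos ⟨hp, hr.2 h⟩, if_pos ⟨hp, h⟩]
      · rw [if_neg fun h' ↦ h (hr.1 h'.2), if_neg fun h' ↦ h h'.2]
  · refine closedAt_of_forall_eventually_eq_zero ?_
    filter_upwards [(isClosed_image_segment φ a b).isOpen_compl.mem_nhds hx] with y hy
    exact segmentForm_of_notMem hy

/-- An end point of a segment is not a removable singularity of the dual form. -/
lemma not_removable_of_segment (hφ : IsOpenEmbedding φ) {ω : Form X} {k : ℝ} (hk : k ≠ 0)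
    (hab : a ≠ b) (h0 : ∀ p ∉ segment ℝ a b, ∀ q, ω (φ p) (φ q) = 0)
    (h1 : ∀ p ∈ segment ℝ a b, ∀ q, k * cross a b q ≤ 0 → ω (φ p) (φ q) = 0)
    (h2 : ∀ p ∈ segment ℝ a b, ∀ q, 0 < k * cross a b q → ω (φ p) (φ q) = 1) :
    ¬ Removable ω (φ a) := by
  rintro ⟨F, hF⟩
  rw [eventually_nhdsNE_iff hφ, eventually_nhdsWithin_iff, Metric.eventually_nhds_iff_ball] at hF
  obtain ⟨r₀, hr₀, hball⟩ := hF
  have hv : 0 < ‖b - a‖ := norm_pos_iff.2 (sub_ne_zero.2 hab.symm)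
  set r := min r₀ ‖b - a‖ with hr
  have hr0 : 0 < r := lt_min hr₀ hv
  obtain ⟨o, ho, hstar⟩ := exists_starConvex_slit hab hr0 (min_le_right _ _)
  have sub : Metric.ball a r ⊆ Metric.ball a r₀ := Metric.ball_subset_ball (min_le_left _ _)
  have e1 : IsPrimitiveOn (ω.pullback φ) (F ∘ φ) (Metric.ball a r \ segment ℝ a b) :=
    PrimitiveAt.isPrimitiveOn fun p hp ↦ (hball p (sub hp.1) (by
      rintro rfl
      exact hp.2 (left_mem_segment ℝ _ _))).pullback φ.continuous
  have e2 : IsPrimitiveOn (ω.pullback φ) 0 (Metric.ball a r \ segment ℝ a b) :=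
    PrimitiveAt.isPrimitiveOn fun p hp ↦ .of_forall fun q ↦ by
      simp [Form.pullback, h0 p hp.2]
  -- Off the segment the form is zero and the slit ball is connected, so a primitive `F` around the
  -- end point takes a single value there.
  have hconst {p q : ℝ × ℝ} (hp : p ∈ Metric.ball a r \ segment ℝ a b)
      (hq : q ∈ Metric.ball a r \ segment ℝ a b) : F (φ p) = F (φ q) := by
    simpa using e1.add_eq_add (hstar.isPathConnected ho).isConnected.isPreconnected e2 hp hq
  set p : ℝ × ℝ := a + (r / (2 * ‖b - a‖)) • (b - a) with hp
  have hpos : 0 < r / (2 * ‖b - a‖) := by positivity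
  have hle : r / (2 * ‖b - a‖) ≤ 1 := by
    rw [div_le_one (by positivity)]
    linarith [min_le_right r₀ ‖b - a‖]
  have hps : p ∈ segment ℝ a b := mem_segment_iff.2 ⟨_, ⟨hpos.le, hle⟩, rfl⟩
  have hpball : p ∈ Metric.ball a r := by
    rw [mem_ball_iff_norm, hp, add_sub_cancel_left, norm_smul, Real.norm_of_nonneg hpos.le]
    field_simp
    linarith
  have hpa : p ≠ a := by
    intro h
    rw [hp, add_eq_left, smul_eq_zero] at h
    exact h.elim hpos.ne' (sub_ne_zero.2 hab.symm)
  have hprim : PrimitiveAt (ω.pullback φ) (F ∘ φ) p :=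
    (hball p (sub hpball) hpa).pullback φ.continuous
  have hev := hprim.and (Metric.isOpen_ball.mem_nhds hpball)
  -- The line through `p` perpendicular to the segment. Its points on both sides of `p` have equal
  -- `F`, whereas `ω (φ p)` jumps between them.
  let g : ℝ → ℝ × ℝ := fun τ ↦ (p.1 - τ * (b.2 - a.2), p.2 + τ * (b.1 - a.1))
  have hg : Continuous g := by fun_prop
  have hg0 : g 0 = p := by simp [g]
  have hcr (τ : ℝ) : cross a b (g τ) = τ * ((b.1 - a.1) ^ 2 + (b.2 - a.2) ^ 2) := by
    have := cross_eq_zero_of_mem_segment hps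
    simp only [cross, g] at this ⊢
    linear_combination this
  have hl : 0 < (b.1 - a.1) ^ 2 + (b.2 - a.2) ^ 2 := by
    by_contra hcon
    have h1 : b.1 - a.1 = 0 := by nlinarith [sq_nonneg (b.1 - a.1), sq_nonneg (b.2 - a.2)]
    have h2 : b.2 - a.2 = 0 := by nlinarith [sq_nonneg (b.1 - a.1), sq_nonneg (b.2 - a.2)]
    exact hab (Prod.ext (by linarith) (by linarith))
  have hev2 : ∀ᶠ τ in 𝓝 (0 : ℝ), (F (φ (g τ)) + ω (φ p) (φ (g τ)) = F (φ p) + ω (φ p) (φ p)) ∧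
      g τ ∈ Metric.ball a r :=
    hg.continuousAt.eventually (by rw [hg0]; exact hev)
  obtain ⟨δ, hδ, hδ'⟩ := Metric.eventually_nhds_iff.1 hev2
  have m1 := hδ' (y := δ / 2) (by simp [abs_of_pos hδ, hδ])
  have m2 := hδ' (y := -(δ / 2)) (by simp [abs_of_pos hδ, hδ])
  have s1 : g (δ / 2) ∉ segment ℝ a b := fun h ↦ by
    have := cross_eq_zero_of_mem_segment h
    rw [hcr] at this
    have : 0 < δ / 2 * ((b.1 - a.1) ^ 2 + (b.2 - a.2) ^ 2) := by positivity
    linarith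
  have s2 : g (-(δ / 2)) ∉ segment ℝ a b := fun h ↦ by
    have := cross_eq_zero_of_mem_segment h
    rw [hcr] at this
    have : 0 < δ / 2 * ((b.1 - a.1) ^ 2 + (b.2 - a.2) ^ 2) := by positivity
    linarith
  have eF := hconst ⟨m1.2, s1⟩ ⟨m2.2, s2⟩
  have eω : ω (φ p) (φ (g (δ / 2))) = ω (φ p) (φ (g (-(δ / 2)))) := by
    have := m1.1.trans m2.1.symm
    rw [eF] at this
    exact add_left_cancel this
  rcases hk.lt_or_gt with hk | hk
  · rw [h1 p hps _ (by
      rw [hcr]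
      exact mul_nonpos_of_nonpos_of_nonneg hk.le (by positivity)),
      h2 p hps _ (by
      rw [hcr]
      exact mul_pos_of_neg_of_neg hk (by nlinarith))] at eω
    exact zero_ne_one eω
  · rw [h2 p hps _ (by
      rw [hcr]
      positivity),
      h1 p hps _ (by
      rw [hcr]
      exact mul_nonpos_of_nonneg_of_nonpos hk.le (by nlinarith))] at eω
    exact one_ne_zero eω

-- The end `b` is handled by exchanging the ends, which reverses the sign of `cross`; this is the
-- reason for the factor `k` in `not_removable_of_segment`. For `a = b` the form vanishes and the
-- two terms on the right cancel.
open Classical in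
lemma residue_segmentForm [T2Space X] (hφ : IsOpenEmbedding φ) (z : X) :
    residue (segmentForm φ a b) z = (if z = φ a then 1 else 0) + if z = φ b then 1 else 0 := by
  rcases eq_or_ne a b with rfl | hab
  · rw [add_self_zmod]
    exact (closedAt_of_forall_eventually_eq_zero (.of_forall fun y ↦ funext fun z ↦
      segmentForm_self y z)).residue_eq_zero
  have hab' : φ a ≠ φ b := hφ.injective.ne hab
  rcases eq_or_ne z (φ a) with rfl | hza
  · rw [if_pos rfl, if_neg hab', add_zero, residue_eq_one_iff]
    refine not_removable_of_segment hφ one_ne_zero hab ?_ ?_ ?_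
    · intro p hp q
      simp [segmentForm_apply hφ, hp]
    · intro p hp q hq
      rw [one_mul] at hq
      simp [segmentForm_apply hφ, hq]
    · intro p hp q hq
      rw [one_mul] at hq
      simp [segmentForm_apply hφ, hq, hp]
  rcases eq_or_ne z (φ b) with rfl | hzb
  · rw [if_neg hab'.symm, if_pos rfl, zero_add, residue_eq_one_iff]
    refine not_removable_of_segment hφ (k := -1) (by norm_num) hab.symm ?_ ?_ ?_
    · intro p hp q
      rw [segment_symm] at hp
      simp [segmentForm_apply hφ, hp]
    · intro p hp q hq
      rw [cross_swap, neg_one_mul, neg_neg] at hq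
      simp [segmentForm_apply hφ, hq]
    · intro p hp q hq
      rw [segment_symm] at hp
      rw [cross_swap, neg_one_mul, neg_neg] at hq
      simp [segmentForm_apply hφ, hq, hp]
  rw [if_neg hza, if_neg hzb, add_zero]
  exact (closedAt_segmentForm hφ hza hzb).residue_eq_zero

end SegmentForm

/-! ### Counting crossings -/

/-- The function `h` has different constant values on both sides of `t₀`. -/
def JumpsAt (h : ℝ → ZMod 2) (t₀ : ℝ) : Prop :=
  ∃ ε > 0, ∃ c, (∀ t ∈ Set.Ioo t₀ (t₀ + ε), h t = c) ∧ ∀ t ∈ Set.Ioo (t₀ - ε) t₀, h t = c + 1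

lemma nhds_coe_unitAddCircle (t : ℝ) : 𝓝 (t : UnitAddCircle) = map (↑) (𝓝 t) :=
  (QuotientAddGroup.isOpenQuotientMap_mk.map_nhds_eq t).symm

lemma coe_ne_coe_unitAddCircle {s t : ℝ} (h : s ≠ t) (h' : |s - t| < 1) :
    (s : UnitAddCircle) ≠ t := by
  intro e
  rw [← sub_eq_zero, ← AddCircle.coe_sub, AddCircle.coe_eq_zero_iff] at e
  obtain ⟨m, hm⟩ := e
  rw [zsmul_eq_mul, mul_one] at hm
  rw [← hm, ← Int.cast_abs] at h'
  have h0 : |m| < 1 := by exact_mod_cast h'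
  have : m = 0 := Int.abs_lt_one_iff.1 h0
  rw [this, Int.cast_zero] at hm
  exact h (sub_eq_zero.1 hm.symm)

section Jump

variable {η : Form UnitAddCircle} {t₀ : ℝ}

/-- On each side of `t₀` the function `η t₀` is constant, which matches the zero form at the other
points. -/
lemma closedAt_of_jumpsAt (h0 : ∀ s ≠ (t₀ : UnitAddCircle), η s = 0)
    (hj : JumpsAt (fun t : ℝ ↦ η t₀ t) t₀) (s : UnitAddCircle) : ClosedAt η s := by
  rcases eq_or_ne s t₀ with rfl | hs
  · obtain ⟨ε, hε, c, hr, hl⟩ := hj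
    rw [closedAt_iff, nhds_coe_unitAddCircle, eventually_map]
    filter_upwards [Metric.ball_mem_nhds t₀ (lt_min hε one_pos)] with t ht
    rw [Metric.mem_ball, Real.dist_eq, lt_min_iff] at ht
    rcases lt_trichotomy t t₀ with h | rfl | h
    · have hne := coe_ne_coe_unitAddCircle h.ne ht.2
      have hm : t ∈ Set.Ioo (t₀ - ε) t₀ := ⟨by linarith [(abs_lt.1 ht.1).1], h⟩
      rw [PrimitiveAt, nhds_coe_unitAddCircle, eventually_map]
      filter_upwards [isOpen_Ioo.mem_nhds hm] with r hr
      rw [h0 _ hne]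
      exact congrArg (· + _) ((hl r hr).trans (hl t hm).symm)
    · exact ClosedAt.primitiveAt_self _ _
    · have hne := coe_ne_coe_unitAddCircle h.ne' ht.2
      have hm : t ∈ Set.Ioo t₀ (t₀ + ε) := ⟨h, by linarith [(abs_lt.1 ht.1).2]⟩
      rw [PrimitiveAt, nhds_coe_unitAddCircle, eventually_map]
      filter_upwards [isOpen_Ioo.mem_nhds hm] with r hr'
      rw [h0 _ hne]
      exact congrArg (· + _) ((hr r hr').trans (hr t hm).symm)
  · refine closedAt_of_forall_eventually_eq_zero ?_
    filter_upwards [isOpen_compl_singleton.mem_nhds hs] with y hy using h0 y hy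

/-- A primitive on the line is constant on the open interval `(t₀, t₀ + 1)`, where the form
vanishes. Comparison with the values at its two ends uses the two sides of the jump, and these
differ by `1`. -/
lemma period_of_jumpsAt (h0 : ∀ s ≠ (t₀ : UnitAddCircle), η s = 0)
    (hj : JumpsAt (fun t : ℝ ↦ η t₀ t) t₀) : period η (ContinuousMap.id _) = 1 := by
  have hcl := closedAt_of_jumpsAt h0 hj
  obtain ⟨F, hF⟩ := exists_primitive_unroll (ω := η) (γ := ContinuousMap.id _) fun s ↦ hcl s
  have hun (t : ℝ) : unroll (ContinuousMap.id UnitAddCircle) t = t := rfl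
  have hper (t : ℝ) : ((t + 1 : ℝ) : UnitAddCircle) = t := AddCircle.coe_add_period 1 t
  -- The translate of a primitive by one period is again a primitive, so the period may be computed
  -- from `t₀` to `t₀ + 1`.
  have hF1 (t : ℝ) :
      PrimitiveAt (η.pullback (unroll (ContinuousMap.id _))) (fun t ↦ F (t + 1)) t := by
    have hc : ContinuousAt (fun t : ℝ ↦ t + 1) t := by fun_prop
    filter_upwards [hc.eventually (hF (t + 1))] with z hz
    simpa only [Form.pullback, hun, hper] using hz
  have e0 : period η (ContinuousMap.id _) = F (t₀ + 1) + F t₀ := by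
    rw [period_eq (fun s ↦ hcl s) (PrimitiveAt.isPrimitiveOn fun t _ ↦ hF t)]
    have := (PrimitiveAt.isPrimitiveOn fun t _ ↦ hF t).add_eq_add isPreconnected_univ
      (PrimitiveAt.isPrimitiveOn fun t _ ↦ hF1 t) (Set.mem_univ 0) (Set.mem_univ t₀)
    rw [zero_add] at this
    linear_combination this
  have hIoo : IsPrimitiveOn (η.pullback (unroll (ContinuousMap.id _))) 0
      (Set.Ioo t₀ (t₀ + 1)) := by
    refine PrimitiveAt.isPrimitiveOn fun t ht ↦ .of_forall fun z ↦ ?_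
    have : (t : UnitAddCircle) ≠ t₀ := coe_ne_coe_unitAddCircle ht.1.ne'
      (abs_lt.2 ⟨by linarith [ht.1], by linarith [ht.2]⟩)
    simp [Form.pullback, hun, h0 _ this]
  have hconst {s t : ℝ} (hs : s ∈ Set.Ioo t₀ (t₀ + 1)) (ht : t ∈ Set.Ioo t₀ (t₀ + 1)) :
      F s = F t := by
    simpa using (PrimitiveAt.isPrimitiveOn fun t _ ↦ hF t).add_eq_add isPreconnected_Ioo hIoo hs ht
  obtain ⟨ε, hε, c, hr, hl⟩ := hj
  have h1 : ∃ s ∈ Set.Ioo t₀ (t₀ + 1), F s + c = F t₀ + η t₀ t₀ := by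
    have hm : Set.Ioo t₀ (min (t₀ + ε) (t₀ + 1)) ∈ 𝓝[>] t₀ :=
      Ioo_mem_nhdsGT (by simp [hε])
    obtain ⟨s, hs, hs'⟩ := ((Eventually.filter_mono nhdsWithin_le_nhds (hF t₀)).and hm).exists
    refine ⟨s, ⟨hs'.1, hs'.2.trans_le (min_le_right _ _)⟩, ?_⟩
    rw [← hr s ⟨hs'.1, hs'.2.trans_le (min_le_left _ _)⟩]
    exact hs
  have h2 : ∃ s ∈ Set.Ioo t₀ (t₀ + 1), F s + (c + 1) = F (t₀ + 1) + η t₀ t₀ := by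
    have hm : Set.Ioo (max (t₀ + 1 - ε) t₀) (t₀ + 1) ∈ 𝓝[<] (t₀ + 1) :=
      Ioo_mem_nhdsLT (by simp [hε])
    obtain ⟨s, hs, hs'⟩ :=
      ((Eventually.filter_mono nhdsWithin_le_nhds (hF (t₀ + 1))).and hm).exists
    refine ⟨s, ⟨(le_max_right _ _).trans_lt hs'.1, hs'.2⟩, ?_⟩
    have e := hl (s - 1) ⟨by linarith [(le_max_left (t₀ + 1 - ε) t₀).trans_lt hs'.1],
      by linarith [hs'.2]⟩
    rw [← e]
    have e' : ((s - 1 : ℝ) : UnitAddCircle) = s := by rw [← hper, sub_add_cancel]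
    simp only [Form.pullback, hun, hper] at hs
    dsimp only
    rw [e']
    exact hs
  obtain ⟨s, hs, e1⟩ := h1
  obtain ⟨s', hs', e2⟩ := h2
  rw [hconst hs' hs] at e2
  rw [e0]
  linear_combination -e1 - e2 + add_self_zmod (F s) + add_self_zmod c - add_self_zmod (η t₀ t₀)

end Jump

section Count

variable {X : Type u} [TopologicalSpace X] {n : ℕ} {γ : Fin n → C(UnitAddCircle, X)} {ω : Form X}

lemma period_pullback_id (ω : Form X) (γ : C(UnitAddCircle, X)) :
    period (ω.pullback γ) (ContinuousMap.id _) = period ω γ := rfl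

lemma period_sum {ι : Type*} (s : Finset ι) {ω : ι → Form X} {γ : C(UnitAddCircle, X)}
    (h : ∀ i ∈ s, ∀ t, ClosedAt (ω i) (γ t)) :
    period (∑ i ∈ s, ω i) γ = ∑ i ∈ s, period (ω i) γ := by
  classical
  induction s using Finset.induction_on with
  | empty =>
    rw [Finset.sum_empty, Finset.sum_empty]
    exact period_eq_zero (F := 0) (fun _ ↦ closedAt_zero) (fun _ ↦ by simp [PrimitiveAt])
  | insert i s hi ih =>
    rw [Finset.sum_insert hi, Finset.sum_insert hi, period_add (h i (by simp))
      (fun t ↦ .sum fun j hj ↦ h j (by simp [hj]) t), ih fun j hj ↦ h j (by simp [hj])]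

/-- If a form vanishes along a curve except for finitely many jumps, then its period is the number
of jumps. -/
lemma period_eq_card {γ : C(UnitAddCircle, X)} (T : Finset UnitAddCircle)
    (h0 : ∀ s ∉ T, ω (γ s) = 0)
    (hj : ∀ t : ℝ, (t : UnitAddCircle) ∈ T → JumpsAt (fun r : ℝ ↦ ω (γ t) (γ r)) t) :
    period ω γ = T.card := by
  classical
  -- The pulled-back form is a sum of forms with a single jump, each of period `1`.
  let η (s : UnitAddCircle) : Form UnitAddCircle :=
    fun r z ↦ if r = s then ω (γ r) (γ z) else 0
  have e : ω.pullback γ = ∑ s ∈ T, η s := by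
    ext r z
    simp only [Finset.sum_apply, η, Finset.sum_ite_eq, Form.pullback]
    split_ifs with h
    · rfl
    · rw [h0 r h]
      rfl
  have hη0 (s) : ∀ r ≠ s, η s r = 0 := fun r hr ↦ by
    ext z
    simp [η, hr]
  have hηj (t : ℝ) (ht : (t : UnitAddCircle) ∈ T) : JumpsAt (fun r : ℝ ↦ η t t r) t := by
    simpa [η] using hj t ht
  rw [← period_pullback_id, e, period_sum]
  · rw [Finset.sum_congr rfl fun s hs ↦ ?_, Finset.sum_const, nsmul_one]
    obtain ⟨t, rfl⟩ := QuotientAddGroup.mk_surjective s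
    exact period_of_jumpsAt (hη0 _) (hηj t hs)
  · intro s hs r
    obtain ⟨t, rfl⟩ := QuotientAddGroup.mk_surjective s
    exact closedAt_of_jumpsAt (hη0 _) (hηj t hs) r

lemma sum_period_eq_card (T : Finset (Fin n × UnitAddCircle))
    (h0 : ∀ s ∉ T, ω (total γ s) = 0)
    (hj : ∀ (i : Fin n) (t : ℝ), (i, (t : UnitAddCircle)) ∈ T →
      JumpsAt (fun r : ℝ ↦ ω (γ i t) (γ i r)) t) :
    ∑ i, period ω (γ i) = T.card := by
  classical
  have h (i : Fin n) : period ω (γ i) = (T.preimage (Prod.mk i)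
      (Prod.mk_right_injective i).injOn).card :=
    period_eq_card _ (fun s hs ↦ h0 (i, s) (by simpa using hs)) fun t ht ↦
      hj i t (by simpa using ht)
  simp_rw [h]
  rw [← Nat.cast_sum]
  congr 1
  rw [Finset.card_eq_sum_card_fiberwise (f := Prod.fst) (t := Finset.univ) (by simp)]
  refine Finset.sum_congr rfl fun i _ ↦ ?_
  rw [← Finset.card_map ⟨Prod.mk i, Prod.mk_right_injective i⟩]
  congr 1
  ext ⟨j, s⟩
  simp only [Finset.mem_map, Finset.mem_preimage, Function.Embedding.coeFn_mk, Finset.mem_filter,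
    Prod.mk.injEq]
  constructor
  · rintro ⟨r, hr, rfl, rfl⟩
    exact ⟨hr, rfl⟩
  · rintro ⟨hr, rfl⟩
    exact ⟨s, hr, rfl, rfl⟩

end Count

/-! ### Crossings of a segment with the strands of a diagram -/

/-- Coordinates in the plane adapted to a line: `e` spans the line, `π` is the coordinate along the
line, and `τ` the transverse coordinate. -/
structure LineCoord (e : ℝ × ℝ) (π τ : ℝ × ℝ →L[ℝ] ℝ) : Prop where
  transverse : ∀ q, τ q = 0 ↔ q = π q • e
  det : ∃ σ : ℝ, σ ≠ 0 ∧ ∀ v : ℝ × ℝ, v.1 * e.2 - v.2 * e.1 = σ * τ v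

lemma lineCoord_horizontal :
    LineCoord (1, 0) (ContinuousLinearMap.fst ℝ ℝ ℝ) (ContinuousLinearMap.snd ℝ ℝ ℝ) where
  transverse q := by simp [Prod.ext_iff]
  det := ⟨-1, by norm_num, by simp⟩

lemma lineCoord_vertical :
    LineCoord (0, 1) (ContinuousLinearMap.snd ℝ ℝ ℝ) (ContinuousLinearMap.fst ℝ ℝ ℝ) where
  transverse q := by simp [Prod.ext_iff]
  det := ⟨1, by norm_num, by simp⟩

section Strand

variable {X : Type u} [TopologicalSpace X] {n : ℕ} {γ : Fin n → C(UnitAddCircle, X)}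
  {φ : C(ℝ × ℝ, X)} {e a b : ℝ × ℝ} {π τ : ℝ × ℝ →L[ℝ] ℝ} {A : Set (Fin n × UnitAddCircle)}

/-- A strand along a line crosses transversely every segment which joins both sides of the line. -/
lemma jumpsAt_of_strand (hφ : IsOpenEmbedding φ) (hl : LineCoord e π τ) (hA : IsOpen A)
    (hinj : Set.InjOn (total γ) A) (hmap : Set.MapsTo (total γ) A (φ '' {q | τ q = 0}))
    (hab : τ a ≠ τ b) {i : Fin n} {t₀ : ℝ} (ht₀ : (i, (t₀ : UnitAddCircle)) ∈ A)
    (hseg : γ i t₀ ∈ φ '' segment ℝ a b) :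
    JumpsAt (fun t : ℝ ↦ segmentForm φ a b (γ i t₀) (γ i t)) t₀ := by
  obtain ⟨σ, hσ, hdet⟩ := hl.det
  have hev : ∀ᶠ t : ℝ in 𝓝 t₀, (i, (t : UnitAddCircle)) ∈ A := by
    have hc : Continuous fun t : ℝ ↦ ((i, (t : UnitAddCircle)) : Fin n × UnitAddCircle) :=
      continuous_const.prodMk (AddCircle.continuous_mk' 1)
    exact hc.continuousAt.eventually (hA.mem_nhds ht₀)
  obtain ⟨ε₀, hε₀, hball⟩ := Metric.eventually_nhds_iff.1 hev
  -- With `ε < 1 / 2` the interval of radius `ε` around `t₀` is shorter than the circle and embeds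
  -- in it.
  obtain ⟨ε, hε, hε1, hε2⟩ : ∃ ε > 0, ε < ε₀ ∧ ε < 1 / 2 :=
    ⟨min ε₀ (1 / 2) / 2, by positivity, by linarith [min_le_left ε₀ (1 / 2)],
      by linarith [min_le_right ε₀ (1 / 2), lt_min hε₀ (show (0 : ℝ) < 1 / 2 by norm_num)]⟩
  have hI (t : ℝ) (ht : t ∈ Set.Icc (t₀ - ε) (t₀ + ε)) : (i, (t : UnitAddCircle)) ∈ A :=
    hball (by rw [Real.dist_eq, abs_lt]; constructor <;> linarith [ht.1, ht.2])
  let ψ := hφ.toOpenPartialHomeomorph φ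
  have hψ (q : ℝ × ℝ) : ψ.symm (φ q) = q := ψ.left_inv (by simp [ψ])
  let x : ℝ → ℝ := fun t ↦ π (ψ.symm (γ i t))
  have hx (t : ℝ) (ht : t ∈ Set.Icc (t₀ - ε) (t₀ + ε)) : γ i t = φ (x t • e) := by
    obtain ⟨q, hq, hq'⟩ := hmap (hI t ht)
    have hq' : φ q = γ i t := hq'
    have : ψ.symm (γ i t) = q := by rw [← hq', hψ]
    simp only [x, this]
    rw [← (hl.transverse q).1 hq, hq']
  have hxc : ContinuousOn x (Set.Icc (t₀ - ε) (t₀ + ε)) := by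
    refine π.continuous.comp_continuousOn (ψ.symm.continuousOn.comp
      ((γ i).continuous.comp (AddCircle.continuous_mk' 1)).continuousOn fun t ht ↦ ?_)
    rw [OpenPartialHomeomorph.symm_source]
    refine ⟨x t • e, by simp, (hx t ht).symm⟩
  have hxi : Set.InjOn x (Set.Icc (t₀ - ε) (t₀ + ε)) := by
    intro s hs t ht hst
    by_contra hne
    have h1 := hinj (hI s hs) (hI t ht)
      (show γ i s = γ i t by rw [hx s hs, hx t ht, hst])
    refine coe_ne_coe_unitAddCircle hne ?_ (Prod.ext_iff.1 h1).2
    rw [abs_lt]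
    constructor <;> linarith [hs.1, hs.2, ht.1, ht.2]
  obtain ⟨p, hp, hp'⟩ := hseg
  have m0 : t₀ ∈ Set.Icc (t₀ - ε) (t₀ + ε) := ⟨by linarith, by linarith⟩
  have hp0 : p = x t₀ • e := hφ.injective (hp'.trans (hx t₀ m0))
  -- Along the strand's line the side of the segment is an affine function of the position. Its
  -- slope is non-zero since `a` and `b` have different transverse coordinates.
  have hcross (s : ℝ) : cross a b (s • e) = (s - x t₀) * (σ * (τ b - τ a)) := by
    have h1 := cross_eq_zero_of_mem_segment hp
    have h2 := hdet (b - a)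
    rw [map_sub] at h2
    rw [hp0] at h1
    simp only [cross, Prod.smul_fst, Prod.smul_snd, smul_eq_mul, Prod.fst_sub, Prod.snd_sub]
      at h1 h2 ⊢
    linear_combination h1 + (s - x t₀) * h2
  have hα : σ * (τ b - τ a) ≠ 0 := mul_ne_zero hσ (sub_ne_zero.2 hab.symm)
  set α := σ * (τ b - τ a) with hαdef
  have hval (t : ℝ) (ht : t ∈ Set.Icc (t₀ - ε) (t₀ + ε)) :
      (0 < (x t - x t₀) * α → segmentForm φ a b (γ i t₀) (γ i t) = 1) ∧
      ((x t - x t₀) * α ≤ 0 → segmentForm φ a b (γ i t₀) (γ i t) = 0) := by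
    rw [← hp', hx t ht, segmentForm_apply hφ, hcross]
    exact ⟨fun h ↦ if_pos ⟨hp, h⟩, fun h ↦ if_neg fun h' ↦ h.not_gt h'.2⟩
  have hright (t) (ht : t ∈ Set.Ioo t₀ (t₀ + ε)) : t ∈ Set.Icc (t₀ - ε) (t₀ + ε) :=
    ⟨by linarith [ht.1], ht.2.le⟩
  have hleft (t) (ht : t ∈ Set.Ioo (t₀ - ε) t₀) : t ∈ Set.Icc (t₀ - ε) (t₀ + ε) :=
    ⟨ht.1.le, by linarith [ht.2]⟩
  have dich : ((∀ t ∈ Set.Ioo t₀ (t₀ + ε), 0 < (x t - x t₀) * α) ∧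
      ∀ t ∈ Set.Ioo (t₀ - ε) t₀, (x t - x t₀) * α ≤ 0) ∨
      ((∀ t ∈ Set.Ioo t₀ (t₀ + ε), (x t - x t₀) * α ≤ 0) ∧
      ∀ t ∈ Set.Ioo (t₀ - ε) t₀, 0 < (x t - x t₀) * α) := by
    -- The position on the line is continuous and injective in time, hence strictly monotone: the
    -- strand passes from one side to the other at `t₀` without turning back.
    rcases hxc.strictMonoOn_of_injOn_Icc' (by linarith) hxi with hm | hm
    · have h1 (t) (ht : t ∈ Set.Ioo t₀ (t₀ + ε)) := hm m0 (hright t ht) ht.1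
      have h2 (t) (ht : t ∈ Set.Ioo (t₀ - ε) t₀) := hm (hleft t ht) m0 ht.2
      rcases hα.lt_or_gt with h | h
      · exact .inr ⟨fun t ht ↦ by nlinarith [h1 t ht], fun t ht ↦ by nlinarith [h2 t ht]⟩
      · exact .inl ⟨fun t ht ↦ by nlinarith [h1 t ht], fun t ht ↦ by nlinarith [h2 t ht]⟩
    · have h1 (t) (ht : t ∈ Set.Ioo t₀ (t₀ + ε)) := hm m0 (hright t ht) ht.1
      have h2 (t) (ht : t ∈ Set.Ioo (t₀ - ε) t₀) := hm (hleft t ht) m0 ht.2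
      rcases hα.lt_or_gt with h | h
      · exact .inl ⟨fun t ht ↦ by nlinarith [h1 t ht], fun t ht ↦ by nlinarith [h2 t ht]⟩
      · exact .inr ⟨fun t ht ↦ by nlinarith [h1 t ht], fun t ht ↦ by nlinarith [h2 t ht]⟩
  rcases dich with ⟨h1, h2⟩ | ⟨h1, h2⟩
  · refine ⟨ε, hε, 1, fun t ht ↦ (hval t (hright t ht)).1 (h1 t ht), fun t ht ↦ ?_⟩
    exact (hval t (hleft t ht)).2 (h2 t ht)
  · refine ⟨ε, hε, 0, fun t ht ↦ (hval t (hright t ht)).2 (h1 t ht), fun t ht ↦ ?_⟩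
    exact (hval t (hleft t ht)).1 (h2 t ht)

/-- The crossings of a segment with a strand along a line. -/
lemma exists_crossings_of_strand (hφ : IsOpenEmbedding φ) (hl : LineCoord e π τ) (hA : IsOpen A)
    (hbij : Set.BijOn (total γ) A (φ '' {q | τ q = 0})) (ha : τ a ≠ 0) (hb : τ b ≠ 0) :
    ∃ T : Finset (Fin n × UnitAddCircle),
      (∀ s, s ∈ T ↔ s ∈ A ∧ total γ s ∈ φ '' segment ℝ a b) ∧
      (∀ (i : Fin n) (t : ℝ), (i, (t : UnitAddCircle)) ∈ T →
        JumpsAt (fun r : ℝ ↦ segmentForm φ a b (γ i t) (γ i r)) t) ∧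
      (T.card : ZMod 2) = if τ a * τ b < 0 then 1 else 0 := by
  classical
  by_cases h : τ a * τ b < 0
  · have hne : τ a ≠ τ b := by
      intro h'
      rw [h'] at h
      nlinarith [mul_self_nonneg (τ b)]
    have hd : τ a - τ b ≠ 0 := sub_ne_zero.2 hne
    -- The zero of the affine function `τ` along the segment.
    set p : ℝ × ℝ := a + (τ a / (τ a - τ b)) • (b - a) with hp
    have hpτ : τ p = 0 := by
      rw [hp, map_add, map_smul, map_sub, smul_eq_mul]
      field_simp
      ring
    have hps : p ∈ segment ℝ a b := by
      refine mem_segment_iff.2 ⟨_, ?_, rfl⟩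
      rcases ha.lt_or_gt with h1 | h1
      · have h2 : 0 < τ b := by nlinarith
        exact ⟨div_nonneg_of_nonpos h1.le (by linarith), by
          rw [div_le_one_of_neg (by linarith)]
          linarith⟩
      · have h2 : τ b < 0 := by nlinarith
        exact ⟨div_nonneg h1.le (by linarith), by
          rw [div_le_one (by linarith)]
          linarith⟩
    have huniq (q : ℝ × ℝ) (hq : q ∈ segment ℝ a b) (hq0 : τ q = 0) : q = p := by
      obtain ⟨t, -, rfl⟩ := mem_segment_iff.1 hq
      rw [map_add, map_smul, map_sub, smul_eq_mul] at hq0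
      have : t = τ a / (τ a - τ b) := by
        rw [eq_div_iff hd]
        linarith
      rw [hp, this]
    obtain ⟨s₀, hs₀, hs₀'⟩ := hbij.surjOn ⟨p, hpτ, rfl⟩
    have hmem (s) : s ∈ ({s₀} : Finset (Fin n × UnitAddCircle)) ↔
        s ∈ A ∧ total γ s ∈ φ '' segment ℝ a b := by
      rw [Finset.mem_singleton]
      constructor
      · rintro rfl
        exact ⟨hs₀, p, hps, hs₀'.symm⟩
      · rintro ⟨hsA, q, hq, hq'⟩
        refine hbij.injOn hsA hs₀ ?_
        obtain ⟨q', hq1, hq2⟩ := hbij.mapsTo hsA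
        have : q' = q := hφ.injective (hq2.trans hq'.symm)
        rw [hs₀', ← hq', huniq q hq (this ▸ hq1)]
    refine ⟨{s₀}, hmem, fun i t ht ↦ ?_, by simp [h]⟩
    have := (hmem _).1 ht
    exact jumpsAt_of_strand hφ hl hA hbij.injOn hbij.mapsTo hne this.1 this.2
  · refine ⟨∅, fun s ↦ ?_, by simp, by simp [h]⟩
    simp only [Finset.notMem_empty, false_iff, not_and]
    rintro hsA ⟨q, hq, hq'⟩
    obtain ⟨q', hq1, hq2⟩ := hbij.mapsTo hsA
    have : q' = q := hφ.injective (hq2.trans hq'.symm)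
    subst this
    obtain ⟨t, ht, rfl⟩ := mem_segment_iff.1 hq
    have hq1 : τ (a + t • (b - a)) = 0 := hq1
    rw [map_add, map_smul, map_sub, smul_eq_mul] at hq1
    have hpos : 0 < τ a * τ b := lt_of_le_of_ne (not_lt.1 h) (mul_ne_zero ha hb).symm
    have h0 := ht.1
    have h1 := ht.2
    have e1 : τ a * (τ a + t * (τ b - τ a)) = 0 := by rw [hq1, mul_zero]
    -- Multiplication by `τ a` turns the vanishing of `τ` at the point into a vanishing convex
    -- combination of two positive numbers.
    have e2 : (1 - t) * (τ a * τ a) + t * (τ a * τ b) = 0 := by linarith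
    have p1 : 0 < τ a * τ a := mul_self_pos.2 ha
    rcases eq_or_lt_of_le h0 with rfl | h0'
    · simp at e2
      exact ha e2
    · have : 0 < t * (τ a * τ b) := mul_pos h0' hpos
      have : 0 ≤ (1 - t) * (τ a * τ a) := mul_nonneg (by linarith) p1.le
      linarith

/-- `φ` parametrizes a disc in which the diagram is the horizontal axis. -/
def IsArcDisc (γ : Fin n → C(UnitAddCircle, X)) (φ : C(ℝ × ℝ, X)) : Prop :=
  Set.BijOn (total γ) (total γ ⁻¹' Set.range φ) (φ '' {q | q.2 = 0})

/-- `φ` parametrizes a disc in which the diagram consists of the two axes. -/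
def IsCrossingDisc (γ : Fin n → C(UnitAddCircle, X)) (φ : C(ℝ × ℝ, X)) : Prop :=
  ∃ A B : Set (Fin n × UnitAddCircle), IsOpen A ∧ IsOpen B ∧ Disjoint A B ∧
    A ∪ B = total γ ⁻¹' Set.range φ ∧ Set.BijOn (total γ) A (φ '' {q | q.2 = 0}) ∧
    Set.BijOn (total γ) B (φ '' {q | q.1 = 0})

lemma continuous_total (γ : Fin n → C(UnitAddCircle, X)) : Continuous (total γ) :=
  continuous_prod_of_discrete_left.2 fun i ↦ (γ i).continuous

lemma sum_period_of_disjoint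
    (h : ∀ s, total γ s ∉ Set.range φ) : ∑ i, period (segmentForm φ a b) (γ i) = 0 := by
  rw [sum_period_eq_card ∅ (fun s _ ↦ segmentForm_of_notMem fun hs ↦
    h s (Set.image_subset_range _ _ hs)) (by simp)]
  simp

lemma sum_period_of_isArcDisc (hφ : IsOpenEmbedding φ) (h : IsArcDisc γ φ) (ha : a.2 ≠ 0)
    (hb : b.2 ≠ 0) :
    ∑ i, period (segmentForm φ a b) (γ i) = if a.2 * b.2 < 0 then 1 else 0 := by
  obtain ⟨T, hT, hj, hc⟩ := exists_crossings_of_strand (a := a) (b := b) hφ lineCoord_horizontal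
    (hφ.isOpen_range.preimage (continuous_total γ)) h ha hb
  refine (sum_period_eq_card T (fun s hs ↦ segmentForm_of_notMem fun hs' ↦ ?_) hj).trans hc
  exact hs ((hT s).2 ⟨Set.image_subset_range _ _ hs', hs'⟩)

/-- The parameter sets of the two strands are disjoint, so crossings with the two axes are counted
separately, even if the segment runs through the double point. -/
lemma sum_period_of_isCrossingDisc (hφ : IsOpenEmbedding φ) (h : IsCrossingDisc γ φ)
    (ha : a.2 ≠ 0) (hb : b.2 ≠ 0) (ha' : a.1 ≠ 0) (hb' : b.1 ≠ 0) :
    ∑ i, period (segmentForm φ a b) (γ i) =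
      (if a.2 * b.2 < 0 then 1 else 0) + if a.1 * b.1 < 0 then 1 else 0 := by
  classical
  obtain ⟨A, B, hA, hB, hAB, hU, hbA, hbB⟩ := h
  obtain ⟨T, hT, hj, hc⟩ := exists_crossings_of_strand (a := a) (b := b) hφ lineCoord_horizontal
    hA hbA ha hb
  obtain ⟨T', hT', hj', hc'⟩ := exists_crossings_of_strand (a := a) (b := b) hφ lineCoord_vertical
    hB hbB ha' hb'
  have hd : Disjoint T T' := Finset.disjoint_left.2 fun s h h' ↦
    Set.disjoint_left.1 hAB ((hT s).1 h).1 ((hT' s).1 h').1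
  rw [sum_period_eq_card (T ∪ T') (fun s hs ↦ segmentForm_of_notMem fun hs' ↦ hs ?_)
    (fun i t ht ↦ ?_), Finset.card_union_of_disjoint hd, Nat.cast_add, hc, hc']
  · rfl
  · have : s ∈ A ∪ B := by
      rw [hU]
      exact Set.image_subset_range _ _ hs'
    rw [Finset.mem_union, hT, hT']
    exact this.imp (fun h ↦ ⟨h, hs'⟩) fun h ↦ ⟨h, hs'⟩
  · exact (Finset.mem_union.1 ht).elim (hj i t) (hj' i t)

end Strand

/-! ### Charts and discs -/

/-- The plane with its two coordinates. -/
def planeHomeo : EuclideanSpace ℝ (Fin 2) ≃ₜ ℝ × ℝ :=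
  (EuclideanSpace.equiv (Fin 2) ℝ).toHomeomorph.trans Homeomorph.finTwoArrow

lemma planeHomeo_symm_zero (q : ℝ × ℝ) : planeHomeo.symm q 0 = q.1 :=
  congrArg Prod.fst (planeHomeo.apply_symm_apply q)

lemma planeHomeo_symm_one (q : ℝ × ℝ) : planeHomeo.symm q 1 = q.2 :=
  congrArg Prod.snd (planeHomeo.apply_symm_apply q)

section Charts

variable {X : Type u} [TopologicalSpace X] {n : ℕ} {γ : Fin n → C(UnitAddCircle, X)}

/-- A chart onto the whole plane, as a parametrized disc. -/
lemma exists_disc (e : OpenPartialHomeomorph X (EuclideanSpace ℝ (Fin 2)))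
    (he : e.target = Set.univ) : ∃ φ : C(ℝ × ℝ, X), IsOpenEmbedding φ ∧ Set.range φ = e.source ∧
      ∀ q, e (φ q) = planeHomeo.symm q := by
  have h1 : IsOpenEmbedding (e.symm ∘ planeHomeo.symm) :=
    (e.symm.isOpenEmbedding he).comp planeHomeo.symm.isOpenEmbedding
  refine ⟨⟨_, h1.continuous⟩, h1, ?_, fun q ↦ e.right_inv (by simp [he])⟩
  ext x
  constructor
  · rintro ⟨q, rfl⟩
    exact e.map_target (by simp [he])
  · intro hx
    exact ⟨planeHomeo (e x), by simp [e.left_inv hx]⟩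

lemma image_disc {e : OpenPartialHomeomorph X (EuclideanSpace ℝ (Fin 2))} {φ : C(ℝ × ℝ, X)}
    (hr : Set.range φ = e.source) (he : ∀ q, e (φ q) = planeHomeo.symm q)
    {P : EuclideanSpace ℝ (Fin 2) → Prop} {Q : ℝ × ℝ → Prop}
    (hPQ : ∀ q, P (planeHomeo.symm q) ↔ Q q) : φ '' {q | Q q} = {x | x ∈ e.source ∧ P (e x)} := by
  ext x
  constructor
  · rintro ⟨q, hq, rfl⟩
    exact ⟨hr ▸ ⟨q, rfl⟩, by rw [he]; exact (hPQ q).2 hq⟩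
  · rintro ⟨hx, hx'⟩
    rw [← hr] at hx
    obtain ⟨q, rfl⟩ := hx
    rw [he] at hx'
    exact ⟨q, (hPQ q).1 hx', rfl⟩

lemma IsArcChart.exists_disc {e : OpenPartialHomeomorph X (EuclideanSpace ℝ (Fin 2))}
    (h : IsArcChart γ e) : ∃ φ : C(ℝ × ℝ, X), IsOpenEmbedding φ ∧ Set.range φ = e.source ∧
      (∀ q, e (φ q) = planeHomeo.symm q) ∧ IsArcDisc γ φ := by
  obtain ⟨φ, hφ, hr, he⟩ := SurfaceLink.exists_disc e h.target_eq
  refine ⟨φ, hφ, hr, he, ?_⟩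
  have := h.bijOn
  rwa [← image_disc (P := fun v ↦ v 1 = 0) (Q := fun q ↦ q.2 = 0) hr he
    (fun q ↦ by rw [planeHomeo_symm_one]), ← hr] at this

lemma IsCrossingChart.exists_disc {e : OpenPartialHomeomorph X (EuclideanSpace ℝ (Fin 2))}
    (h : IsCrossingChart γ e) : ∃ φ : C(ℝ × ℝ, X), IsOpenEmbedding φ ∧ Set.range φ = e.source ∧
      IsCrossingDisc γ φ := by
  obtain ⟨φ, hφ, hr, he⟩ := SurfaceLink.exists_disc e h.target_eq
  refine ⟨φ, hφ, hr, ?_⟩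
  have := h.exists_strands
  rwa [← image_disc (P := fun v ↦ v 1 = 0) (Q := fun q ↦ q.2 = 0) hr he
    (fun q ↦ by rw [planeHomeo_symm_one]),
    ← image_disc (P := fun v ↦ v 0 = 0) (Q := fun q ↦ q.1 = 0) hr he
    (fun q ↦ by rw [planeHomeo_symm_zero]), ← hr] at this

lemma IsArcDisc.exists_chart {φ : C(ℝ × ℝ, X)} (hφ : IsOpenEmbedding φ) (h : IsArcDisc γ φ) :
    ∃ e : OpenPartialHomeomorph X (EuclideanSpace ℝ (Fin 2)), IsArcChart γ e ∧
      Set.range φ = e.source ∧ ∀ q, e (φ q) = planeHomeo.symm q := by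
  let e : OpenPartialHomeomorph X (EuclideanSpace ℝ (Fin 2)) :=
    (hφ.toOpenPartialHomeomorph φ).symm.trans planeHomeo.symm.toOpenPartialHomeomorph
  have hr : Set.range φ = e.source := by simp [e]
  have he (q) : e (φ q) = planeHomeo.symm q := by
    have : (hφ.toOpenPartialHomeomorph φ).symm (φ q) = q :=
      (hφ.toOpenPartialHomeomorph φ).left_inv (by simp)
    simp [e, this]
  refine ⟨e, ⟨by simp [e], ?_⟩, hr, he⟩
  rw [← image_disc (P := fun v ↦ v 1 = 0) (Q := fun q ↦ q.2 = 0) hr he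
    (fun q ↦ by rw [planeHomeo_symm_one]), ← hr]
  exact h

/-- A small ball inside a chart is itself homeomorphic to the whole plane, by
`OpenPartialHomeomorph.univBall`. -/
lemma exists_disc_subset [ChartedSpace (EuclideanSpace ℝ (Fin 2)) X] {x : X} {U : Set X}
    (hU : U ∈ 𝓝 x) : ∃ φ : C(ℝ × ℝ, X), IsOpenEmbedding φ ∧ φ 0 = x ∧ Set.range φ ⊆ U := by
  let e := chartAt (EuclideanSpace ℝ (Fin 2)) x
  have hx : x ∈ e.source := mem_chart_source _ x
  have h1 : e.target ∩ e.symm ⁻¹' U ∈ 𝓝 (e x) :=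
    inter_mem (e.open_target.mem_nhds (e.map_source hx))
      ((e.continuousAt_symm (e.map_source hx)).preimage_mem_nhds (by rwa [e.left_inv hx]))
  obtain ⟨r, hr, hball⟩ := Metric.mem_nhds_iff.1 h1
  let u := OpenPartialHomeomorph.univBall (e x) r
  have hmap (v) : u v ∈ Metric.ball (e x) r := by
    rw [← OpenPartialHomeomorph.univBall_target (e x) hr]
    exact u.map_source (by simp [u])
  have hs : (u.trans e.symm).source = Set.univ := by
    ext v
    simp only [OpenPartialHomeomorph.trans_source, Set.mem_inter_iff, Set.mem_preimage,
      OpenPartialHomeomorph.symm_source, Set.mem_univ, iff_true]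
    exact ⟨by simp [u], (hball (hmap v)).1⟩
  have h2 := ((u.trans e.symm).isOpenEmbedding hs).comp planeHomeo.symm.isOpenEmbedding
  refine ⟨⟨_, h2.continuous⟩, h2, ?_, ?_⟩
  · have : planeHomeo.symm (0, 0) = 0 := by
      rw [Homeomorph.symm_apply_eq]
      rfl
    change e.symm (u (planeHomeo.symm (0, 0))) = x
    rw [this, OpenPartialHomeomorph.univBall_apply_zero, e.left_inv hx]
  · rintro - ⟨q, rfl⟩
    exact (hball (hmap _)).2

end Charts

/-! ### Integrals along a diagram, and the discs around its points. -/

namespace LinkDiagram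

variable {X : Type u} [TopologicalSpace X] {n : ℕ} (L : LinkDiagram X n)

/-- The sum of the integrals of a form along the components of the diagram. -/
def integral (ω : Form X) : ZMod 2 := ∑ i, period ω (L.curve i)

variable {L} {ω η : Form X} {φ : C(ℝ × ℝ, X)} {a b : ℝ × ℝ}

lemma integral_add (h : ∀ x ∈ L.support, ClosedAt ω x) (h' : ∀ x ∈ L.support, ClosedAt η x) :
    L.integral (ω + η) = L.integral ω + L.integral η := by
  rw [integral, integral, integral, ← Finset.sum_add_distrib]
  exact Finset.sum_congr rfl fun i _ ↦
    period_add (fun s ↦ h _ ⟨(i, s), rfl⟩) fun s ↦ h' _ ⟨(i, s), rfl⟩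

lemma integral_congr (h : ∀ x ∈ L.support, ω x = η x) : L.integral ω = L.integral η :=
  Finset.sum_congr rfl fun i _ ↦ period_congr fun s ↦ h _ ⟨(i, s), rfl⟩

lemma integral_eq_zero (h : ∀ x ∈ L.support, ClosedAt ω x) {F : X → ZMod 2}
    (hF : ∀ x ∈ L.support, PrimitiveAt ω F x) : L.integral ω = 0 :=
  Finset.sum_eq_zero fun i _ ↦
    period_eq_zero (fun s ↦ h _ ⟨(i, s), rfl⟩) fun s ↦ hF _ ⟨(i, s), rfl⟩

lemma isClosed_support [T2Space X] : IsClosed L.support :=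
  (isCompact_range (continuous_total L.curve)).isClosed

lemma integral_segmentForm_of_disjoint (h : Set.range φ ⊆ L.supportᶜ) :
    L.integral (segmentForm φ a b) = 0 :=
  sum_period_of_disjoint fun s hs ↦ h hs ⟨s, rfl⟩

/-- The points of an arc disc on the diagram are those on the horizontal axis. -/
lemma mem_support_iff_of_isArcDisc (hφ : IsOpenEmbedding φ) (h : IsArcDisc L.curve φ) {q : ℝ × ℝ} :
    φ q ∈ L.support ↔ q.2 = 0 := by
  constructor
  · rintro ⟨s, hs⟩
    obtain ⟨q', hq', e⟩ := h.mapsTo (show s ∈ total L.curve ⁻¹' Set.range φ from ⟨q, hs.symm⟩)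
    rwa [← hφ.injective (e.trans hs)]
  · intro hq
    obtain ⟨s, -, hs⟩ := h.surjOn ⟨q, hq, rfl⟩
    exact ⟨s, hs⟩

/-- The points of a crossing disc on the diagram are those on the axes. -/
lemma mem_support_iff_of_isCrossingDisc (hφ : IsOpenEmbedding φ) (h : IsCrossingDisc L.curve φ)
    {q : ℝ × ℝ} : φ q ∈ L.support ↔ q.2 = 0 ∨ q.1 = 0 := by
  obtain ⟨A, B, -, -, -, hU, hA, hB⟩ := h
  constructor
  · rintro ⟨s, hs⟩
    have : s ∈ A ∪ B := by
      rw [hU]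
      exact ⟨q, hs.symm⟩
    rcases this with hsA | hsB
    · obtain ⟨q', hq', e⟩ := hA.mapsTo hsA
      rw [← hφ.injective (e.trans hs)]
      exact .inl hq'
    · obtain ⟨q', hq', e⟩ := hB.mapsTo hsB
      rw [← hφ.injective (e.trans hs)]
      exact .inr hq'
  · rintro (hq | hq)
    · obtain ⟨s, -, hs⟩ := hA.surjOn ⟨q, hq, rfl⟩
      exact ⟨s, hs⟩
    · obtain ⟨s, -, hs⟩ := hB.surjOn ⟨q, hq, rfl⟩
      exact ⟨s, hs⟩

/-- Each point of the diagram has an arc disc or a crossing disc. -/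
lemma exists_disc_of_mem_support {x : X} (hx : x ∈ L.support) :
    ∃ φ : C(ℝ × ℝ, X), IsOpenEmbedding φ ∧ x ∈ Set.range φ ∧
      (IsArcDisc L.curve φ ∨ IsCrossingDisc L.curve φ) := by
  obtain ⟨e, hxe, h | h⟩ := L.generic x hx
  · obtain ⟨φ, hφ, hr, -, h'⟩ := h.exists_disc
    exact ⟨φ, hφ, hr ▸ hxe, .inl h'⟩
  · obtain ⟨φ, hφ, hr, h'⟩ := h.exists_disc
    exact ⟨φ, hφ, hr ▸ hxe, .inr h'⟩

/-- The diagram is nowhere dense. -/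
lemma dense_compl_support : Dense L.supportᶜ := by
  rw [← interior_eq_empty_iff_dense_compl, Set.eq_empty_iff_forall_notMem]
  intro x hx
  obtain ⟨φ, hφ, ⟨q, rfl⟩, h⟩ := exists_disc_of_mem_support (interior_subset hx)
  have hd : Dense (({0}ᶜ : Set ℝ) ×ˢ ({0}ᶜ : Set ℝ)) :=
    (dense_compl_singleton 0).prod (dense_compl_singleton 0)
  obtain ⟨p, hp, hp'⟩ := hd.inter_open_nonempty _ (isOpen_interior.preimage φ.continuous) ⟨q, hx⟩
  have hp := interior_subset hp
  rcases h with h | h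
  · exact hp'.2 ((mem_support_iff_of_isArcDisc hφ h).1 hp)
  · exact ((mem_support_iff_of_isCrossingDisc hφ h).1 hp).elim (fun h ↦ hp'.2 h) fun h ↦ hp'.1 h

end LinkDiagram

/-! ### Almost closed forms and the checkerboard coloring of a null-homologous diagram -/

namespace LinkDiagram

variable {X : Type u} [TopologicalSpace X] {n : ℕ} {L : LinkDiagram X n} {ω η : Form X}
  {φ : C(ℝ × ℝ, X)} {a b : ℝ × ℝ} {x y z : X}

variable (L) in
/-- The form is closed except at finitely many points off the diagram. -/
def AlmostClosed (ω : Form X) : Prop :=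
  ∃ Z : Set X, Z.Finite ∧ (∀ z ∈ Z, z ∉ L.support) ∧ ∀ x ∉ Z, ClosedAt ω x

lemma almostClosed_of_closedAt (h : ∀ x, ClosedAt ω x) : L.AlmostClosed ω :=
  ⟨∅, Set.finite_empty, by simp, fun x _ ↦ h x⟩

lemma AlmostClosed.add (hω : L.AlmostClosed ω) (hη : L.AlmostClosed η) :
    L.AlmostClosed (ω + η) := by
  obtain ⟨Z, hZ, hZL, hZc⟩ := hω
  obtain ⟨Z', hZ', hZL', hZc'⟩ := hη
  refine ⟨Z ∪ Z', hZ.union hZ', ?_, ?_⟩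
  · rintro z (h | h)
    exacts [hZL z h, hZL' z h]
  · intro x hx
    exact (hZc x fun h ↦ hx (.inl h)).add (hZc' x fun h ↦ hx (.inr h))

lemma AlmostClosed.closedAt (hω : L.AlmostClosed ω) (hx : x ∈ L.support) : ClosedAt ω x := by
  obtain ⟨Z, -, hZL, hZc⟩ := hω
  exact hZc x fun h ↦ hZL x h hx

lemma AlmostClosed.eventually [T1Space X] (hω : L.AlmostClosed ω) (z : X) :
    ∀ᶠ y in 𝓝[≠] z, ClosedAt ω y := by
  obtain ⟨Z, hZ, -, hZc⟩ := hω
  have : (Z \ {z})ᶜ ∈ 𝓝 z := (hZ.sdiff).isClosed.isOpen_compl.mem_nhds (by simp)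
  filter_upwards [nhdsWithin_le_nhds this, self_mem_nhdsWithin] with y hy hyz
  exact hZc y fun h ↦ hy ⟨h, hyz⟩

lemma AlmostClosed.integral_add (hω : L.AlmostClosed ω) (hη : L.AlmostClosed η) :
    L.integral (ω + η) = L.integral ω + L.integral η :=
  LinkDiagram.integral_add (fun _ h ↦ hω.closedAt h) fun _ h ↦ hη.closedAt h

lemma almostClosed_segmentForm [T2Space X] (hφ : IsOpenEmbedding φ) (ha : φ a ∉ L.support)
    (hb : φ b ∉ L.support) : L.AlmostClosed (segmentForm φ a b) := by
  refine ⟨{φ a, φ b}, by simp, ?_, ?_⟩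
  · rintro z (rfl | rfl)
    exacts [ha, hb]
  · intro x hx
    simp only [Set.mem_insert_iff, Set.mem_singleton_iff, not_or] at hx
    exact closedAt_segmentForm hφ hx.1 hx.2

lemma AlmostClosed.residue_add [ChartedSpace (EuclideanSpace ℝ (Fin 2)) X] [T1Space X]
    (hω : L.AlmostClosed ω) (hη : L.AlmostClosed η) :
    residue (ω + η) z = residue ω z + residue η z := by
  obtain ⟨φ, hφ, h0, -⟩ := exists_disc_subset (univ_mem : (Set.univ : Set X) ∈ 𝓝 z)
  exact SurfaceLink.residue_add ⟨φ, hφ, h0⟩ (hω.eventually z) (hη.eventually z)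

/-- Without residues, an almost closed form can be made closed off the diagram. -/
lemma AlmostClosed.exists_closed [T1Space X] (hω : L.AlmostClosed ω) (h : ∀ z, residue ω z = 0) :
    ∃ ω' : Form X, (∀ x, ClosedAt ω' x) ∧ L.integral ω' = L.integral ω := by
  obtain ⟨Z, hZ, hZL, hZc⟩ := hω
  obtain ⟨ω', h1, h2, -, -⟩ := exists_closed_extension hZ hZc isOpen_empty (F := 0) (by simp)
  exact ⟨ω', fun x ↦ h2 x (.inr (residue_eq_zero_iff.1 (h x))),
    integral_congr fun x hx ↦ h1 x fun hx' ↦ hZL x hx' hx⟩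

open Classical in
variable (L) in
/-- Some almost closed form with simple singularities exactly at `x` and `y` (none if `x = y`)
has integral `ε` along the diagram. -/
def Joined (x y : X) (ε : ZMod 2) : Prop :=
  ∃ ω, L.AlmostClosed ω ∧ L.integral ω = ε ∧
    ∀ z, residue ω z = (if z = x then 1 else 0) + if z = y then 1 else 0

lemma joined_refl : L.Joined x x 0 := by
  refine ⟨0, almostClosed_of_closedAt fun _ ↦ closedAt_zero,
    integral_eq_zero (fun _ _ ↦ closedAt_zero) (F := 0) fun y _ ↦ by simp [PrimitiveAt], ?_⟩
  intro z
  rw [closedAt_zero.residue_eq_zero, add_self_zmod]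

/-- The residues at the common point `x` cancel modulo 2. -/
lemma Joined.trans [ChartedSpace (EuclideanSpace ℝ (Fin 2)) X] [T1Space X] {ε δ : ZMod 2}
    (h : L.Joined x y ε) (h' : L.Joined x z δ) :
    L.Joined y z (ε + δ) := by
  classical
  obtain ⟨ω, hω, rfl, hr⟩ := h
  obtain ⟨η, hη, rfl, hr'⟩ := h'
  refine ⟨ω + η, hω.add hη, hω.integral_add hη, fun w ↦ ?_⟩
  rw [hω.residue_add hη, hr, hr']
  have := add_self_zmod (if w = x then 1 else 0)
  linear_combination this

lemma joined_segment [T2Space X] (hφ : IsOpenEmbedding φ) (ha : φ a ∉ L.support)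
    (hb : φ b ∉ L.support) : L.Joined (φ a) (φ b) (L.integral (segmentForm φ a b)) :=
  ⟨_, almostClosed_segmentForm hφ ha hb, rfl, fun z ↦ residue_segmentForm hφ z⟩

lemma Joined.symm {ε : ZMod 2} (h : L.Joined x y ε) : L.Joined y x ε := by
  obtain ⟨ω, hω, h1, h2⟩ := h
  exact ⟨ω, hω, h1, fun z ↦ by rw [h2, add_comm]⟩

/-- Any two points off the diagram are joined. -/
lemma exists_joined [ChartedSpace (EuclideanSpace ℝ (Fin 2)) X] [T2Space X]
    [PreconnectedSpace X] (hx : x ∉ L.support) (hy : y ∉ L.support) :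
    ∃ ε, L.Joined x y ε := by
  let R : Set X := {y | y ∉ L.support ∧ ∃ ε, L.Joined x y ε}
  have step (φ : C(ℝ × ℝ, X)) (hφ : IsOpenEmbedding φ) {p q : ℝ × ℝ} (hp : φ p ∈ R)
      (hq : φ q ∉ L.support) : φ q ∈ R :=
    ⟨hq, _, (hp.2.choose_spec.symm.trans (joined_segment hφ hp.1 hq))⟩
  -- The complement of the diagram need not be connected, but it is dense. In a disc meeting `R` all
  -- points off the diagram belong to `R`, so the closure of `R` contains the disc.
  have hopen : IsOpen (closure R) := by
    rw [isOpen_iff_mem_nhds]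
    intro w hw
    obtain ⟨φ, hφ, rfl, -⟩ := exists_disc_subset (univ_mem : (Set.univ : Set X) ∈ 𝓝 w)
    refine mem_of_superset (hφ.isOpen_range.mem_nhds ⟨0, rfl⟩) ?_
    obtain ⟨-, ⟨p, rfl⟩, hp⟩ := mem_closure_iff.1 hw _ hφ.isOpen_range ⟨0, rfl⟩
    refine (L.dense_compl_support.open_subset_closure_inter hφ.isOpen_range).trans
      (closure_mono ?_)
    rintro - ⟨⟨q, rfl⟩, hq⟩
    exact step φ hφ hp hq
  have huniv : closure R = Set.univ :=
    IsClopen.eq_univ ⟨isClosed_closure, hopen⟩ ⟨x, subset_closure ⟨hx, 0, joined_refl⟩⟩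
  obtain ⟨φ, hφ, rfl, -⟩ := exists_disc_subset (univ_mem : (Set.univ : Set X) ∈ 𝓝 y)
  obtain ⟨-, ⟨p, rfl⟩, hp⟩ :=
    mem_closure_iff.1 (huniv ▸ Set.mem_univ (φ 0)) _ hφ.isOpen_range ⟨0, rfl⟩
  exact (step φ hφ hp hy).2

/-- A diagram with vanishing integrals of closed forms admits a checkerboard coloring. -/
theorem twoColorable_of_integral_eq_zero [ChartedSpace (EuclideanSpace ℝ (Fin 2)) X] [T2Space X]
    [ConnectedSpace X] (h : ∀ ω, (∀ x, ClosedAt ω x) → L.integral ω = 0) : L.TwoColorable := by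
  obtain ⟨o, ho⟩ := L.dense_compl_support.nonempty
  -- The color of `x` is the integral of some form whose only residues are at `o` and `x`.
  choose! col hcol using fun x (hx : x ∉ L.support) ↦ exists_joined ho hx
  -- Independence of choices: the sum of two forms with the same residues has none, so it can be
  -- made closed without changing its integral, which then vanishes by hypothesis.
  have key {x y ε} (hx : x ∉ L.support) (hy : y ∉ L.support) (hxy : L.Joined x y ε) :
      col x + col y = ε := by
    have := (hcol x hx).trans (hcol y hy)
    obtain ⟨ω, hω, h1, h2⟩ := hxy.trans this
    obtain ⟨ω', h3, h4⟩ := hω.exists_closed fun z ↦ by rw [h2, add_self_zmod]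
    rw [h ω' h3, h1] at h4
    exact (CharTwo.add_eq_zero.1 h4.symm).symm
  let f : ↥(L.supportᶜ) → Bool := fun x ↦ decide (col x = 1)
  -- A segment in a disc away from the diagram has integral `0`, so colors are locally constant and
  -- descend to regions.
  have hf : Continuous f := by
    refine IsLocallyConstant.continuous ((IsLocallyConstant.iff_eventually_eq f).2 fun x ↦ ?_)
    obtain ⟨φ, hφ, h0, hr⟩ := exists_disc_subset (isClosed_support.isOpen_compl.mem_nhds x.2)
    have : Subtype.val ⁻¹' Set.range φ ∈ 𝓝 x :=
      continuous_subtype_val.continuousAt.preimage_mem_nhds (hφ.isOpen_range.mem_nhds ⟨0, h0⟩)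
    filter_upwards [this]
    rintro ⟨y, hy⟩ ⟨q, rfl⟩
    have := key (h0 ▸ x.2) hy (joined_segment (L := L) hφ (h0 ▸ x.2) hy)
    rw [integral_segmentForm_of_disjoint hr, h0] at this
    simp only [f, CharTwo.add_eq_zero.1 this]
  refine ⟨hf.connectedComponentsLift, ?_⟩
  rintro R R' ⟨e, he, h1, h2⟩
  obtain ⟨φ, hφ, hr, heφ, harc⟩ := he.exists_disc
  have ha : φ (0, 1) ∉ L.support := by simp [mem_support_iff_of_isArcDisc hφ harc]
  have hb : φ (0, -1) ∉ L.support := by simp [mem_support_iff_of_isArcDisc hφ harc]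
  rw [← h1 ⟨_, ha⟩ (hr ▸ ⟨_, rfl⟩) (by rw [heφ, planeHomeo_symm_one]; norm_num),
    ← h2 ⟨_, hb⟩ (hr ▸ ⟨_, rfl⟩) (by rw [heφ, planeHomeo_symm_one]; norm_num)]
  -- The segment from `(0, 1)` to `(0, -1)` meets the arc once, so its ends have different colors.
  have := key ha hb (joined_segment hφ ha hb)
  rw [integral, sum_period_of_isArcDisc hφ harc (by norm_num) (by norm_num),
    if_pos (by norm_num)] at this
  simp only [Continuous.connectedComponentsLift_apply_coe, f]
  generalize col (φ (0, 1)) = s at this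
  generalize col (φ (0, -1)) = t at this
  revert s t
  decide

end LinkDiagram

/-! ### Checkerboard colorings and discs -/

/-- Half of a disc with two strands, containing a half of one of them, is an arc disc. -/
lemma isArcDisc_comp {X : Type u} [TopologicalSpace X] {n : ℕ} {γ : Fin n → C(UnitAddCircle, X)}
    {φ : C(ℝ × ℝ, X)} (hφ : IsOpenEmbedding φ) {g : C(ℝ × ℝ, ℝ × ℝ)}
    {A B : Set (Fin n × UnitAddCircle)} {SA SB : Set (ℝ × ℝ)}
    (hU : A ∪ B = total γ ⁻¹' Set.range φ) (hA : Set.BijOn (total γ) A (φ '' SA))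
    (hB : Set.BijOn (total γ) B (φ '' SB)) (hgB : ∀ q, g q ∉ SB)
    (hgA : ∀ q, g q ∈ SA ↔ q.2 = 0) : IsArcDisc γ (φ.comp g) := by
  -- The image of `g` avoids the second strand, so only parameters in `A` lie over it.
  have key {s q} (h : φ (g q) = total γ s) : s ∈ A := by
    have : s ∈ A ∪ B := hU ▸ ⟨g q, h⟩
    rcases this with hs | hs
    · exact hs
    · obtain ⟨p, hp, e⟩ := hB.mapsTo hs
      rw [hφ.injective (e.trans h.symm)] at hp
      exact absurd hp (hgB q)
  refine ⟨?_, ?_, ?_⟩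
  · rintro s ⟨q, hq⟩
    refine ⟨q, ?_, hq⟩
    obtain ⟨p, hp, e⟩ := hA.mapsTo (key hq)
    rw [hφ.injective (e.trans hq.symm)] at hp
    exact (hgA q).1 hp
  · rintro s ⟨q, hq⟩ t ⟨r, hr⟩ hst
    exact hA.injOn (key hq) (key hr) hst
  · rintro - ⟨q, hq, rfl⟩
    obtain ⟨s, hs, e⟩ := hA.surjOn ⟨g q, (hgA q).2 hq, rfl⟩
    exact ⟨s, ⟨q, e.symm⟩, e⟩

namespace LinkDiagram

variable {X : Type u} [TopologicalSpace X] {n : ℕ} {L : LinkDiagram X n} {col : X → ZMod 2}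
  {φ : C(ℝ × ℝ, X)} {a b : ℝ × ℝ}

variable (L) in
/-- The function `col` is a checkerboard coloring, with colors in `ℤ/2`. -/
structure IsColoring (col : X → ZMod 2) : Prop where
  eq_of_isPreconnected : ∀ S ⊆ L.supportᶜ, IsPreconnected S → ∀ x ∈ S, ∀ y ∈ S, col x = col y
  add_eq_one : ∀ φ : C(ℝ × ℝ, X), IsOpenEmbedding φ → IsArcDisc L.curve φ →
    ∀ a b : ℝ × ℝ, 0 < a.2 → b.2 < 0 → col (φ a) + col (φ b) = 1

/-- Each open half of an arc disc is connected and misses the diagram, hence lies in one region;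
these two regions are locally adjacent. The color `0` given to points of the diagram plays no role.
-/
lemma TwoColorable.exists_isColoring (h : L.TwoColorable) : ∃ col, L.IsColoring col := by
  classical
  obtain ⟨c, hc⟩ := h
  let col (x : X) : ZMod 2 :=
    if hx : x ∈ L.supportᶜ then (if c (ConnectedComponents.mk ⟨x, hx⟩) then 1 else 0) else 0
  have mk_eq (S : Set X) (hS : S ⊆ L.supportᶜ) (hS' : IsPreconnected S) (x y) (hx : x ∈ S)
      (hy : y ∈ S) : (ConnectedComponents.mk ⟨x, hS hx⟩ : L.Region) =
        ConnectedComponents.mk ⟨y, hS hy⟩ := by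
    have hpre : IsPreconnected (Subtype.val ⁻¹' S : Set ↥(L.supportᶜ)) := by
      rw [← IsInducing.subtypeVal.isPreconnected_image, Subtype.image_preimage_coe,
        Set.inter_eq_right.2 hS]
      exact hS'
    rw [ConnectedComponents.coe_eq_coe']
    exact hpre.subset_connectedComponent (by exact hy) (by exact hx)
  have col_eq {x} (hx : x ∈ L.supportᶜ) :
      col x = if c (ConnectedComponents.mk ⟨x, hx⟩) then 1 else 0 := dif_pos hx
  refine ⟨col, ⟨fun S hS hS' x hx y hy ↦ ?_, fun φ hφ harc a b ha hb ↦ ?_⟩⟩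
  · rw [col_eq (hS hx), col_eq (hS hy), mk_eq S hS hS' x y hx hy]
  · obtain ⟨e, he, hr, heφ⟩ := harc.exists_chart hφ
    have ha' : φ a ∈ L.supportᶜ := mt (mem_support_iff_of_isArcDisc hφ harc).1 ha.ne'
    have hb' : φ b ∈ L.supportᶜ := mt (mem_support_iff_of_isArcDisc hφ harc).1 hb.ne
    have hcon {S : Set (ℝ × ℝ)} (hS : Convex ℝ S)  : IsPreconnected (φ '' S) :=
      hS.isPreconnected.image _ φ.continuous.continuousOn
    have := hc (ConnectedComponents.mk ⟨φ a, ha'⟩) (ConnectedComponents.mk ⟨φ b, hb'⟩)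
      ⟨e, he, ?_, ?_⟩
    · rw [col_eq ha', col_eq hb']
      revert this
      generalize c _ = s
      generalize c _ = t
      revert s t
      decide
    · rintro ⟨x, hx⟩ hxe hx'
      rw [← hr] at hxe
      obtain ⟨q, rfl⟩ := hxe
      rw [heφ, planeHomeo_symm_one] at hx'
      have hsub : φ '' {q | 0 < q.2} ⊆ L.supportᶜ := by
        rintro - ⟨q, hq, rfl⟩
        exact mt (mem_support_iff_of_isArcDisc hφ harc).1 (ne_of_gt hq)
      exact mk_eq _ hsub (hcon ((convex_Ioi 0).linear_preimage (LinearMap.snd ℝ ℝ ℝ))) _ _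
        ⟨q, hx', rfl⟩ ⟨a, ha, rfl⟩
    · rintro ⟨x, hx⟩ hxe hx'
      rw [← hr] at hxe
      obtain ⟨q, rfl⟩ := hxe
      rw [heφ, planeHomeo_symm_one] at hx'
      have hsub : φ '' {q | q.2 < 0} ⊆ L.supportᶜ := by
        rintro - ⟨q, hq, rfl⟩
        exact mt (mem_support_iff_of_isArcDisc hφ harc).1 (ne_of_lt hq)
      exact mk_eq _ hsub (hcon ((convex_Iio 0).linear_preimage (LinearMap.snd ℝ ℝ ℝ))) _ _
        ⟨q, hx', rfl⟩ ⟨b, hb, rfl⟩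

variable (L) in
/-- In the disc `φ`, the integral along the diagram of the form dual to a segment is the
difference of the colors of its endpoints. -/
def IsColoredDisc (col : X → ZMod 2) (φ : C(ℝ × ℝ, X)) : Prop :=
  ∀ a b, φ a ∉ L.support → φ b ∉ L.support →
    L.integral (segmentForm φ a b) = col (φ a) + col (φ b)

lemma IsColoring.add_eq_one_of_mul_neg (h : L.IsColoring col) (hφ : IsOpenEmbedding φ)
    (harc : IsArcDisc L.curve φ) (hab : a.2 * b.2 < 0) : col (φ a) + col (φ b) = 1 := by
  rcases mul_neg_iff.1 hab with ⟨ha, hb⟩ | ⟨ha, hb⟩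
  · exact h.add_eq_one φ hφ harc a b ha hb
  · rw [add_comm]
    exact h.add_eq_one φ hφ harc b a hb ha

lemma IsColoring.isColoredDisc_of_isArcDisc (h : L.IsColoring col) (hφ : IsOpenEmbedding φ)
    (harc : IsArcDisc L.curve φ) : L.IsColoredDisc col φ := by
  intro a b ha hb
  rw [mem_support_iff_of_isArcDisc hφ harc] at ha hb
  rw [integral, sum_period_of_isArcDisc hφ harc ha hb]
  split_ifs with hab
  · exact (h.add_eq_one_of_mul_neg hφ harc hab).symm
  · have hpos : 0 < a.2 * b.2 := lt_of_le_of_ne (not_lt.1 hab) (mul_ne_zero ha hb).symm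
    -- For ends on the same side, both are compared with an auxiliary point on the other side.
    have h1 := h.add_eq_one_of_mul_neg (a := a) (b := (0, -b.2)) hφ harc (by simpa using hpos)
    have h2 := h.add_eq_one_of_mul_neg (a := b) (b := (0, -b.2)) hφ harc
      (by simpa using mul_self_pos.2 hb)
    linear_combination -h1 - h2 + add_self_zmod (col (φ (0, -b.2))) - add_self_zmod 1

/-- The open half-plane containing `a` and `b`, bounded by the vertical axis, becomes an arc disc
after an exponential change of the first coordinate. In it the diagram is half of the horizontal
axis, which separates `a` from `b`. -/
lemma IsColoring.add_eq_one_of_isCrossingDisc_right (h : L.IsColoring col) (hφ : IsOpenEmbedding φ)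
    (hc : IsCrossingDisc L.curve φ) (hab : 0 < a.1 * b.1) (hab' : a.2 * b.2 < 0) :
    col (φ a) + col (φ b) = 1 := by
  have ha : a.1 ≠ 0 := fun h ↦ by simp [h] at hab
  obtain ⟨A, B, -, -, -, hU, hA, hB⟩ := hc
  let g : C(ℝ × ℝ, ℝ × ℝ) := ⟨fun q ↦ (a.1 * Real.exp q.1, q.2), by fun_prop⟩
  have hg : IsOpenEmbedding g := IsOpenEmbedding.prodMap
    ((Homeomorph.mulLeft₀ a.1 ha).isOpenEmbedding.comp Real.isOpenEmbedding_exp) .id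
  have harc : IsArcDisc L.curve (φ.comp g) := isArcDisc_comp hφ hU hA hB
    (fun q ↦ mul_ne_zero ha (Real.exp_pos _).ne') fun q ↦ Iff.rfl
  have h1 : g (0, a.2) = a := by simp [g]
  have h2 : g (Real.log (b.1 / a.1), b.2) = b := by
    have : 0 < b.1 / a.1 := by
      rw [div_pos_iff]; rw [mul_pos_iff] at hab; tauto
    ext
    · simp [g, Real.exp_log this, mul_div_cancel₀ _ ha]
    · rfl
  have := h.add_eq_one_of_mul_neg (φ := φ.comp g) (a := (0, a.2))
    (b := (Real.log (b.1 / a.1), b.2)) (hφ.comp hg) harc hab'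
  rwa [ContinuousMap.comp_apply, ContinuousMap.comp_apply, h1, h2] at this

/-- The same argument with the axes exchanged: `g` swaps the coordinates so that the vertical strand
becomes horizontal. -/
lemma IsColoring.add_eq_one_of_isCrossingDisc_left (h : L.IsColoring col) (hφ : IsOpenEmbedding φ)
    (hc : IsCrossingDisc L.curve φ) (hab : 0 < a.2 * b.2) (hab' : a.1 * b.1 < 0) :
    col (φ a) + col (φ b) = 1 := by
  have ha : a.2 ≠ 0 := fun h ↦ by simp [h] at hab
  obtain ⟨A, B, -, -, -, hU, hA, hB⟩ := hc
  let g : C(ℝ × ℝ, ℝ × ℝ) := ⟨fun q ↦ (q.2, a.2 * Real.exp q.1), by fun_prop⟩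
  have hg : IsOpenEmbedding g := (Homeomorph.prodComm ℝ ℝ).isOpenEmbedding.comp
    (IsOpenEmbedding.prodMap
      ((Homeomorph.mulLeft₀ a.2 ha).isOpenEmbedding.comp Real.isOpenEmbedding_exp) .id)
  have harc : IsArcDisc L.curve (φ.comp g) := isArcDisc_comp hφ ((Set.union_comm _ _).trans hU) hB
    hA (fun q ↦ mul_ne_zero ha (Real.exp_pos _).ne') fun q ↦ Iff.rfl
  have h1 : g (0, a.1) = a := by simp [g]
  have h2 : g (Real.log (b.2 / a.2), b.1) = b := by
    have : 0 < b.2 / a.2 := by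
      rw [div_pos_iff]; rw [mul_pos_iff] at hab; tauto
    ext
    · rfl
    · simp [g, Real.exp_log this, mul_div_cancel₀ _ ha]
  have := h.add_eq_one_of_mul_neg (φ := φ.comp g) (a := (0, a.1))
    (b := (Real.log (b.2 / a.2), b.1)) (hφ.comp hg) harc hab'
  rwa [ContinuousMap.comp_apply, ContinuousMap.comp_apply, h1, h2] at this

/-- Adjacent quadrants have different colors. For opposite quadrants the path goes through the
adjacent quadrant of `(b.1, a.2)`; two points of one quadrant are both compared with `(b.1, -b.2)`.
-/
lemma IsColoring.isColoredDisc_of_isCrossingDisc (h : L.IsColoring col) (hφ : IsOpenEmbedding φ)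
    (hc : IsCrossingDisc L.curve φ) : L.IsColoredDisc col φ := by
  intro a b ha hb
  rw [mem_support_iff_of_isCrossingDisc hφ hc, not_or] at ha hb
  rw [integral, sum_period_of_isCrossingDisc hφ hc ha.1 hb.1 ha.2 hb.2]
  have hb1 := mul_self_pos.2 hb.1
  have hb2 := mul_self_pos.2 hb.2
  have ha1 := mul_self_pos.2 ha.1
  rcases (mul_ne_zero ha.1 hb.1).lt_or_gt with h2 | h2 <;>
    rcases (mul_ne_zero ha.2 hb.2).lt_or_gt with h1 | h1
  · rw [if_pos h2, if_pos h1]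
    have e1 := h.add_eq_one_of_isCrossingDisc_left (a := a) (b := (b.1, a.2)) hφ hc ha1 h1
    have e2 := h.add_eq_one_of_isCrossingDisc_right (a := (b.1, a.2)) (b := b) hφ hc hb2 h2
    linear_combination -e1 - e2 + add_self_zmod (col (φ (b.1, a.2)))
  · rw [if_pos h2, if_neg h1.not_gt, add_zero]
    exact (h.add_eq_one_of_isCrossingDisc_right hφ hc h1 h2).symm
  · rw [if_neg h2.not_gt, if_pos h1, zero_add]
    exact (h.add_eq_one_of_isCrossingDisc_left hφ hc h2 h1).symm
  · rw [if_neg h2.not_gt, if_neg h1.not_gt]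
    have e1 := h.add_eq_one_of_isCrossingDisc_right (a := a) (b := (b.1, -b.2)) hφ hc h1
      (by simpa using h2)
    have e2 := h.add_eq_one_of_isCrossingDisc_right (a := b) (b := (b.1, -b.2)) hφ hc hb2
      (by simpa using hb1)
    linear_combination -e1 - e2 + add_self_zmod (col (φ (b.1, -b.2))) - add_self_zmod 1

/-- Each point lies in a colored disc. -/
lemma IsColoring.exists_isColoredDisc [T2Space X] [ChartedSpace (EuclideanSpace ℝ (Fin 2)) X]
    (h : L.IsColoring col) (x : X) :
    ∃ φ : C(ℝ × ℝ, X), IsOpenEmbedding φ ∧ x ∈ Set.range φ ∧ L.IsColoredDisc col φ := by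
  by_cases hx : x ∈ L.support
  · obtain ⟨φ, hφ, hxφ, harc | hc⟩ := exists_disc_of_mem_support hx
    · exact ⟨φ, hφ, hxφ, h.isColoredDisc_of_isArcDisc hφ harc⟩
    · exact ⟨φ, hφ, hxφ, h.isColoredDisc_of_isCrossingDisc hφ hc⟩
  · obtain ⟨φ, hφ, h0, hr⟩ := exists_disc_subset (isClosed_support.isOpen_compl.mem_nhds hx)
    refine ⟨φ, hφ, ⟨0, h0⟩, fun a b _ _ ↦ ?_⟩
    rw [integral_segmentForm_of_disjoint hr, h.eq_of_isPreconnected _ hr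
      (isPreconnected_range φ.continuous) (φ a) ⟨a, rfl⟩ (φ b) ⟨b, rfl⟩, add_self_zmod]

end LinkDiagram

/-! ### The residue formula for a checkerboard coloring -/

section Form

variable {X : Type u} [TopologicalSpace X] {ω η : Form X} {F G : X → ZMod 2} {V : Set X} {x : X}

lemma PrimitiveAt.congr_form (h : PrimitiveAt ω F x) (e : ω x = η x) : PrimitiveAt η F x := by
  rwa [PrimitiveAt, e] at h

lemma PrimitiveAt.congr_fun (h : PrimitiveAt ω F x) (e : F =ᶠ[𝓝 x] G) : PrimitiveAt ω G x := by
  filter_upwards [h, e] with z hz hz'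
  rw [← hz', ← e.self_of_nhds, hz]

lemma closedAt_of_primitiveAt (hV : IsOpen V) (h : ∀ x ∈ V, PrimitiveAt ω F x) (hx : x ∈ V) :
    ClosedAt ω x := by
  filter_upwards [eventually_eventually_nhds.2 (h x hx), hV.mem_nhds hx] with y hy hyV
  filter_upwards [hy, h y hyV] with z hz hz'
  have hyy := hy.self_of_nhds
  linear_combination hz + hz' - hyy - add_self_zmod (F z) + add_self_zmod (F y)

end Form

namespace LinkDiagram

variable {X : Type u} [TopologicalSpace X] {n : ℕ} {L : LinkDiagram X n} {col : X → ZMod 2}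
  {ω η : Form X} {φ : C(ℝ × ℝ, X)} {a b : ℝ × ℝ} {x z : X}

lemma AlmostClosed.finite_residue (h : L.AlmostClosed ω) : {z | residue ω z ≠ 0}.Finite := by
  obtain ⟨Z, hZ, -, hZc⟩ := h
  exact hZ.subset fun z hz ↦ by_contra fun hz' ↦ hz (hZc z hz').residue_eq_zero

lemma AlmostClosed.notMem_support (h : L.AlmostClosed ω) (hz : residue ω z ≠ 0) :
    z ∉ L.support := fun h' ↦ hz (h.closedAt h').residue_eq_zero

lemma AlmostClosed.finite_support (h : L.AlmostClosed ω) :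
    (Function.support fun z ↦ col z * residue ω z).Finite :=
  h.finite_residue.subset fun _ hz ↦ right_ne_zero_of_mul hz

variable (L col) in
/-- The almost closed form satisfies the residue formula: its integral along the diagram is the sum
of its residues in the regions of color `1`. -/
def ResidueFormula (ω : Form X) : Prop :=
  L.AlmostClosed ω ∧ L.integral ω = ∑ᶠ z, col z * residue ω z

lemma residueFormula_of_closedAt (h : ∀ x, ClosedAt ω x) (h0 : L.integral ω = 0) :
    L.ResidueFormula col ω := by
  refine ⟨almostClosed_of_closedAt h, ?_⟩
  rw [h0, finsum_eq_zero_of_forall_eq_zero fun z ↦ by rw [(h z).residue_eq_zero, mul_zero]]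

lemma residueFormula_zero : L.ResidueFormula col 0 :=
  residueFormula_of_closedAt (fun _ ↦ closedAt_zero)
    (integral_eq_zero (fun _ _ ↦ closedAt_zero) (F := 0) fun y _ ↦ by simp [PrimitiveAt])

lemma ResidueFormula.smul (h : L.ResidueFormula col ω) (k : ZMod 2) :
    L.ResidueFormula col (k • ω) := by
  have : k = 0 ∨ k = 1 := by revert k; decide
  rcases this with rfl | rfl
  · rw [zero_smul]
    exact residueFormula_zero
  · rwa [one_smul]

/-- The residues sit at the two ends, so the weighted sum is the sum of the two end colors, which is
what a colored disc gives for the integral. -/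
lemma residueFormula_segmentForm [T2Space X] (hφ : IsOpenEmbedding φ) (h : L.IsColoredDisc col φ)
    (ha : φ a ∉ L.support) (hb : φ b ∉ L.support) :
    L.ResidueFormula col (segmentForm φ a b) := by
  classical
  refine ⟨almostClosed_segmentForm hφ ha hb, ?_⟩
  have hs (y : X) : (Function.support fun z ↦ col z * if z = y then 1 else 0).Finite := by
    refine (Set.finite_singleton y).subset fun z hz ↦ ?_
    by_contra hzy
    exact hz (by simp [show z ≠ y from hzy])
  have he (y : X) : ∑ᶠ z, (col z * if z = y then 1 else 0) = col y := by
    rw [finsum_eq_single _ y fun z hz ↦ by simp [hz]]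
    simp
  simp_rw [residue_segmentForm hφ, mul_add]
  rw [finsum_add_distrib (hs _) (hs _), he, he, h a b ha hb]

lemma AlmostClosed.sum {ι : Type*} {s : Finset ι} {ω : ι → Form X}
    (h : ∀ i ∈ s, L.AlmostClosed (ω i)) : L.AlmostClosed (∑ i ∈ s, ω i) := by
  classical
  induction s using Finset.induction_on with
  | empty => exact almostClosed_of_closedAt fun _ ↦ closedAt_zero
  | insert i s hi ih =>
    rw [Finset.sum_insert hi]
    exact (h i (by simp)).add (ih fun j hj ↦ h j (by simp [hj]))

/-- Removing the removable singularities of an almost closed form. -/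
lemma AlmostClosed.exists_normalization [T1Space X] (hω : L.AlmostClosed ω) {T V : Set X}
    (hT : T.Finite) (hTL : ∀ x ∈ T, x ∉ L.support) (hV : IsOpen V) {F : X → ZMod 2}
    (hF : ∀ x ∈ V, x ∉ T → PrimitiveAt ω F x) :
    ∃ ω' : Form X, L.AlmostClosed ω' ∧ (L.ResidueFormula col ω' → L.ResidueFormula col ω) ∧
      (∀ x, residue ω x = 0 → ClosedAt ω' x) ∧ (∀ x ∈ V, PrimitiveAt ω' F x) := by
  have hω' := hω
  obtain ⟨Z, hZ, hZL, hZc⟩ := hω'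
  obtain ⟨ω', h1, h2, h3, h4⟩ := exists_closed_extension (hZ.union hT)
    (fun x hx ↦ hZc x fun h ↦ hx (.inl h)) hV (F := F) fun x hx hx' ↦ hF x hx fun h ↦ hx' (.inr h)
  have hZTL : ∀ x ∈ Z ∪ T, x ∉ L.support := by
    rintro x (h | h)
    exacts [hZL x h, hTL x h]
  refine ⟨ω', ⟨Z ∪ T, hZ.union hT, hZTL, fun x hx ↦ h2 x (.inl hx)⟩, fun h ↦ ⟨hω, ?_⟩,
    fun x hx ↦ h2 x (.inr (residue_eq_zero_iff.1 hx)), h3⟩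
  -- The normalized form agrees with `ω` on the diagram and has the same residues, so the two
  -- formulas coincide.
  rw [← integral_congr fun x hx ↦ h1 x fun hx' ↦ hZTL x hx' hx, h.2]
  simp_rw [h4]

variable [ChartedSpace (EuclideanSpace ℝ (Fin 2)) X]

lemma ResidueFormula.add [T1Space X] (h : L.ResidueFormula col ω) (h' : L.ResidueFormula col η) :
    L.ResidueFormula col (ω + η) := by
  refine ⟨h.1.add h'.1, ?_⟩
  simp_rw [h.1.residue_add h'.1, mul_add]
  rw [finsum_add_distrib h.1.finite_support h'.1.finite_support, h.1.integral_add h'.1, h.2, h'.2]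

lemma ResidueFormula.of_add [T1Space X] (h : L.ResidueFormula col (ω + η))
    (h' : L.ResidueFormula col η) : L.ResidueFormula col ω := by
  have := h.add h'
  rwa [add_assoc, form_add_self, add_zero] at this

lemma ResidueFormula.sum [T1Space X] {ι : Type*} {s : Finset ι} {ω : ι → Form X}
    (h : ∀ i ∈ s, L.ResidueFormula col (ω i)) : L.ResidueFormula col (∑ i ∈ s, ω i) := by
  classical
  induction s using Finset.induction_on with
  | empty => exact residueFormula_zero
  | insert i s hi ih =>
    rw [Finset.sum_insert hi]
    exact (h i (by simp)).add (ih fun j hj ↦ h j (by simp [hj]))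

lemma AlmostClosed.residue_sum [T1Space X] {ι : Type*} {s : Finset ι} {ω : ι → Form X}
    (h : ∀ i ∈ s, L.AlmostClosed (ω i)) :
    residue (∑ i ∈ s, ω i) z = ∑ i ∈ s, residue (ω i) z := by
  classical
  induction s using Finset.induction_on with
  | empty => exact closedAt_zero.residue_eq_zero
  | insert i s hi ih =>
    have hs : ∀ j ∈ s, L.AlmostClosed (ω j) := fun j hj ↦ h j (by simp [hj])
    rw [Finset.sum_insert hi, Finset.sum_insert hi,
      (h i (by simp)).residue_add (AlmostClosed.sum hs), ih hs]

end LinkDiagram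

/-! ### Grids in discs -/

/-- The homothety `p ↦ o + ε p` of the plane. -/
def scaling (o : ℝ × ℝ) (ε : ℝ) : C(ℝ × ℝ, ℝ × ℝ) := ⟨fun p ↦ o + ε • p, by fun_prop⟩

lemma isOpenEmbedding_scaling (o : ℝ × ℝ) {ε : ℝ} (hε : ε ≠ 0) :
    IsOpenEmbedding (scaling o ε) :=
  ((Homeomorph.smulOfNeZero ε hε).trans (Homeomorph.addLeft o)).isOpenEmbedding

lemma scaling_surjective (o : ℝ × ℝ) {ε : ℝ} (hε : ε ≠ 0) : Function.Surjective (scaling o ε) :=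
  ((Homeomorph.smulOfNeZero ε hε).trans (Homeomorph.addLeft o)).surjective

lemma image_segment_scaling (o : ℝ × ℝ) (ε : ℝ) (a b : ℝ × ℝ) :
    scaling o ε '' segment ℝ a b = segment ℝ (scaling o ε a) (scaling o ε b) := by
  have := image_segment ℝ (ε • AffineMap.id ℝ (ℝ × ℝ) + AffineMap.const ℝ (ℝ × ℝ) o) a b
  convert this using 1
  · congr 1
    ext p <;> simp [scaling, add_comm]
  · simp [scaling, add_comm]

lemma cross_scaling (o : ℝ × ℝ) (ε : ℝ) (a b q : ℝ × ℝ) :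
    cross (scaling o ε a) (scaling o ε b) (scaling o ε q) = ε ^ 2 * cross a b q := by
  simp [cross, scaling]
  ring

lemma segmentForm_scaling {X : Type u} [TopologicalSpace X] (φ : C(ℝ × ℝ, X)) (o : ℝ × ℝ) {ε : ℝ}
    (hε : ε ≠ 0) (a b : ℝ × ℝ) : segmentForm (φ.comp (scaling o ε)) a b =
      segmentForm φ (scaling o ε a) (scaling o ε b) := by
  have h1 : φ.comp (scaling o ε) '' segment ℝ a b =
      φ '' segment ℝ (scaling o ε a) (scaling o ε b) := by
    rw [← image_segment_scaling, ContinuousMap.coe_comp, Set.image_comp]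
  have h2 : φ.comp (scaling o ε) '' {q | 0 < cross a b q} =
      φ '' {q | 0 < cross (scaling o ε a) (scaling o ε b) q} := by
    rw [ContinuousMap.coe_comp, Set.image_comp]
    congr 1
    ext q
    constructor
    · rintro ⟨p, hp, rfl⟩
      rw [Set.mem_ofPred_eq, cross_scaling]
      exact mul_pos (by positivity) hp
    · intro hq
      obtain ⟨p, rfl⟩ := scaling_surjective o hε q
      rw [Set.mem_ofPred_eq, cross_scaling] at hq
      exact ⟨p, pos_of_mul_pos_right hq (by positivity), rfl⟩
  ext x z
  unfold segmentForm
  rw [h1, h2]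

lemma LinkDiagram.IsColoredDisc.comp_scaling {X : Type u} [TopologicalSpace X] {n : ℕ}
    {L : LinkDiagram X n} {col : X → ZMod 2} {φ : C(ℝ × ℝ, X)} (h : L.IsColoredDisc col φ)
    (o : ℝ × ℝ) {ε : ℝ} (hε : ε ≠ 0) : L.IsColoredDisc col (φ.comp (scaling o ε)) := by
  intro a b ha hb
  rw [segmentForm_scaling φ o hε]
  exact h _ _ ha hb

/-- The points of the plane with integral coordinates. -/
def latticePoint (c : ℤ × ℤ) : ℝ × ℝ := (c.1, c.2)

/-- The coordinates of the lower left corner of the unit square containing the point. -/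
def floorPoint (p : ℝ × ℝ) : ℤ × ℤ := (⌊p.1⌋, ⌊p.2⌋)

/-- Each lattice point imposes an open dense condition on the offset `o`; there are countably many,
so Baire's theorem provides a small offset meeting all of them. -/
lemma exists_scaling {U : Set (ℝ × ℝ)} (hd : Dense U) (hU : IsOpen U) (ε : ℝ) :
    ∃ o : ℝ × ℝ, ‖o‖ < 1 ∧ ∀ c, scaling o ε (latticePoint c) ∈ U := by
  obtain ⟨o, ho, ho'⟩ := (dense_iInter_of_isOpen
    (fun c : ℤ × ℤ ↦ hU.preimage (continuous_add_const (ε • latticePoint c)))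
    fun c : ℤ × ℤ ↦ hd.preimage (isOpenMap_add_right (ε • latticePoint c))).inter_open_nonempty
      (Metric.ball 0 1) Metric.isOpen_ball ⟨0, by simp⟩
  exact ⟨o, by simpa using ho, fun c ↦ Set.mem_iInter.1 ho' c⟩

/-- Inside a disc there is a fine grid with vertices off a nowhere dense closed set. -/
lemma exists_grid {X : Type u} [TopologicalSpace X] {φ : C(ℝ × ℝ, X)} (hφ : IsOpenEmbedding φ)
    {A V S : Set X} (hA : IsClosed A) (hV : IsOpen V) (hAV : A ⊆ V) (hS : IsClosed S)
    (hS' : Dense Sᶜ) (r : ℝ) :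
    ∃ (o : ℝ × ℝ) (ε : ℝ) (m : ℕ), ε ≠ 0 ∧ (∀ c, φ (scaling o ε (latticePoint c)) ∉ S) ∧
      Metric.closedBall 0 r ⊆ scaling o ε '' Metric.ball 0 m ∧
      ∀ p q, ‖p‖ ≤ m + 1 → φ (scaling o ε p) ∈ A → dist p q ≤ 3 → φ (scaling o ε q) ∈ V := by
  -- The radius `|r| + 5` is large enough for the images of all `p` with `‖p‖ ≤ m + 1`, since below
  -- `‖o‖ < 1`, `ε ≤ 1` and `ε * m ≤ |r| + 2`. The bound `3 * ε < δ` then turns grid distance `3`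
  -- into distance less than `δ`.
  obtain ⟨δ, hδ, hδV⟩ := IsCompact.exists_thickening_subset_open
    ((isCompact_closedBall (0 : ℝ × ℝ) (|r| + 5)).inter_right (hA.preimage φ.continuous))
    (hV.preimage φ.continuous) fun p hp ↦ hAV hp.2
  obtain ⟨ε, hε, hε1, hεδ⟩ : ∃ ε : ℝ, 0 < ε ∧ ε ≤ 1 ∧ 3 * ε < δ :=
    ⟨min 1 (δ / 4), by positivity, min_le_left _ _, by
      have := min_le_right 1 (δ / 4)
      linarith⟩
  obtain ⟨o, ho, hoS⟩ := exists_scaling (hS'.preimage hφ.isOpenMap)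
    (hS.isOpen_compl.preimage φ.continuous) ε
  have hm := Nat.lt_floor_add_one ((|r| + 1) / ε)
  have hm' : (⌊(|r| + 1) / ε⌋₊ : ℝ) ≤ (|r| + 1) / ε := Nat.floor_le (by positivity)
  rw [le_div_iff₀ hε] at hm'
  rw [div_lt_iff₀ hε] at hm
  have hr := le_abs_self r
  -- This `m` satisfies `ε * m > |r| + 1`, which covers the closed ball of radius `r` in spite of
  -- the offset `o`.
  refine ⟨o, ε, ⌊(|r| + 1) / ε⌋₊ + 1, hε.ne', hoS, fun q hq ↦ ?_, fun p q hp hpA hpq ↦ ?_⟩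
  · obtain ⟨p, rfl⟩ := scaling_surjective o hε.ne' q
    refine ⟨p, ?_, rfl⟩
    rw [mem_closedBall_zero_iff] at hq
    rw [mem_ball_zero_iff]
    have h1 : ε * ‖p‖ = ‖scaling o ε p - o‖ := by
      simp [scaling, norm_smul, abs_of_pos hε]
    have h2 := norm_sub_le (scaling o ε p) o
    push_cast
    by_contra! h3
    have h4 := mul_le_mul_of_nonneg_left h3 hε.le
    linarith
  · have h1 : ‖scaling o ε p‖ ≤ ‖o‖ + ε * ‖p‖ := by
      refine (norm_add_le _ _).trans_eq ?_
      rw [norm_smul, Real.norm_of_nonneg hε.le]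
    push_cast at hp
    have h4 := mul_le_mul_of_nonneg_left hp hε.le
    refine hδV (Metric.mem_thickening_iff.2 ⟨scaling o ε p, ⟨?_, hpA⟩, ?_⟩)
    · rw [mem_closedBall_zero_iff]
      linarith
    · have : dist (scaling o ε q) (scaling o ε p) = ε * dist p q := by
        change dist (o + ε • q) (o + ε • p) = _
        rw [dist_add_left, dist_smul₀, Real.norm_of_nonneg hε.le, dist_comm]
      rw [this]
      have := mul_le_mul_of_nonneg_left hpq hε.le
      linarith

lemma dist_floorPoint_le {p q : ℝ × ℝ} (hq : q ∈ segment ℝ p (latticePoint (floorPoint p))) :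
    dist p q ≤ 1 := by
  have h1 : latticePoint (floorPoint p) ∈ Metric.closedBall p 1 := by
    rw [mem_closedBall_iff_norm, ← norm_neg, Prod.norm_def, max_le_iff]
    simp only [latticePoint, floorPoint, neg_sub, Prod.fst_sub, Prod.snd_sub, Real.norm_eq_abs]
    exact ⟨by rw [Int.self_sub_floor, Int.abs_fract]; exact (Int.fract_lt_one _).le,
      by rw [Int.self_sub_floor, Int.abs_fract]; exact (Int.fract_lt_one _).le⟩
  rw [dist_comm]
  exact (convex_closedBall p 1).segment_subset (Metric.mem_closedBall_self zero_le_one) h1 hq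

lemma norm_latticePoint_floorPoint_le {p : ℝ × ℝ} {m : ℕ} (hp : ‖p‖ ≤ m) :
    ‖latticePoint (floorPoint p)‖ ≤ m := by
  rw [Prod.norm_def, max_le_iff, Real.norm_eq_abs, Real.norm_eq_abs, abs_le, abs_le] at hp ⊢
  have key (t : ℝ) (h : -(m : ℝ) ≤ t ∧ t ≤ m) : -(m : ℝ) ≤ ⌊t⌋ ∧ (⌊t⌋ : ℝ) ≤ m := by
    refine ⟨?_, (Int.floor_le t).trans h.2⟩
    have : (-(m : ℤ)) ≤ ⌊t⌋ := Int.le_floor.2 (by push_cast; exact h.1)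
    exact_mod_cast this
  exact ⟨key _ hp.1, key _ hp.2⟩

namespace LinkDiagram

variable {X : Type u} [TopologicalSpace X] {n : ℕ} {L : LinkDiagram X n} {col : X → ZMod 2}
  {ω : Form X} {φ : C(ℝ × ℝ, X)}

/-- Moving the singularities in a square to the vertices of the grid. -/
lemma AlmostClosed.exists_moved [T2Space X] [ChartedSpace (EuclideanSpace ℝ (Fin 2)) X]
    (hω : L.AlmostClosed ω) (hφ : IsOpenEmbedding φ) (hcol : L.IsColoredDisc col φ)
    (hlat : ∀ c, φ (latticePoint c) ∉ L.support) {m : ℕ} {A V : Set X} (hV : IsOpen V)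
    (hAV : A ⊆ V) {F : X → ZMod 2} (hF : ∀ x ∈ V, PrimitiveAt ω F x)
    (hm : ∀ p q, ‖p‖ ≤ m + 1 → φ p ∈ A → dist p q ≤ 3 → φ q ∈ V) :
    ∃ (ω' : Form X) (V' : Set X), L.AlmostClosed ω' ∧
      (L.ResidueFormula col ω' → L.ResidueFormula col ω) ∧ IsOpen V' ∧ A ⊆ V' ∧
      (∀ x ∈ V', PrimitiveAt ω' F x) ∧
      (∀ p q, ‖p‖ ≤ m + 1 → φ p ∈ A → dist p q ≤ 2 → φ q ∈ V') ∧
      ∀ p, ‖p‖ ≤ m → (∀ c, p ≠ latticePoint c) → ClosedAt ω' (φ p) := by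
  classical
  have hfin : {p | residue ω (φ p) ≠ 0 ∧ ‖p‖ ≤ m}.Finite :=
    (hω.finite_residue.preimage hφ.injective.injOn).subset fun p hp ↦ hp.1
  let P := hfin.toFinset
  have hP (p) : p ∈ P ↔ residue ω (φ p) ≠ 0 ∧ ‖p‖ ≤ m := by simp [P]
  have hPV (p) (hp : p ∈ P) : φ p ∉ V := fun h ↦
    ((hP p).1 hp).1 (closedAt_of_primitiveAt hV hF h).residue_eq_zero
  -- The segment from a singular point to the corner of its cell: adding its form moves the residue
  -- to that corner.
  let s (p : ℝ × ℝ) : Form X := segmentForm φ p (latticePoint (floorPoint p))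
  have hs (p) (hp : p ∈ P) : L.ResidueFormula col (s p) :=
    residueFormula_segmentForm hφ hcol (hω.notMem_support ((hP p).1 hp).1) (hlat _)
  -- Off the segments the form is unchanged, so `F` remains a primitive on `V'`.
  let V' : Set X := V \ ⋃ p ∈ P, φ '' segment ℝ p (latticePoint (floorPoint p))
  have hV' : IsOpen V' :=
    hV.sdiff (Set.Finite.isClosed_biUnion P.finite_toSet fun p _ ↦ isClosed_image_segment φ _ _)
  -- A point on one of the segments is within `1` of the singular point at its start. If it were
  -- also within `2` of `A`, this singular point would lie in `V`, where the form is closed. Hence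
  -- the margin drops from `3` to `2`.
  have hnear (p q) (hp : ‖p‖ ≤ m + 1) (hpA : φ p ∈ A) (hpq : dist p q ≤ 2) : φ q ∈ V' := by
    refine ⟨hm p q hp hpA (hpq.trans (by norm_num)), fun h ↦ ?_⟩
    simp only [Set.mem_iUnion] at h
    obtain ⟨p', hp', q', hq', e⟩ := h
    rw [hφ.injective e] at hq'
    refine hPV p' hp' (hm p p' hp hpA ?_)
    have := dist_floorPoint_le hq'
    have := dist_triangle_right p p' q
    linarith
  have hAV' : A ⊆ V' := by
    refine fun x hx ↦ ⟨hAV hx, fun h ↦ ?_⟩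
    have h' := h
    simp only [Set.mem_iUnion] at h'
    obtain ⟨p, hp, q, hq, rfl⟩ := h'
    have hq' : ‖q‖ ≤ m := by
      have := (convex_closedBall (0 : ℝ × ℝ) (m : ℝ)).segment_subset
        (mem_closedBall_zero_iff.2 ((hP p).1 hp).2)
        (mem_closedBall_zero_iff.2 (norm_latticePoint_floorPoint_le ((hP p).1 hp).2)) hq
      simpa using this
    exact (hnear q q (by linarith) hx (by simp)).2 h
  have hF' (x) (hx : x ∈ V') : PrimitiveAt (ω + ∑ p ∈ P, s p) F x := by
    refine (hF x hx.1).congr_form ?_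
    have : (∑ p ∈ P, s p) x = 0 := by
      rw [Finset.sum_apply]
      refine Finset.sum_eq_zero fun p hp ↦ segmentForm_of_notMem fun h ↦ hx.2 ?_
      simp only [Set.mem_iUnion]
      exact ⟨p, hp, h⟩
    rw [Pi.add_apply, this, add_zero]
  have hsum : L.ResidueFormula col (∑ p ∈ P, s p) := ResidueFormula.sum hs
  obtain ⟨ω', h1, h2, h3, h4⟩ := (hω.add hsum.1).exists_normalization (col := col)
    Set.finite_empty (by simp) hV' fun x hx _ ↦ hF' x hx
  refine ⟨ω', V', h1, fun h ↦ (h2 h).of_add hsum, hV', hAV', h4, hnear, fun q hq hqc ↦ h3 _ ?_⟩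
  rw [hω.residue_add hsum.1, AlmostClosed.residue_sum fun p hp ↦ (hs p hp).1]
  have hres (p) (_ : p ∈ P) : residue (s p) (φ q) = if q = p then 1 else 0 := by
    rw [residue_segmentForm hφ]
    simp [hφ.injective.eq_iff, hqc]
  rw [Finset.sum_congr rfl hres, Finset.sum_ite_eq]
  by_cases h0 : residue ω (φ q) = 0
  · rw [if_neg (by simp [hP, h0]), h0, add_zero]
  · rw [if_pos ((hP q).2 ⟨h0, hq⟩)]
    have : residue ω (φ q) = 1 := by
      generalize residue ω (φ q) = k at h0
      revert k
      decide
    rw [this, add_self_zmod]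

end LinkDiagram

/-! ### Primitives on the cells of a grid and their jumps along the edges -/

section Cells

variable {Ω : Form (ℝ × ℝ)} {p q : ℝ × ℝ} {c : ℤ × ℤ}

/-- The half-open unit square with lower left corner `c`. -/
def cell (c : ℤ × ℤ) : Set (ℝ × ℝ) := floorPoint ⁻¹' {c}

lemma mem_cell : p ∈ cell c ↔ (c.1 ≤ p.1 ∧ p.1 < c.1 + 1) ∧ (c.2 ≤ p.2 ∧ p.2 < c.2 + 1) := by
  rw [cell, Set.mem_preimage, Set.mem_singleton_iff, floorPoint, Prod.ext_iff, Int.floor_eq_iff,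
    Int.floor_eq_iff]

/-- The lower left corner is an extreme point of the half-open square, so its removal keeps
convexity. The remaining set contains no vertex, hence no singularity after these have been moved.
-/
lemma convex_cell_diff (c : ℤ × ℤ) : Convex ℝ (cell c \ {latticePoint c}) := by
  rw [convex_iff_forall_pos]
  rintro p ⟨hp, hpc⟩ q ⟨hq, -⟩ a b ha hb hab
  rw [mem_cell] at hp hq
  obtain rfl : b = 1 - a := by linarith
  constructor
  · rw [mem_cell]
    simp only [Prod.fst_add, Prod.snd_add, Prod.smul_fst, Prod.smul_snd, smul_eq_mul]
    refine ⟨⟨?_, ?_⟩, ?_, ?_⟩ <;> nlinarith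
  · intro h
    simp only [latticePoint, Set.mem_singleton_iff, Prod.ext_iff, Prod.fst_add, Prod.snd_add,
      Prod.smul_fst, Prod.smul_snd, smul_eq_mul] at h
    refine hpc (Prod.ext ?_ ?_)
    · refine le_antisymm ?_ hp.1.1
      by_contra! h1
      have h1 : (c.1 : ℝ) < p.1 := h1
      nlinarith
    · refine le_antisymm ?_ hp.2.1
      by_contra! h1
      have h1 : (c.2 : ℝ) < p.2 := h1
      nlinarith

lemma exists_isPrimitiveOn_cell (h : ∀ p ∈ cell c \ {latticePoint c}, ClosedAt Ω p) :
    ∃ F, IsPrimitiveOn Ω F (cell c \ {latticePoint c}) := by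
  have hne : (cell c \ {latticePoint c}).Nonempty := by
    refine ⟨(c.1 + 1 / 2, c.2 + 1 / 2), mem_cell.2 ⟨⟨?_, ?_⟩, ?_, ?_⟩, ?_⟩
    any_goals norm_num
    simp [latticePoint]
  have := (convex_cell_diff c).contractibleSpace hne
  exact exists_isPrimitiveOn h

/-- Two primitives on the two parts of a convex open set differ by a jump. -/
lemma exists_jump {D S : Set (ℝ × ℝ)} (hD : Convex ℝ D) (hDo : IsOpen D) (h : ∀ p ∈ D, ClosedAt Ω p)
    (hS : IsPreconnected (D ∩ S)) (hS' : IsPreconnected (D \ S)) {G : ℝ × ℝ → ZMod 2}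
    (hG : IsPrimitiveOn Ω G (D ∩ S)) (hG' : IsPrimitiveOn Ω G (D \ S)) :
    ∃ k : ZMod 2, ∀ p ∈ D, PrimitiveAt Ω (G + k • S.indicator 1) p := by
  rcases D.eq_empty_or_nonempty with rfl | hne
  · exact ⟨0, by simp⟩
  have := hD.contractibleSpace hne
  -- `G` differs from the global primitive `H` by a constant on each part; the jump is the
  -- difference of the two constants.
  obtain ⟨H, hH⟩ := exists_isPrimitiveOn h
  have const {T : Set (ℝ × ℝ)} (hT : _root_.IsPreconnected T) (hTG : IsPrimitiveOn Ω G T)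
      (hTD : T ⊆ D) : ∃ k, ∀ p ∈ T, G p + H p = k := by
    rcases T.eq_empty_or_nonempty with rfl | ⟨q, hq⟩
    · exact ⟨0, by simp⟩
    · exact ⟨G q + H q, fun p hp ↦ hTG.add_eq_add hT (hH.mono hTD) hp hq⟩
  obtain ⟨k, hk⟩ := const hS hG Set.inter_subset_left
  obtain ⟨k', hk'⟩ := const hS' hG' Set.sdiff_subset
  refine ⟨k + k', fun p hp ↦ IsPrimitiveOn.primitiveAt (IsPrimitiveOn.congr_fun
    (hH.add_const k') fun q hq ↦ ?_) (hDo.mem_nhds hp)⟩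
  by_cases hqS : q ∈ S
  · have := hk q ⟨hq, hqS⟩
    simp only [Pi.add_apply, Pi.smul_apply, Set.indicator_of_mem hqS, Pi.one_apply, smul_eq_mul]
    linear_combination this + add_self_zmod k - add_self_zmod (H q)
  · have := hk' q ⟨hq, hqS⟩
    simp only [Pi.add_apply, Pi.smul_apply, Set.indicator_of_notMem hqS, smul_zero]
    linear_combination this - add_self_zmod (H q)

lemma mem_segment_vertical :
    p ∈ segment ℝ (latticePoint c) (latticePoint (c.1, c.2 + 1)) ↔
      p.1 = c.1 ∧ c.2 ≤ p.2 ∧ p.2 ≤ c.2 + 1 := by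
  rw [mem_segment_iff]
  simp only [latticePoint, Prod.ext_iff, Prod.fst_add, Prod.snd_add, Prod.smul_fst, Prod.smul_snd,
    Prod.fst_sub, Prod.snd_sub, smul_eq_mul, Int.cast_add, Int.cast_one, Set.mem_Icc]
  constructor
  · rintro ⟨t, ⟨h0, h1⟩, h2, h3⟩
    refine ⟨?_, ?_, ?_⟩ <;> nlinarith
  · rintro ⟨h1, h2, h3⟩
    exact ⟨p.2 - c.2, ⟨by linarith, by linarith⟩, by rw [h1]; ring, by ring⟩

lemma mem_segment_horizontal :
    p ∈ segment ℝ (latticePoint (c.1 + 1, c.2)) (latticePoint c) ↔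
      p.2 = c.2 ∧ c.1 ≤ p.1 ∧ p.1 ≤ c.1 + 1 := by
  rw [segment_symm, mem_segment_iff]
  simp only [latticePoint, Prod.ext_iff, Prod.fst_add, Prod.snd_add, Prod.smul_fst, Prod.smul_snd,
    Prod.fst_sub, Prod.snd_sub, smul_eq_mul, Int.cast_add, Int.cast_one, Set.mem_Icc]
  constructor
  · rintro ⟨t, ⟨h0, h1⟩, h2, h3⟩
    refine ⟨?_, ?_, ?_⟩ <;> nlinarith
  · rintro ⟨h1, h2, h3⟩
    exact ⟨p.1 - c.1, ⟨by linarith, by linarith⟩, by ring, by rw [h1]; ring⟩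

lemma cross_vertical : cross (latticePoint c) (latticePoint (c.1, c.2 + 1)) q = c.1 - q.1 := by
  simp [cross, latticePoint]

/-- The edge runs from right to left so that its positive side is the half-plane below, as in
`exists_horizontal_jump`. -/
lemma cross_horizontal : cross (latticePoint (c.1 + 1, c.2)) (latticePoint c) q = c.2 - q.2 := by
  simp [cross, latticePoint]

lemma norm_lt_iff {r : ℝ} : ‖p‖ < r ↔ (-r < p.1 ∧ p.1 < r) ∧ (-r < p.2 ∧ p.2 < r) := by
  rw [Prod.norm_def, max_lt_iff, Real.norm_eq_abs, Real.norm_eq_abs, abs_lt, abs_lt]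

lemma norm_le_iff {r : ℝ} : ‖p‖ ≤ r ↔ (-r ≤ p.1 ∧ p.1 ≤ r) ∧ (-r ≤ p.2 ∧ p.2 ≤ r) := by
  rw [Prod.norm_def, max_le_iff, Real.norm_eq_abs, Real.norm_eq_abs, abs_le, abs_le]

end Cells

/-! ### Forms with prescribed jumps along the edges of a grid. -/

section GridForm

variable {X : Type u} [TopologicalSpace X] {φ : C(ℝ × ℝ, X)} {m : ℕ} {p q : ℝ × ℝ}
  {k l : ℤ × ℤ → ZMod 2}

/-- The form with jump `k c` across the vertical edge and jump `l c` across the horizontal edge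
starting at each vertex `c`, for the edges inside the square of radius `m`. -/
def gridForm (φ : C(ℝ × ℝ, X)) (m : ℕ) (k l : ℤ × ℤ → ZMod 2) : Form X :=
  ∑ c ∈ Finset.Ioo (-m : ℤ) m ×ˢ Finset.Ico (-m : ℤ) m,
      k c • segmentForm φ (latticePoint c) (latticePoint (c.1, c.2 + 1)) +
    ∑ c ∈ Finset.Ico (-m : ℤ) m ×ˢ Finset.Ioo (-m : ℤ) m,
      l c • segmentForm φ (latticePoint (c.1 + 1, c.2)) (latticePoint c)

/-- The vertices of the grid in the square of radius `m`. -/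
def gridVertices (φ : C(ℝ × ℝ, X)) (m : ℕ) : Set X :=
  (fun c ↦ φ (latticePoint c)) '' (Set.Icc (-m : ℤ) m ×ˢ Set.Icc (-m : ℤ) m)

lemma finite_gridVertices : (gridVertices φ m).Finite :=
  ((Set.finite_Icc _ _).prod (Set.finite_Icc _ _)).image _

/-- Edges on the boundary of the square are excluded from the index set, so an edge touches the
boundary only at a vertex. Consequently the grid form is zero outside the open square except at
vertices. -/
lemma mem_of_mem_vertical {c : ℤ × ℤ} (hc : c ∈ Finset.Ioo (-m : ℤ) m ×ˢ Finset.Ico (-m : ℤ) m)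
    (hp : p.1 = c.1 ∧ c.2 ≤ p.2 ∧ p.2 ≤ c.2 + 1) : ‖p‖ < m ∨ φ p ∈ gridVertices φ m := by
  obtain ⟨h1, h2, h3⟩ := hp
  rw [Finset.mem_product, Finset.mem_Ioo, Finset.mem_Ico] at hc
  rcases h2.eq_or_lt with h2 | h2
  · exact .inr ⟨c, by simp only [Set.mem_prod, Set.mem_Icc]; lia, by simp [latticePoint, ← h1, h2]⟩
  rcases h3.eq_or_lt with h3 | h3
  · exact .inr ⟨(c.1, c.2 + 1), by simp only [Set.mem_prod, Set.mem_Icc]; lia,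
      by simp [latticePoint, ← h1, ← h3]⟩
  have e1 : (-m : ℝ) < c.1 := by exact_mod_cast hc.1.1
  have e2 : (c.1 : ℝ) < m := by exact_mod_cast hc.1.2
  have e3 : (-m : ℝ) ≤ c.2 := by exact_mod_cast hc.2.1
  have e4 : (c.2 + 1 : ℝ) ≤ m := by exact_mod_cast hc.2.2
  exact .inl (norm_lt_iff.2 ⟨⟨h1 ▸ e1, h1 ▸ e2⟩, by linarith, by linarith⟩)

lemma mem_of_mem_horizontal {c : ℤ × ℤ}
    (hc : c ∈ Finset.Ico (-m : ℤ) m ×ˢ Finset.Ioo (-m : ℤ) m)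
    (hp : p.2 = c.2 ∧ c.1 ≤ p.1 ∧ p.1 ≤ c.1 + 1) : ‖p‖ < m ∨ φ p ∈ gridVertices φ m := by
  obtain ⟨h1, h2, h3⟩ := hp
  rw [Finset.mem_product, Finset.mem_Ioo, Finset.mem_Ico] at hc
  rcases h2.eq_or_lt with h2 | h2
  · exact .inr ⟨c, by simp only [Set.mem_prod, Set.mem_Icc]; lia, by simp [latticePoint, ← h1, h2]⟩
  rcases h3.eq_or_lt with h3 | h3
  · exact .inr ⟨(c.1 + 1, c.2), by simp only [Set.mem_prod, Set.mem_Icc]; lia,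
      by simp [latticePoint, ← h1, ← h3]⟩
  have e1 : (-m : ℝ) < c.2 := by exact_mod_cast hc.2.1
  have e2 : (c.2 : ℝ) < m := by exact_mod_cast hc.2.2
  have e3 : (-m : ℝ) ≤ c.1 := by exact_mod_cast hc.1.1
  have e4 : (c.1 + 1 : ℝ) ≤ m := by exact_mod_cast hc.1.2
  exact .inl (norm_lt_iff.2 ⟨⟨by linarith, by linarith⟩, h1 ▸ e1, h1 ▸ e2⟩)

lemma gridForm_of_notMem {x : X} (hx : x ∉ φ '' Metric.ball 0 m) (hx' : x ∉ gridVertices φ m) :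
    gridForm φ m k l x = 0 := by
  rw [gridForm, Pi.add_apply, Finset.sum_apply, Finset.sum_apply, Finset.sum_eq_zero,
    Finset.sum_eq_zero, add_zero]
  · intro c hc
    rw [Pi.smul_apply, segmentForm_of_notMem, smul_zero]
    rintro ⟨p, hp, rfl⟩
    exact (mem_of_mem_horizontal hc (mem_segment_horizontal.1 hp)).elim
      (fun h ↦ hx ⟨p, mem_ball_zero_iff.2 h, rfl⟩) hx'
  · intro c hc
    rw [Pi.smul_apply, segmentForm_of_notMem, smul_zero]
    rintro ⟨p, hp, rfl⟩
    exact (mem_of_mem_vertical hc (mem_segment_vertical.1 hp)).elim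
      (fun h ↦ hx ⟨p, mem_ball_zero_iff.2 h, rfl⟩) hx'

open Classical in
lemma gridForm_apply (hφ : IsOpenEmbedding φ) : gridForm φ m k l (φ p) (φ q) =
    ∑ c ∈ Finset.Ioo (-m : ℤ) m ×ˢ Finset.Ico (-m : ℤ) m,
      (k c * if (p.1 = c.1 ∧ c.2 ≤ p.2 ∧ p.2 ≤ c.2 + 1) ∧ q.1 < c.1 then 1 else 0) +
    ∑ c ∈ Finset.Ico (-m : ℤ) m ×ˢ Finset.Ioo (-m : ℤ) m,
      (l c * if (p.2 = c.2 ∧ c.1 ≤ p.1 ∧ p.1 ≤ c.1 + 1) ∧ q.2 < c.2 then 1 else 0) := by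
  simp only [gridForm, Pi.add_apply, Finset.sum_apply, Pi.smul_apply, segmentForm_apply hφ,
    mem_segment_vertical, mem_segment_horizontal, cross_vertical, cross_horizontal, sub_pos,
    smul_eq_mul]

/-- A point in the interior of an edge lies on no other edge, so a single term of the sum survives.
-/
lemma gridForm_apply_vertical (hφ : IsOpenEmbedding φ) {c : ℤ × ℤ} (hp : ‖p‖ < m)
    (hp1 : p.1 = c.1) (hp2 : c.2 < p.2) (hp3 : p.2 < c.2 + 1) :
    gridForm φ m k l (φ p) (φ q) = k c * if q.1 < c.1 then 1 else 0 := by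
  classical
  rw [norm_lt_iff, hp1] at hp
  have e1 : -(m : ℤ) < c.1 := by exact_mod_cast hp.1.1
  have e2 : c.1 < m := by exact_mod_cast hp.1.2
  have e3 : -(m : ℤ) < c.2 + 1 := by exact_mod_cast hp.2.1.trans hp3
  have e4 : c.2 < m := by exact_mod_cast hp2.trans hp.2.2
  rw [gridForm_apply hφ, Finset.sum_eq_single c, Finset.sum_eq_zero, add_zero]
  · simp [hp1, hp2.le, hp3.le]
  · intro d _
    rw [if_neg, mul_zero]
    rintro ⟨⟨h, -, -⟩, -⟩
    rw [h] at hp2 hp3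
    norm_cast at hp2 hp3
    lia
  · intro d _ hd
    rw [if_neg, mul_zero]
    rintro ⟨⟨h1, h2, h3⟩, -⟩
    rw [hp1] at h1
    norm_cast at h1
    have h4 := h2.trans_lt hp3
    have h5 := hp2.trans_le h3
    norm_cast at h4 h5
    exact hd (Prod.ext h1.symm (by lia))
  · intro h
    refine absurd ?_ h
    simp only [Finset.mem_product, Finset.mem_Ioo, Finset.mem_Ico]
    lia

lemma gridForm_apply_horizontal (hφ : IsOpenEmbedding φ) {c : ℤ × ℤ} (hp : ‖p‖ < m)
    (hp1 : p.2 = c.2) (hp2 : c.1 < p.1) (hp3 : p.1 < c.1 + 1) :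
    gridForm φ m k l (φ p) (φ q) = l c * if q.2 < c.2 then 1 else 0 := by
  classical
  rw [norm_lt_iff, hp1] at hp
  have e1 : -(m : ℤ) < c.2 := by exact_mod_cast hp.2.1
  have e2 : c.2 < m := by exact_mod_cast hp.2.2
  have e3 : -(m : ℤ) < c.1 + 1 := by exact_mod_cast hp.1.1.trans hp3
  have e4 : c.1 < m := by exact_mod_cast hp2.trans hp.1.2
  rw [gridForm_apply hφ, Finset.sum_eq_zero, Finset.sum_eq_single c, zero_add]
  · simp [hp1, hp2.le, hp3.le]
  · intro d _ hd
    rw [if_neg, mul_zero]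
    rintro ⟨⟨h1, h2, h3⟩, -⟩
    rw [hp1] at h1
    norm_cast at h1
    have h4 := h2.trans_lt hp3
    have h5 := hp2.trans_le h3
    norm_cast at h4 h5
    exact hd (Prod.ext (by lia) h1.symm)
  · intro h
    refine absurd ?_ h
    simp only [Finset.mem_product, Finset.mem_Ioo, Finset.mem_Ico]
    lia
  · intro d _
    rw [if_neg, mul_zero]
    rintro ⟨⟨h, -, -⟩, -⟩
    rw [h] at hp2 hp3
    norm_cast at hp2 hp3
    lia

lemma gridForm_apply_interior (hφ : IsOpenEmbedding φ) {c : ℤ × ℤ} (hp0 : c.1 < p.1)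
    (hp1 : p.1 < c.1 + 1) (hp2 : c.2 < p.2) (hp3 : p.2 < c.2 + 1) :
    gridForm φ m k l (φ p) (φ q) = 0 := by
  classical
  rw [gridForm_apply hφ, Finset.sum_eq_zero, Finset.sum_eq_zero, add_zero]
  · intro d _
    rw [if_neg, mul_zero]
    rintro ⟨⟨h, -, -⟩, -⟩
    rw [h] at hp2 hp3
    norm_cast at hp2 hp3
    lia
  · intro d _
    rw [if_neg, mul_zero]
    rintro ⟨⟨h, -, -⟩, -⟩
    rw [h] at hp0 hp1
    norm_cast at hp0 hp1
    lia

/-- The open rectangle formed by two neighbouring cells and the interior of their common edge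
contains no vertex. The edge belongs to the right cell, which explains the strict inequality in the
indicator. -/
lemma exists_vertical_jump {Ω : Form (ℝ × ℝ)} {G : ℝ × ℝ → ZMod 2} {c : ℤ × ℤ}
    (h : ∀ p ∈ Set.Ioo (c.1 - 1 : ℝ) (c.1 + 1) ×ˢ Set.Ioo (c.2 : ℝ) (c.2 + 1), ClosedAt Ω p)
    (hG : IsPrimitiveOn Ω G (cell c \ {latticePoint c}))
    (hG' : IsPrimitiveOn Ω G (cell (c.1 - 1, c.2) \ {latticePoint (c.1 - 1, c.2)})) :
    ∃ k : ZMod 2, ∀ p ∈ Set.Ioo (c.1 - 1 : ℝ) (c.1 + 1) ×ˢ Set.Ioo (c.2 : ℝ) (c.2 + 1),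
      PrimitiveAt Ω (G + k • (Prod.fst ⁻¹' Set.Iio (c.1 : ℝ)).indicator 1) p := by
  have hD : Convex ℝ (Set.Ioo (c.1 - 1 : ℝ) (c.1 + 1) ×ˢ Set.Ioo (c.2 : ℝ) (c.2 + 1)) :=
    (convex_Ioo _ _).prod (convex_Ioo _ _)
  refine exists_jump hD (isOpen_Ioo.prod isOpen_Ioo) h
    (hD.inter ((convex_Iio _).linear_preimage (LinearMap.fst ℝ ℝ ℝ))).isPreconnected ?_
    (hG'.mono ?_) (hG.mono ?_)
  · rw [Set.sdiff_eq, ← Set.preimage_compl, Set.compl_Iio]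
    exact (hD.inter ((convex_Ici _).linear_preimage (LinearMap.fst ℝ ℝ ℝ))).isPreconnected
  · rintro p ⟨⟨h1, h2⟩, h3⟩
    refine ⟨mem_cell.2 ?_, fun h ↦ h2.1.ne' (congrArg Prod.snd h)⟩
    have h3 : p.1 < c.1 := h3
    push_cast
    exact ⟨⟨h1.1.le, by linarith⟩, h2.1.le, h2.2⟩
  · rintro p ⟨⟨h1, h2⟩, h3⟩
    exact ⟨mem_cell.2 ⟨⟨not_lt.1 h3, h1.2⟩, h2.1.le, h2.2⟩,
      fun h ↦ h2.1.ne' (congrArg Prod.snd h)⟩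

lemma exists_horizontal_jump {Ω : Form (ℝ × ℝ)} {G : ℝ × ℝ → ZMod 2} {c : ℤ × ℤ}
    (h : ∀ p ∈ Set.Ioo (c.1 : ℝ) (c.1 + 1) ×ˢ Set.Ioo (c.2 - 1 : ℝ) (c.2 + 1), ClosedAt Ω p)
    (hG : IsPrimitiveOn Ω G (cell c \ {latticePoint c}))
    (hG' : IsPrimitiveOn Ω G (cell (c.1, c.2 - 1) \ {latticePoint (c.1, c.2 - 1)})) :
    ∃ k : ZMod 2, ∀ p ∈ Set.Ioo (c.1 : ℝ) (c.1 + 1) ×ˢ Set.Ioo (c.2 - 1 : ℝ) (c.2 + 1),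
      PrimitiveAt Ω (G + k • (Prod.snd ⁻¹' Set.Iio (c.2 : ℝ)).indicator 1) p := by
  have hD : Convex ℝ (Set.Ioo (c.1 : ℝ) (c.1 + 1) ×ˢ Set.Ioo (c.2 - 1 : ℝ) (c.2 + 1)) :=
    (convex_Ioo _ _).prod (convex_Ioo _ _)
  refine exists_jump hD (isOpen_Ioo.prod isOpen_Ioo) h
    (hD.inter ((convex_Iio _).linear_preimage (LinearMap.snd ℝ ℝ ℝ))).isPreconnected ?_
    (hG'.mono ?_) (hG.mono ?_)
  · rw [Set.sdiff_eq, ← Set.preimage_compl, Set.compl_Iio]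
    exact (hD.inter ((convex_Ici _).linear_preimage (LinearMap.snd ℝ ℝ ℝ))).isPreconnected
  · rintro p ⟨⟨h1, h2⟩, h3⟩
    refine ⟨mem_cell.2 ?_, fun h ↦ h1.1.ne' (congrArg Prod.fst h)⟩
    have h3 : p.2 < c.2 := h3
    push_cast
    exact ⟨⟨h1.1.le, h1.2⟩, h2.1.le, by linarith⟩
  · rintro p ⟨⟨h1, h2⟩, h3⟩
    exact ⟨mem_cell.2 ⟨⟨h1.1.le, h1.2⟩, not_lt.1 h3, h2.2⟩,
      fun h ↦ h1.1.ne' (congrArg Prod.fst h)⟩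

lemma ne_latticePoint_of_snd {j : ℤ} (h : j < p.2) (h' : p.2 < j + 1) (c : ℤ × ℤ) :
    p ≠ latticePoint c := by
  rintro rfl
  simp only [latticePoint] at h h'
  norm_cast at h h'
  lia

lemma ne_latticePoint_of_fst {j : ℤ} (h : j < p.1) (h' : p.1 < j + 1) (c : ℤ × ℤ) :
    p ≠ latticePoint c := by
  rintro rfl
  simp only [latticePoint] at h h'
  norm_cast at h h'
  lia

/-- Primitives on the cells of the grid are, together, a primitive up to a grid form. -/
lemma exists_gridForm (hφ : IsOpenEmbedding φ) {ω : Form X}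
    (hω : ∀ p, ‖p‖ ≤ m → (∀ c, p ≠ latticePoint c) → ClosedAt ω (φ p)) {G : ℝ × ℝ → ZMod 2}
    (hG : ∀ c : ℤ × ℤ, -(m : ℤ) ≤ c.1 → c.1 < m → -(m : ℤ) ≤ c.2 → c.2 < m →
      IsPrimitiveOn (ω.pullback φ) G (cell c \ {latticePoint c})) :
    ∃ k l, ∀ p, ‖p‖ < m → (∀ c, p ≠ latticePoint c) →
      PrimitiveAt ((ω + gridForm φ m k l).pullback φ) G p := by
  -- Jumps are read off only at edges inside the square; the value `0` at the other edges does not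
  -- enter the grid form.
  have hk (c : ℤ × ℤ) : ∃ k : ZMod 2, -(m : ℤ) < c.1 → c.1 < m → -(m : ℤ) ≤ c.2 → c.2 < m →
      ∀ p ∈ Set.Ioo (c.1 - 1 : ℝ) (c.1 + 1) ×ˢ Set.Ioo (c.2 : ℝ) (c.2 + 1),
        PrimitiveAt (ω.pullback φ) (G + k • (Prod.fst ⁻¹' Set.Iio (c.1 : ℝ)).indicator 1) p := by
    by_cases hc : -(m : ℤ) < c.1 ∧ c.1 < m ∧ -(m : ℤ) ≤ c.2 ∧ c.2 < m
    · obtain ⟨h1, h2, h3, h4⟩ := hc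
      have hcl (p) (hp : p ∈ Set.Ioo (c.1 - 1 : ℝ) (c.1 + 1) ×ˢ Set.Ioo (c.2 : ℝ) (c.2 + 1)) :
          ClosedAt (ω.pullback φ) p := by
        refine ClosedAt.pullback φ.continuous
          (hω p (norm_le_iff.2 ?_) (ne_latticePoint_of_snd hp.2.1 hp.2.2))
        obtain ⟨⟨h5, h6⟩, h7, h8⟩ := hp
        have e1 : (-m : ℝ) + 1 ≤ c.1 := by exact_mod_cast h1
        have e2 : (c.1 : ℝ) + 1 ≤ m := by exact_mod_cast h2
        have e3 : (-m : ℝ) ≤ c.2 := by exact_mod_cast h3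
        have e4 : (c.2 : ℝ) + 1 ≤ m := by exact_mod_cast h4
        exact ⟨⟨by linarith, by linarith⟩, by linarith, by linarith⟩
      obtain ⟨k, hk⟩ := exists_vertical_jump (Ω := ω.pullback φ) hcl
        (hG c h1.le h2 h3 h4) (hG (c.1 - 1, c.2) (by simp only; lia) (by simp only; lia) h3 h4)
      exact ⟨k, fun _ _ _ _ ↦ hk⟩
    · exact ⟨0, fun h1 h2 h3 h4 ↦ absurd ⟨h1, h2, h3, h4⟩ hc⟩
  have hl (c : ℤ × ℤ) : ∃ k : ZMod 2, -(m : ℤ) ≤ c.1 → c.1 < m → -(m : ℤ) < c.2 → c.2 < m →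
      ∀ p ∈ Set.Ioo (c.1 : ℝ) (c.1 + 1) ×ˢ Set.Ioo (c.2 - 1 : ℝ) (c.2 + 1),
        PrimitiveAt (ω.pullback φ) (G + k • (Prod.snd ⁻¹' Set.Iio (c.2 : ℝ)).indicator 1) p := by
    by_cases hc : -(m : ℤ) ≤ c.1 ∧ c.1 < m ∧ -(m : ℤ) < c.2 ∧ c.2 < m
    · obtain ⟨h1, h2, h3, h4⟩ := hc
      have hcl (p) (hp : p ∈ Set.Ioo (c.1 : ℝ) (c.1 + 1) ×ˢ Set.Ioo (c.2 - 1 : ℝ) (c.2 + 1)) :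
          ClosedAt (ω.pullback φ) p := by
        refine ClosedAt.pullback φ.continuous
          (hω p (norm_le_iff.2 ?_) (ne_latticePoint_of_fst hp.1.1 hp.1.2))
        obtain ⟨⟨h5, h6⟩, h7, h8⟩ := hp
        have e1 : (-m : ℝ) ≤ c.1 := by exact_mod_cast h1
        have e2 : (c.1 : ℝ) + 1 ≤ m := by exact_mod_cast h2
        have e3 : (-m : ℝ) + 1 ≤ c.2 := by exact_mod_cast h3
        have e4 : (c.2 : ℝ) + 1 ≤ m := by exact_mod_cast h4
        exact ⟨⟨by linarith, by linarith⟩, by linarith, by linarith⟩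
      obtain ⟨k, hk⟩ := exists_horizontal_jump (Ω := ω.pullback φ) hcl
        (hG c h1 h2 h3.le h4) (hG (c.1, c.2 - 1) h1 h2 (by simp only; lia) (by simp only; lia))
      exact ⟨k, fun _ _ _ _ ↦ hk⟩
    · exact ⟨0, fun h1 h2 h3 h4 ↦ absurd ⟨h1, h2, h3, h4⟩ hc⟩
  choose k hk using hk
  choose l hl using hl
  refine ⟨k, l, fun p hp hpc ↦ ?_⟩
  have hp' := hp
  rw [norm_lt_iff] at hp'
  obtain ⟨⟨b1, b2⟩, b3, b4⟩ := hp'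
  obtain ⟨c, hc⟩ : ∃ c, p ∈ cell c := ⟨floorPoint p, rfl⟩
  have hc' := mem_cell.1 hc
  obtain ⟨⟨h1, h2⟩, h3, h4⟩ := hc'
  have e1 : -(m : ℤ) ≤ c.1 := by
    have : -(m : ℤ) < c.1 + 1 := by exact_mod_cast b1.trans h2
    lia
  have e2 : c.1 < m := by exact_mod_cast h1.trans_lt b2
  have e3 : -(m : ℤ) ≤ c.2 := by
    have : -(m : ℤ) < c.2 + 1 := by exact_mod_cast b3.trans h4
    lia
  have e4 : c.2 < m := by exact_mod_cast h3.trans_lt b4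
  -- The point is a vertex, in the interior of a vertical or a horizontal edge, or in the interior
  -- of a cell. On an edge the grid form supplies the jump that `G` lacks.
  rcases h1.eq_or_lt with h1 | h1 <;> rcases h3.eq_or_lt with h3 | h3
  · exact absurd (Prod.ext h1.symm h3.symm) (hpc c)
  · have e1' : -(m : ℤ) < c.1 := by
      rw [← h1] at b1
      exact_mod_cast b1
    have hind (q : ℝ × ℝ) : (Prod.fst ⁻¹' Set.Iio (c.1 : ℝ)).indicator (1 : ℝ × ℝ → ZMod 2) q =
        if q.1 < c.1 then 1 else 0 := by
      by_cases h : q.1 < c.1 <;> simp [h]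
    filter_upwards [hk c e1' e2 e3 e4 p ⟨⟨by linarith, h2⟩, h3, h4⟩] with q hq
    simp only [Form.pullback, Pi.add_apply, gridForm_apply_vertical hφ hp h1.symm h3 h4]
    simp only [Form.pullback, Pi.add_apply, Pi.smul_apply, smul_eq_mul, hind] at hq
    linear_combination hq
  · have e3' : -(m : ℤ) < c.2 := by
      rw [← h3] at b3
      exact_mod_cast b3
    have hind (q : ℝ × ℝ) : (Prod.snd ⁻¹' Set.Iio (c.2 : ℝ)).indicator (1 : ℝ × ℝ → ZMod 2) q =
        if q.2 < c.2 then 1 else 0 := by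
      by_cases h : q.2 < c.2 <;> simp [h]
    filter_upwards [hl c e1 e2 e3' e4 p ⟨⟨h1, h2⟩, by linarith, h4⟩] with q hq
    simp only [Form.pullback, Pi.add_apply, gridForm_apply_horizontal hφ hp h3.symm h1 h2]
    simp only [Form.pullback, Pi.add_apply, Pi.smul_apply, smul_eq_mul, hind] at hq
    linear_combination hq
  · have hnhds : cell c \ {latticePoint c} ∈ 𝓝 p := by
      refine mem_of_superset ((isOpen_Ioo.prod isOpen_Ioo).mem_nhds
        (show p ∈ Set.Ioo (c.1 : ℝ) (c.1 + 1) ×ˢ Set.Ioo (c.2 : ℝ) (c.2 + 1) from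
          ⟨⟨h1, h2⟩, h3, h4⟩)) fun q hq ↦ ?_
      exact ⟨mem_cell.2 ⟨⟨hq.1.1.le, hq.1.2⟩, hq.2.1.le, hq.2.2⟩,
        ne_latticePoint_of_fst hq.1.1 hq.1.2 c⟩
    filter_upwards [(hG c e1 e2 e3 e4).primitiveAt hnhds] with q hq
    simpa only [Form.pullback, Pi.add_apply, gridForm_apply_interior hφ h1 h2 h3 h4,
      add_zero] using hq

end GridForm

/-! ### Proof of the residue formula -/

lemma dist_le_one_of_mem_cell {p q : ℝ × ℝ} {c : ℤ × ℤ} (hp : p ∈ cell c) (hq : q ∈ cell c) :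
    dist p q ≤ 1 := by
  obtain ⟨⟨h1, h2⟩, h3, h4⟩ := mem_cell.1 hp
  obtain ⟨⟨h5, h6⟩, h7, h8⟩ := mem_cell.1 hq
  rw [dist_eq_norm, norm_le_iff, Prod.fst_sub, Prod.snd_sub]
  exact ⟨⟨by linarith, by linarith⟩, by linarith, by linarith⟩

lemma ne_latticePoint_of_mem_cell {p : ℝ × ℝ} {c : ℤ × ℤ} (hp : p ∈ cell c \ {latticePoint c})
    (d : ℤ × ℤ) : p ≠ latticePoint d := by
  rintro rfl
  have : floorPoint (latticePoint d) = c := hp.1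
  simp only [floorPoint, latticePoint, Int.floor_intCast] at this
  exact hp.2 (by rw [← this]; rfl)

lemma norm_le_of_mem_cell {p : ℝ × ℝ} {c : ℤ × ℤ} {m : ℕ} (hp : p ∈ cell c) (h1 : -(m : ℤ) ≤ c.1)
    (h2 : c.1 < m) (h3 : -(m : ℤ) ≤ c.2) (h4 : c.2 < m) : ‖p‖ ≤ m := by
  obtain ⟨⟨h5, h6⟩, h7, h8⟩ := mem_cell.1 hp
  have e1 : (-m : ℝ) ≤ c.1 := by exact_mod_cast h1
  have e2 : (c.1 : ℝ) + 1 ≤ m := by exact_mod_cast h2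
  have e3 : (-m : ℝ) ≤ c.2 := by exact_mod_cast h3
  have e4 : (c.2 : ℝ) + 1 ≤ m := by exact_mod_cast h4
  exact norm_le_iff.2 ⟨⟨by linarith, by linarith⟩, by linarith, by linarith⟩

namespace LinkDiagram

variable {X : Type u} [TopologicalSpace X] {n : ℕ} {L : LinkDiagram X n} {col : X → ZMod 2}
  {ω : Form X} {φ : C(ℝ × ℝ, X)}

variable (L col) in
/-- The residue formula holds for the forms which have a primitive in a neighbourhood of `A`. -/
def ResidueFormulaNear (A : Set X) : Prop :=
  ∀ (ω : Form X) (V : Set X) (F : X → ZMod 2), L.AlmostClosed ω → IsOpen V → A ⊆ V →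
    (∀ x ∈ V, PrimitiveAt ω F x) → L.ResidueFormula col ω

/-- A form with a global primitive has zero periods and no residues. -/
lemma residueFormulaNear_univ : L.ResidueFormulaNear col Set.univ := by
  intro ω V F _ hV hAV hF
  have hc (x) : ClosedAt ω x := closedAt_of_primitiveAt hV hF (hAV (Set.mem_univ x))
  exact residueFormula_of_closedAt hc
    (integral_eq_zero (fun x _ ↦ hc x) fun x _ ↦ hF x (hAV (Set.mem_univ x)))

variable [T2Space X] [ChartedSpace (EuclideanSpace ℝ (Fin 2)) X]

lemma residueFormula_gridForm (hφ : IsOpenEmbedding φ) (hcol : L.IsColoredDisc col φ)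
    (hlat : ∀ c, φ (latticePoint c) ∉ L.support) (m : ℕ) (k l : ℤ × ℤ → ZMod 2) :
    L.ResidueFormula col (gridForm φ m k l) :=
  (ResidueFormula.sum fun _ _ ↦
    (residueFormula_segmentForm hφ hcol (hlat _) (hlat _)).smul _).add
  (ResidueFormula.sum fun _ _ ↦ (residueFormula_segmentForm hφ hcol (hlat _) (hlat _)).smul _)

/-- Inductive step over the discs of a cover. Singularities in the disc are moved to the vertices of
a fine grid, primitives are chosen cell by cell, equal to `F` on the cells near `A`, and a grid form
absorbs their jumps. The corrected form has a primitive near `A` and on the disc, up to vertices,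
and every correction satisfies the residue formula itself. -/
lemma ResidueFormulaNear.of_union (hφ : IsOpenEmbedding φ) (hcol : L.IsColoredDisc col φ) {r : ℝ}
    {A : Set X} (hA : IsClosed A) (h : L.ResidueFormulaNear col (A ∪ φ '' Metric.closedBall 0 r)) :
    L.ResidueFormulaNear col A := by
  classical
  intro ω V F hω hV hAV hF
  obtain ⟨o, ε, m, hε, hlat, hK, hm⟩ :=
    exists_grid hφ hA hV hAV L.isClosed_support L.dense_compl_support r
  set ψ := φ.comp (scaling o ε) with hψdef
  have hψ : IsOpenEmbedding ψ := hφ.comp (isOpenEmbedding_scaling o hε)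
  have hcolψ : L.IsColoredDisc col ψ := hcol.comp_scaling o hε
  have hlat : ∀ c, ψ (latticePoint c) ∉ L.support := hlat
  have hKψ : φ '' Metric.closedBall 0 r ⊆ ψ '' Metric.ball 0 m := by
    rw [hψdef, ContinuousMap.coe_comp, Set.image_comp]
    exact Set.image_mono hK
  obtain ⟨g, V', hg, hgω, hV', hAV', hF', hm', hcl⟩ :=
    hω.exists_moved hψ hcolψ hlat hV hAV hF hm
  clear_value ψ
  refine hgω ?_
  -- primitives on the cells, equal to the given one near `A`
  let near (c : ℤ × ℤ) : Prop := ∃ p, ‖p‖ ≤ m + 1 ∧ ψ p ∈ A ∧ ∃ q ∈ cell c, dist p q ≤ 1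
  have hcell (c : ℤ × ℤ) : ∃ H : ℝ × ℝ → ZMod 2, (near c → H = F ∘ ψ) ∧
      (-(m : ℤ) ≤ c.1 → c.1 < m → -(m : ℤ) ≤ c.2 → c.2 < m →
        IsPrimitiveOn (g.pullback ψ) H (cell c \ {latticePoint c})) := by
    by_cases hc : near c
    -- Cells have diameter at most `1`, so each point of a near cell is within `2` of `A` and hence
    -- in `V'`.
    · refine ⟨F ∘ ψ, fun _ ↦ rfl, fun _ _ _ _ ↦ PrimitiveAt.isPrimitiveOn fun q hq ↦
        PrimitiveAt.pullback ψ.continuous (hF' _ ?_)⟩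
      obtain ⟨p, hp, hpA, q', hq', hd⟩ := hc
      refine hm' p q hp hpA ?_
      have := dist_le_one_of_mem_cell hq' hq.1
      have := dist_triangle p q' q
      linarith
    · by_cases hcm : -(m : ℤ) ≤ c.1 ∧ c.1 < m ∧ -(m : ℤ) ≤ c.2 ∧ c.2 < m
      · obtain ⟨h1, h2, h3, h4⟩ := hcm
        obtain ⟨H, hH⟩ := exists_isPrimitiveOn_cell (Ω := g.pullback ψ) (c := c) fun p hp ↦
          ClosedAt.pullback ψ.continuous
            (hcl p (norm_le_of_mem_cell hp.1 h1 h2 h3 h4) (ne_latticePoint_of_mem_cell hp))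
        exact ⟨H, fun h ↦ absurd h hc, fun _ _ _ _ ↦ hH⟩
      · exact ⟨0, fun h ↦ absurd h hc, fun h1 h2 h3 h4 ↦ absurd ⟨h1, h2, h3, h4⟩ hcm⟩
  choose H hHnear hH using hcell
  let G (p : ℝ × ℝ) : ZMod 2 := H (floorPoint p) p
  have hG (c : ℤ × ℤ) (h1 : -(m : ℤ) ≤ c.1) (h2 : c.1 < m) (h3 : -(m : ℤ) ≤ c.2) (h4 : c.2 < m) :
      IsPrimitiveOn (g.pullback ψ) G (cell c \ {latticePoint c}) := by
    refine (hH c h1 h2 h3 h4).congr_fun fun p hp ↦ ?_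
    have : floorPoint p = c := hp.1
    simp only [G, this]
  obtain ⟨k, l, hkl⟩ := exists_gridForm hψ hcl hG
  have hu := residueFormula_gridForm hψ hcolψ hlat m k l
  refine ResidueFormula.of_add ?_ hu
  -- a primitive near `A` and on the disc
  let N : Set X := ψ '' (Metric.closedBall 0 m \ Metric.thickening 1 (ψ ⁻¹' A))
  have hN : IsClosed N :=
    (((isCompact_closedBall _ _).diff Metric.isOpen_thickening).image ψ.continuous).isClosed
  let W : Set X := ψ '' Metric.ball 0 m
  have hW : IsOpen W := hψ.isOpenMap _ Metric.isOpen_ball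
  let F' (x : X) : ZMod 2 := if x ∈ W then Function.extend ψ G 0 x else F x
  have hF'V (x) (hx : x ∈ V' \ N) : F' x = F x := by
    by_cases hxW : x ∈ W
    · obtain ⟨p, hp, rfl⟩ := hxW
      simp only [F', if_pos (show ψ p ∈ W from ⟨p, hp, rfl⟩), hψ.injective.extend_apply]
      have hp' := mem_ball_zero_iff.1 hp
      have hpN : p ∈ Metric.thickening 1 (ψ ⁻¹' A) := by
        by_contra hpN
        exact hx.2 ⟨p, ⟨Metric.ball_subset_closedBall hp, hpN⟩, rfl⟩
      obtain ⟨q, hq, hpq⟩ := Metric.mem_thickening_iff.1 hpN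
      -- `p` is within `1` of a point `q` over `A`, so its cell is near. This is where the bound `m
      -- + 1` in `near` is used, as `q` may lie outside the square.
      have : H (floorPoint p) = F ∘ ψ := by
        refine hHnear _ ⟨q, ?_, hq, p, rfl, (dist_comm q p).trans_le hpq.le⟩
        have h1 : ‖q‖ ≤ ‖p‖ + dist p q := by
          rw [dist_eq_norm]
          have := norm_sub_norm_le q p
          rw [norm_sub_rev] at this
          linarith
        linarith
      simp only [G, this, Function.comp]
    · simp only [F', if_neg hxW]
  have hprim (x) (hx : x ∈ V' \ N ∪ W) (hxT : x ∉ gridVertices ψ m) :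
      PrimitiveAt (g + gridForm ψ m k l) F' x := by
    by_cases hxW : x ∈ W
    · have hev : Function.extend ψ G 0 =ᶠ[𝓝 x] F' := by
        filter_upwards [hW.mem_nhds hxW] with y hy
        simp only [F', if_pos hy]
      refine PrimitiveAt.congr_fun ?_ hev
      obtain ⟨p, hp, rfl⟩ := hxW
      have hp := mem_ball_zero_iff.1 hp
      refine (hkl p hp ?_).extend hψ
      rintro c rfl
      refine hxT ⟨c, ?_, rfl⟩
      obtain ⟨⟨h1, h2⟩, h3, h4⟩ := norm_le_iff.1 hp.le
      simp only [latticePoint] at h1 h2 h3 h4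
      exact ⟨⟨by exact_mod_cast h1, by exact_mod_cast h2⟩, by exact_mod_cast h3,
        by exact_mod_cast h4⟩
    · have hxV := hx.resolve_right hxW
      have hev : F =ᶠ[𝓝 x] F' := by
        filter_upwards [(hV'.sdiff hN).mem_nhds hxV] with y hy
        exact (hF'V y hy).symm
      refine PrimitiveAt.congr_fun ((hF' x hxV.1).congr_form ?_) hev
      rw [Pi.add_apply, gridForm_of_notMem hxW hxT, add_zero]
  have hTL : ∀ x ∈ gridVertices ψ m, x ∉ L.support := by
    rintro - ⟨c, -, rfl⟩
    exact hlat c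
  obtain ⟨ω', h1, h2, -, h4⟩ := (hg.add hu.1).exists_normalization (col := col)
    finite_gridVertices hTL ((hV'.sdiff hN).union hW) hprim
  refine h2 (h ω' _ F' h1 ((hV'.sdiff hN).union hW) (Set.union_subset_union ?_ hKψ) h4)
  refine fun x hx ↦ ⟨hAV' hx, ?_⟩
  rintro ⟨p, ⟨-, hp⟩, rfl⟩
  exact hp (Metric.self_subset_thickening one_pos _ hx)

/-- The integral of a closed form along a diagram with a checkerboard coloring vanishes. -/
theorem IsColoring.integral_eq_zero [CompactSpace X] (h : L.IsColoring col)
    (hω : ∀ x, ClosedAt ω x) : L.integral ω = 0 := by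
  classical
  choose φ hφ hx hcol using h.exists_isColoredDisc
  choose p hp using hx
  let K (x : X) : Set X := φ x '' Metric.closedBall 0 (‖p x‖ + 1)
  have hK (x) : K x ∈ 𝓝 x := by
    refine mem_of_superset ((hφ x).isOpenMap _ Metric.isOpen_ball |>.mem_nhds
      ⟨p x, mem_ball_zero_iff.2 (lt_add_one _), hp x⟩)
      (Set.image_mono Metric.ball_subset_closedBall)
  obtain ⟨t, ht⟩ := CompactSpace.elim_nhds_subcover K hK
  -- The formula near a smaller set is the stronger statement. The cover starts as the whole
  -- surface, and its discs are removed one by one until no primitive is required at all.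
  have key (s : Finset X) : L.ResidueFormulaNear col (⋃ x ∈ s, K x) →
      L.ResidueFormulaNear col ∅ := by
    induction s using Finset.induction_on with
    | empty => simp
    | insert x s _ ih =>
      intro hs
      rw [Finset.set_biUnion_insert, Set.union_comm] at hs
      refine ih (hs.of_union (hφ x) (hcol x) ?_)
      exact Set.Finite.isClosed_biUnion s.finite_toSet fun y _ ↦
        ((isCompact_closedBall _ _).image (φ y).continuous).isClosed
  have := key t (by rw [ht]; exact residueFormulaNear_univ) ω ∅ 0 (almostClosed_of_closedAt hω)
    isOpen_empty (Set.Subset.refl _) (by simp)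
  rw [this.2, finsum_eq_zero_of_forall_eq_zero fun z ↦ by rw [(hω z).residue_eq_zero, mul_zero]]

end LinkDiagram

end SurfaceLink

end

open SurfaceLink in
theorem lemma1 {M : Type*} [TopologicalSpace M] [T2Space M] [CompactSpace M] [ConnectedSpace M]
    [ChartedSpace (EuclideanSpace ℝ (Fin 2)) M] {n : ℕ} (L : LinkDiagram M n) :
    L.TwoColorable ↔ ∑ i, loopClass (L.curve i) = 0 := by
  rw [sum_loopClass_eq_zero_iff_period fun x ↦
    (exists_disc_subset (Filter.univ_mem : Set.univ ∈ nhds x)).imp fun _ h ↦ ⟨h.1, h.2.1⟩]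
  constructor
  · intro h ω hω
    obtain ⟨col, hcol⟩ := h.exists_isColoring
    exact hcol.integral_eq_zero hω
  · exact LinkDiagram.twoColorable_of_integral_eq_zero
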